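/- Notation. Let $N\ge 2$ and $M\in\mathbb Z\setminus\{0\}$ be integers and $\zeta,\tau,c\in\mathbb C$. Put $\omega=e^{2i\pi/N}$, $q^s=e^{i\pi\zeta s}$ for $s\in\mathbb C$, $p=e^{2i\pi\tau}$, $p^{1/2}=e^{i\pi\tau}$, $p^*=pq^{-2c}$, i.e. $\tau^*=\tau-c\zeta$. Assume $\operatorname{Im}\zeta,\operatorname{Im}\tau,\operatorname{Im}\tau^*>0$ and $q^2\notin p^{\mathbb Z}\cup (p^*)^{\mathbb Z}$. A spectral parameter is written $z=e^{i\pi\xi}$, and a function of $z$ is understood as a function of $\xi\in\mathbb C$: $q^sz$ and $-p^{1/2}z$ stand for $\xi+s\zeta$ and $\xi+\tau+1$. Let $$(z;p_1,\dots,p_m)_\infty=\prod_{n_i\ge 0}(1-zp_1^{n_1}\cdots p_m^{n_m}),\qquad \Theta_a(z)=(z;a)_\infty(az^{-1};a)_\infty(a;a)_\infty,$$ $$\vartheta\begin{bmatrix}\gamma_1\\ \gamma_2\end{bmatrix}(\xi,\tau)=\sum_{m\in\mathbb Z}e^{i\pi(m+\gamma_1)^2\tau+2i\pi(m+\gamma_1)(\xi+\gamma_2)}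 .$$ Index $N\times N$ matrices by $\mathbb Z/N\mathbb Z$, let $g_{ij}=\omega^i\delta_{ij}$, $g^{1/2}=\operatorname{diag}(e^{i\pi j/N})_{0\le j<N}$, $h_{ij}=\delta_{i+1,j}$, $G=g^{1/2}hg^{1/2}$, $I_{(\alpha_1,\alpha_2)}=g^{\alpha_2}h^{\alpha_1}$, and $$\widetilde R(z,q,p)=\frac{z^{2/N-2}}{\kappa(z^2)}\,\frac{\vartheta\begin{bmatrix}1/2\\1/2\end{bmatrix}(\zeta,\tau)}{\vartheta\begin{bmatrix}1/2\\1/2\end{bmatrix}(\xi+\zeta,\tau)}\sum_{\alpha\in(\mathbb Z/N)^2}\frac{\vartheta\begin{bmatrix}1/2+\alpha_1/N\\1/2+\alpha_2/N\end{bmatrix}(\xi+\zeta/N,\tau)}{N\,\vartheta\begin{bmatrix}1/2+\alpha_1/N\\1/2+\alpha_2/N\end{bmatrix}(\zeta/N,\tau)}\,I_\alpha\otimes I_\alpha^{-1},$$ $$\frac1{\kappa(z^2)}=\frac{(q^{2N}z^{-2};p,q^{2N})_\infty(q^2z^2;p,q^{2N})_\infty(pz^{-2};p,q^{2N})_\infty(pq^{2N-2}z^2;p,q^{2N})_\infty}{(q^{2N}z^2;p,q^{2N})_\infty(q^2z^{-2};p,q^{2N})_\infty(pz^2;p,q^{2N})_\infty(pq^{2N-2}z^{-2};p,q^{2N})_\infty},$$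 $$\widehat R_{12}(z,q,p)=\tau_N(q^{1/2}z^{-1})\,(g^{1/2}\otimes g^{1/2})\,\widetilde R(z,q,p)\,(g^{-1/2}\otimes g^{-1/2}),\qquad \tau_N(z)=z^{2/N-2}\,\frac{\Theta_{q^{2N}}(qz^2)}{\Theta_{q^{2N}}(qz^{-2})},$$ and $\widehat R^*_{12}(z)=\widehat R_{12}(z,q,p^*)$. Algebras. $\mathcal A_{q,p}(\widehat{gl}(N)_c)$ is the unital associative $\mathbb C$-algebra generated by the entries of the $N\times N$ matrices $L(z)$ and of their inverses $L(z)^{-1}$, for all values of the spectral parameter, with the relations $$\widehat R_{12}(z/w)\,L_1(z)\,L_2(w)=L_2(w)\,L_1(z)\,\widehat R^*_{12}(z/w),\qquad L_1=L\otimes\mathbb I,\quad L_2=\mathbb I\otimes L .$$ These are relations with meromorphic coefficients: with $z=e^{i\pi\xi}$, $w=e^{i\pi\eta}$ they are imposed for all $\xi-\eta$ outside a closed discrete set $E\subset\mathbb C$ that contains the singularities of $\widehat R$ and $\widehat R^*$; the choice of $E$ is arbitrary. $\mathcal A_{q,p}(\widehat{sl}(N)_c)$ is its quotient by the relations $q\text{-}\det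 L(z)=q^{c/2}$, where $q\text{-}\det L(z)=\sum_{\sigma\in\mathfrak S_N}\varepsilon(\sigma)\prod_{i=1}^NL_{i,\sigma(i)}(zq^{i-N-1})$, the factors ordered from left to right. In both algebras put $$L^+(z)=L(q^{c/2}z),\qquad L^-(z)=G\,L(-p^{1/2}z)\,G^{-1},\qquad t(z)=\operatorname{Tr}\bigl(L^+(q^{c/2}z)\,L^-(z)^{-1}\bigr).$$ Theorem. Let $(p,q,c)$ lie on the surface $\Sigma_{N,M}$, i.e. $(-p^{1/2})^{NM}=q^{-c-N}$, where the determination is such that the $2/N$-th power of this relation, $p^M=q^{-2(c+N)/N}$, holds too (for $N=2$ the two relations coincide). Then in $\mathcal A_{q,p}(\widehat{gl}(N)_c)$ and in $\mathcal A_{q,p}(\widehat{sl}(N)_c)$, $t(z)$ closes a quadratic exchange algebra: $$t(z)\,t(w)=\mathcal Y_{N,p,q,M}\Bigl(\frac wz\Bigr)\,t(w)\,t(z)$$ as an identity with meromorphic coefficients, that is, for all $z=e^{i\pi\xi}$, $w=e^{i\pi\eta}$ with $\eta-\xi$ outside a closed discrete subset of $\mathbb C$. Here $$\mathcal Y_{N,p,q,M}(x)=\prod_{k=1}^{K}\frac{\Theta_{q^{2N}}(x^2p^{-k})^2\;\Theta_{q^{2N}}(x^2q^2p^k)\;\Theta_{q^{2N}}(x^2q^{-2}p^k)}{\Theta_{q^{2N}}(x^2p^k)^2\;\Theta_{q^{2N}}(x^2q^2p^{-k})\;\Theta_{q^{2N}}(x^2q^{-2}p^{-k})},\qquad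 K=\begin{cases}NM & (M>0),\\ N|M|-1 & (M<0).\end{cases}$$ -/

import Mathlib

/-!
Conventions.  All multiplicative quantities are written through their logarithms, because the
`R`-matrix contains fractional powers: `z = exp (iπξ)`, `q = exp (iπζ)`, `p = exp (2iπτ)`, hence
`q ^ s = exp (iπζs)`, `p ^ (1/2) = exp (iπτ)`, and the multiplications `z ↦ q ^ s z`,
`z ↦ -p ^ (1/2) z` are the translations `ξ ↦ ξ + sζ`, `ξ ↦ ξ + τ + 1`.
-/

open scoped Kronecker

noncomputable section

namespace EllipticAlgebra

open Complex

/-! ### Special functions -/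

/-- `exp (iπx)`. -/
def ePi (x : ℂ) : ℂ := exp (Real.pi * I * x)

/-- The infinite multiple product `(z; p₁, …, p_m)_∞ = ∏_{n_i ≥ 0} (1 - z p₁^{n₁} ⋯ p_m^{n_m})`. -/
def qPoch {m : ℕ} (z : ℂ) (p : Fin m → ℂ) : ℂ :=
  ∏' n : Fin m → ℕ, (1 - z * ∏ i, p i ^ n i)

/-- The Jacobi theta function `Θ_a(z) = (z; a)_∞ (a z⁻¹; a)_∞ (a; a)_∞`. -/
def Theta (a z : ℂ) : ℂ :=
  qPoch z ![a] * qPoch (a * z⁻¹) ![a] * qPoch a ![a]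

/-- The theta function with characteristics `ϑ[γ₁; γ₂](ξ, τ)`. -/
def thetaChar (γ₁ γ₂ ξ τ : ℂ) : ℂ :=
  ∑' m : ℤ, exp (Real.pi * I * (m + γ₁) ^ 2 * τ + 2 * Real.pi * I * (m + γ₁) * (ξ + γ₂))

/-! ### The `R`-matrix -/

section RMatrix

variable (N : ℕ) [NeZero N]

/-- `g_{ij} = ω^i δ_{ij}` with `ω = exp (2iπ/N)`. -/
def gMat : Matrix (ZMod N) (ZMod N) ℂ :=
  Matrix.diagonal fun i => ePi (2 * (i.val : ℂ) / N)

/-- The square root `g^{1/2}`. -/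
def gHalf : Matrix (ZMod N) (ZMod N) ℂ :=
  Matrix.diagonal fun i => ePi ((i.val : ℂ) / N)

/-- `h_{ij} = δ_{i+1,j}`, indices modulo `N`. -/
def hMat : Matrix (ZMod N) (ZMod N) ℂ :=
  Matrix.of fun i j => if i + 1 = j then 1 else 0

/-- `I_{(α₁,α₂)} = g^{α₂} h^{α₁}`. -/
def IMat (α : ZMod N × ZMod N) : Matrix (ZMod N) (ZMod N) ℂ :=
  gMat N ^ α.2.val * hMat N ^ α.1.val

/-- The functions `W_{(α₁,α₂)}(ξ, ζ, τ)`. -/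
def W (α : ZMod N × ZMod N) (ξ ζ τ : ℂ) : ℂ :=
  thetaChar (1 / 2 + (α.1.val : ℂ) / N) (1 / 2 + (α.2.val : ℂ) / N) (ξ + ζ / N) τ /
    (N * thetaChar (1 / 2 + (α.1.val : ℂ) / N) (1 / 2 + (α.2.val : ℂ) / N) (ζ / N) τ)

/-- The normalization factor `1 / κ(z²)`, where `z = exp (iπξ)`. -/
def kappaInv (ξ ζ τ : ℂ) : ℂ :=
  let z := ePi ξ
  let q := ePi ζ
  let p := ePi (2 * τ)
  let b : Fin 2 → ℂ := ![p, q ^ (2 * N)]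
  (qPoch (q ^ (2 * N) * (z ^ 2)⁻¹) b * qPoch (q ^ 2 * z ^ 2) b *
      qPoch (p * (z ^ 2)⁻¹) b * qPoch (p * q ^ (2 * N - 2) * z ^ 2) b) /
    (qPoch (q ^ (2 * N) * z ^ 2) b * qPoch (q ^ 2 * (z ^ 2)⁻¹) b *
      qPoch (p * z ^ 2) b * qPoch (p * q ^ (2 * N - 2) * (z ^ 2)⁻¹) b)

/-- The `N`-elliptic (`ℤ_N`-vertex) `R`-matrix. -/
def RTilde (ξ ζ τ : ℂ) : Matrix (ZMod N × ZMod N) (ZMod N × ZMod N) ℂ :=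
  (ePi (ξ * (2 / N - 2)) * kappaInv N ξ ζ τ *
      (thetaChar (1 / 2) (1 / 2) ζ τ / thetaChar (1 / 2) (1 / 2) (ξ + ζ) τ)) •
    ∑ α : ZMod N × ZMod N, W N α ξ ζ τ • (IMat N α ⊗ₖ (IMat N α)⁻¹)

/-- The gauge-transformed `R`-matrix `R₁₂(z, q, p)`. -/
def RMat (ξ ζ τ : ℂ) : Matrix (ZMod N × ZMod N) (ZMod N × ZMod N) ℂ :=
  (gHalf N ⊗ₖ gHalf N) * RTilde N ξ ζ τ * ((gHalf N)⁻¹ ⊗ₖ (gHalf N)⁻¹)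

/-- `τ_N(z) = z^{2/N-2} Θ_{q^{2N}}(q z²) / Θ_{q^{2N}}(q z⁻²)`, where `z = exp (iπu)`. -/
def tauN (u ζ : ℂ) : ℂ :=
  ePi (u * (2 / N - 2)) *
    (Theta (ePi ζ ^ (2 * N)) (ePi ζ * ePi u ^ 2) /
      Theta (ePi ζ ^ (2 * N)) (ePi ζ * (ePi u ^ 2)⁻¹))

/-- `R̂₁₂(z, q, p) = τ_N(q^{1/2} z⁻¹) R₁₂(z, q, p)`. -/
def RHat (ξ ζ τ : ℂ) : Matrix (ZMod N × ZMod N) (ZMod N × ZMod N) ℂ :=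
  tauN N (ζ / 2 - ξ) ζ • RMat N ξ ζ τ

/-- `R̂*₁₂(z, q, p) = R̂₁₂(z, q, p*)` with `p* = p q^{-2c}`, that is `τ* = τ - cζ`. -/
def RHatStar (ξ ζ τ c : ℂ) : Matrix (ZMod N × ZMod N) (ZMod N × ZMod N) ℂ :=
  RHat N ξ ζ (τ - c * ζ)

/-- The matrix `g^{1/2} h g^{1/2}`. -/
def GMat : Matrix (ZMod N) (ZMod N) ℂ := gHalf N * hMat N * gHalf N

end RMatrix

/-! ### Matrices over an algebra -/

section Operators

variable {N : ℕ} [NeZero N] {A : Type} [Ring A] [Algebra ℂ A]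

/-- A numerical matrix, seen as a matrix over `A`. -/
def scal {n : Type} (X : Matrix n n ℂ) : Matrix n n A := X.map (algebraMap ℂ A)

/-- `X₁ = X ⊗ 𝕀`. -/
def leg₁ (X : Matrix (ZMod N) (ZMod N) A) :
    Matrix (ZMod N × ZMod N) (ZMod N × ZMod N) A := X ⊗ₖ (1 : Matrix (ZMod N) (ZMod N) A)

/-- `X₂ = 𝕀 ⊗ X`. -/
def leg₂ (X : Matrix (ZMod N) (ZMod N) A) :
    Matrix (ZMod N × ZMod N) (ZMod N × ZMod N) A := (1 : Matrix (ZMod N) (ZMod N) A) ⊗ₖ X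

variable (ζ τ c : ℂ) (L : ℂ → Matrix (ZMod N) (ZMod N) A)

/-- `R̂₁₂(z/w) L₁(z) L₂(w)`. -/
def exchangeLHS (ξ η : ℂ) : Matrix (ZMod N × ZMod N) (ZMod N × ZMod N) A :=
  scal (RHat N (ξ - η) ζ τ) * leg₁ (L ξ) * leg₂ (L η)

/-- `L₂(w) L₁(z) R̂*₁₂(z/w)`. -/
def exchangeRHS (ξ η : ℂ) : Matrix (ZMod N × ZMod N) (ZMod N × ZMod N) A :=
  leg₂ (L η) * leg₁ (L ξ) * scal (RHatStar N (ξ - η) ζ τ c)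

/-- The quantum determinant
`∑_σ ε(σ) ∏_{i=1}^N L_{i,σ(i)}(z q^{i-N-1})`, the factors ordered from left to right. -/
def qDet (ξ : ℂ) : A :=
  ∑ σ : Equiv.Perm (ZMod N), ((Equiv.Perm.sign σ : ℤ) : A) *
    ((List.range' 1 N).map fun i : ℕ =>
      L (ξ + ((i : ℂ) - N - 1) * ζ) (i : ZMod N) (σ (i : ZMod N))).prod

/-- `L⁺(z) = L(q^{c/2} z)`. -/
def LPlus (ξ : ℂ) : Matrix (ZMod N) (ZMod N) A := L (ξ + c / 2 * ζ)

/-- `L⁻(z) = (g^{1/2} h g^{1/2}) L(-p^{1/2} z) (g^{1/2} h g^{1/2})⁻¹`. -/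
def LMinus (ξ : ℂ) : Matrix (ZMod N) (ZMod N) A :=
  scal (GMat N) * L (ξ + τ + 1) * scal (GMat N)⁻¹

/-- `t(z) = Tr (L⁺(q^{c/2} z) L⁻(z)⁻¹)`. -/
def transfer (ξ : ℂ) : A :=
  (LPlus ζ c L (ξ + c / 2 * ζ) * Ring.inverse (LMinus τ L ξ)).trace

end Operators

/-! ### The elliptic algebras -/

section Algebras

variable (N : ℕ) [NeZero N]

/-- Generators: the entries of `L(z)` and of its inverse, for every value of the spectral
parameter. -/
inductive Gen : Type
  | L (ξ : ℂ) (i j : ZMod N) : Gen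
  | Linv (ξ : ℂ) (i j : ZMod N) : Gen

/-- The matrix of free generators `L_{ij}(z)`. -/
def freeL (ξ : ℂ) : Matrix (ZMod N) (ZMod N) (FreeAlgebra ℂ (Gen N)) :=
  Matrix.of fun i j => FreeAlgebra.ι ℂ (Gen.L ξ i j)

/-- The matrix of free generators `(L(z)⁻¹)_{ij}`. -/
def freeLinv (ξ : ℂ) : Matrix (ZMod N) (ZMod N) (FreeAlgebra ℂ (Gen N)) :=
  Matrix.of fun i j => FreeAlgebra.ι ℂ (Gen.Linv ξ i j)

variable (ζ τ c : ℂ) (E : Set ℂ)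

/-- The defining relations: `L(z)` is invertible, and
`R̂₁₂(z/w) L₁(z) L₂(w) = L₂(w) L₁(z) R̂*₁₂(z/w)`.  The latter is an identity with meromorphic
coefficients, imposed at all `z/w` outside an exceptional set `E`. -/
inductive GLRel : FreeAlgebra ℂ (Gen N) → FreeAlgebra ℂ (Gen N) → Prop
  | mul_inv (ξ : ℂ) (i j : ZMod N) :
      GLRel ((freeL N ξ * freeLinv N ξ) i j)
        ((1 : Matrix (ZMod N) (ZMod N) (FreeAlgebra ℂ (Gen N))) i j)
  | inv_mul (ξ : ℂ) (i j : ZMod N) :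
      GLRel ((freeLinv N ξ * freeL N ξ) i j)
        ((1 : Matrix (ZMod N) (ZMod N) (FreeAlgebra ℂ (Gen N))) i j)
  | exchange (ξ η : ℂ) (h : ξ - η ∉ E) (a b : ZMod N × ZMod N) :
      GLRel (exchangeLHS ζ τ (freeL N) ξ η a b) (exchangeRHS ζ τ c (freeL N) ξ η a b)

/-- The algebra `𝒜_{q,p}(ĝl(N)_c)`. -/
abbrev EllGL : Type := RingQuot (GLRel N ζ τ c E)

/-- The matrix `L(z)` of `𝒜_{q,p}(ĝl(N)_c)`. -/
def glL (ξ : ℂ) : Matrix (ZMod N) (ZMod N) (EllGL N ζ τ c E) :=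
  (freeL N ξ).map (RingQuot.mkAlgHom ℂ (GLRel N ζ τ c E))

/-- The relation `q-det L(z) = q^{c/2}`. -/
inductive SLRel : EllGL N ζ τ c E → EllGL N ζ τ c E → Prop
  | qdet (ξ : ℂ) :
      SLRel (qDet ζ (glL N ζ τ c E) ξ) (algebraMap ℂ (EllGL N ζ τ c E) (ePi (ζ * (c / 2))))

/-- The algebra `𝒜_{q,p}(ŝl(N)_c) = 𝒜_{q,p}(ĝl(N)_c) / ⟨q-det L - q^{c/2}⟩`. -/
abbrev EllSL : Type := RingQuot (SLRel N ζ τ c E)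

/-- The matrix `L(z)` of `𝒜_{q,p}(ŝl(N)_c)`. -/
def slL (ξ : ℂ) : Matrix (ZMod N) (ZMod N) (EllSL N ζ τ c E) :=
  (glL N ζ τ c E ξ).map (RingQuot.mkAlgHom ℂ (SLRel N ζ τ c E))

/-- `E` is a closed discrete subset of `ℂ` that contains the singularities of the coefficients
`R̂` and `R̂*` of the exchange relation. -/
structure IsExceptionalSet : Prop where
  closed_discrete : Eᶜ ∈ Filter.codiscrete ℂ
  analyticAt_RHat : ∀ δ ∉ E, ∀ a b, AnalyticAt ℂ (fun u => RHat N u ζ τ a b) δ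
  analyticAt_RHatStar : ∀ δ ∉ E, ∀ a b, AnalyticAt ℂ (fun u => RHatStar N u ζ τ c a b) δ

end Algebras

/-! ### The surface and the structure function -/

/-- The surface `Σ_{N,M}`: `(-p^{1/2})^{NM} = q^{-c-N}`.  The `R`-matrix is a function of
`z^{2/N}` and not of `z`, so that the `2/N`-th power of this relation,
`p^M = q^{-2(c+N)/N}`, is part of it. -/
def OnSurface (N : ℕ) (M : ℤ) (ζ τ c : ℂ) : Prop :=
  (-ePi τ) ^ ((N : ℤ) * M) = ePi (ζ * (-c - N)) ∧
    ePi (2 * τ) ^ M = ePi (ζ * (2 / N * (-c - N)))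

/-- The `k`-th factor of the structure function, with `p = exp (2iπτ)`, `q = exp (iπζ)`. -/
def YFactor (N : ℕ) (ζ τ x : ℂ) (k : ℕ) : ℂ :=
  let q := ePi ζ
  let p := ePi (2 * τ)
  let Θ := Theta (q ^ (2 * N))
  (Θ (x ^ 2 * (p ^ k)⁻¹) ^ 2 * Θ (x ^ 2 * q ^ 2 * p ^ k) * Θ (x ^ 2 * (q ^ 2)⁻¹ * p ^ k)) /
    (Θ (x ^ 2 * p ^ k) ^ 2 * Θ (x ^ 2 * q ^ 2 * (p ^ k)⁻¹) *
      Θ (x ^ 2 * (q ^ 2)⁻¹ * (p ^ k)⁻¹))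

/-- The structure function `𝒴_{N,p,q,M}(x)`, for `M ≠ 0`. -/
def Y (N : ℕ) (ζ τ : ℂ) (M : ℤ) (x : ℂ) : ℂ :=
  if 0 < M then ∏ k ∈ Finset.Icc 1 (N * M.natAbs), YFactor N ζ τ x k
  else ∏ k ∈ Finset.Icc 1 (N * M.natAbs - 1), YFactor N ζ τ x k

end EllipticAlgebra

end

open EllipticAlgebra

open scoped Kronecker

noncomputable section

namespace EllipticAlgebra

open Complex

/-! Write x = ξ - η and m(ξ) = L(ξ+cζ) G L(ξ+τ+1)⁻¹ G⁻¹, so that t(ξ) is the trace of m(ξ)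
(`trace_monodromy_eq_transfer`). Up to the scalar `rho`, R̂(x) is ∑ w_α(x; ζ/N) X_α ⊗ X_α⁻¹
(`RHat_eq`), with X_α a gauge-transformed Heisenberg basis and w_α a quotient of theta functions.
Three properties of R̂ are needed. A translation by τ+1 conjugates it by G in the first factor and
multiplies it by `shiftFun` (`eventually_RHat_shift`). It has an explicit inverse
(`eventually_RHat_inv`). Finally, the partial trace of R̂(x-Nζ) T₁ R̂(x)⁻¹ is a constant times Tr T
(`exists_eventually_ptr_RHat`).

Combine the exchange relations of L(ξ+cζ) and of L(ξ+τ+1) with L(η). The matrices R̂*(x+cζ) and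
R̂*(x+τ+1) that occur on the right differ by one quasi-period of R̂*, because τ = τ* + cζ. They
cancel, and L₂(η) m₁(ξ) becomes a scalar times R̂(x+cζ) m₁(ξ) R̂(x)⁻¹ L₂(η)
(`eventually_monodromy_exchange`). On the surface, cζ equals -Nζ - NM(τ+1) modulo N. As N is a
period of R̂, and a multiple of N quasi-period steps leaves no conjugation, R̂(x+cζ) is a scalar
multiple of R̂(x-Nζ) (`OnSurface.exists_eventually_RHat`). Crossing unitarity then collapses the
partial trace: L(η) t(ξ) = K F(x) t(ξ) L(η), with F = `exchFun` and K constant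
(`eventually_L_mul_trace`). Used for L(η+cζ) and for L(η+τ+1)⁻¹, this gives an exchange factor
F(x-τ-1)/F(x-cζ) for the two traces. The constant K drops out and the quotient is `Y`
(`OnSurface.eventually_exchFun`).

The matrix identities reduce to sums over β of w_{β+γ}(x;u) w_β(y;u), possibly weighted by a
character. For γ ≠ 0 such a sum, cleared of its poles in u at the torsion points, is a theta
function of order one twisted by a character (`thetaLike_wSum`). A nontrivial twist and a zero at
the origin force it to vanish, while without twist the zero at the origin is automatic. The diagonal
sums γ = 0 are theta functions of order two in x and are determined by their behaviour at x = 0. The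
scalar identities follow from splitting the double infinite products. -/

/-! ### Infinite products: analyticity, functional equations, non-vanishing. -/

open Filter Topology in
/-- An infinite product `∏ (1 - z c_i)` with `∑ |c_i| < ∞` is an entire function of `z`. -/
lemma differentiable_tprod_one_sub {ι : Type*} {c : ι → ℂ} (hc : Summable fun i => ‖c i‖) :
    Differentiable ℂ fun z : ℂ => ∏' i, (1 - z * c i) := by
  intro z₀
  have key : HasProdLocallyUniformlyOn (fun i (z : ℂ) => 1 + -(z * c i))
      (fun z => ∏' i, (1 + -(z * c i))) (Metric.ball 0 (‖z₀‖ + 1)) := by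
    refine Summable.hasProdLocallyUniformlyOn_one_add (u := fun i => (‖z₀‖ + 1) * ‖c i‖)
      Metric.isOpen_ball (hc.mul_left _) (Eventually.of_forall fun i x hx => ?_) fun i => ?_
    · rw [norm_neg, norm_mul]
      have : ‖x‖ < ‖z₀‖ + 1 := by simpa using hx
      gcongr
    · fun_prop
  have hd := TendstoLocallyUniformlyOn.differentiableOn
    (hasProdLocallyUniformlyOn_iff_tendstoLocallyUniformlyOn.mp key)
    (Eventually.of_forall fun s => DifferentiableOn.fun_finsetProd fun i _ => by fun_prop)
    Metric.isOpen_ball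
  have := hd.differentiableAt (Metric.isOpen_ball.mem_nhds (by simp : z₀ ∈ Metric.ball 0 (‖z₀‖ + 1)))
  simpa only [← sub_eq_add_neg] using this

lemma tprod_one_sub_ne_zero {ι : Type*} {c : ι → ℂ} (hc : Summable fun i => ‖c i‖) {z : ℂ}
    (hz : ∀ i, 1 - z * c i ≠ 0) : ∏' i, (1 - z * c i) ≠ 0 := by
  simp only [sub_eq_add_neg] at hz ⊢
  refine tprod_one_add_ne_zero_of_summable hz ?_
  simpa using hc.mul_left ‖z‖

lemma multipliable_one_sub {ι : Type*} {c : ι → ℂ} (hc : Summable fun i => ‖c i‖) (z : ℂ) :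
    Multipliable fun i => 1 - z * c i := by
  simp only [sub_eq_add_neg]
  refine multipliable_one_add_of_summable ?_
  simpa using hc.mul_left ‖z‖

lemma qPoch_one (z a : ℂ) : qPoch z ![a] = ∏' n : ℕ, (1 - z * a ^ n) := by
  unfold qPoch
  rw [← (Equiv.funUnique (Fin 1) ℕ).symm.tprod_eq]
  simp

lemma qPoch_two (z a b : ℂ) :
    qPoch z ![a, b] = ∏' n : ℕ × ℕ, (1 - z * (a ^ n.1 * b ^ n.2)) := by
  unfold qPoch
  rw [← (finTwoArrowEquiv ℕ).symm.tprod_eq]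
  simp [finTwoArrowEquiv]

lemma summable_norm_pow {a : ℂ} (ha : ‖a‖ < 1) : Summable fun n : ℕ => ‖a ^ n‖ := by
  simpa using summable_geometric_of_lt_one (norm_nonneg a) ha

lemma summable_norm_pow_mul_pow {a b : ℂ} (ha : ‖a‖ < 1) (hb : ‖b‖ < 1) :
    Summable fun n : ℕ × ℕ => ‖a ^ n.1 * b ^ n.2‖ := by
  simp only [norm_mul]
  exact (summable_norm_pow ha).mul_of_nonneg (summable_norm_pow hb)
    (fun _ => norm_nonneg _) (fun _ => norm_nonneg _)

lemma differentiable_qPoch_one {a : ℂ} (ha : ‖a‖ < 1) : Differentiable ℂ fun z => qPoch z ![a] := by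
  simp only [qPoch_one]
  exact differentiable_tprod_one_sub (summable_norm_pow ha)

lemma differentiable_qPoch_two {a b : ℂ} (ha : ‖a‖ < 1) (hb : ‖b‖ < 1) :
    Differentiable ℂ fun z => qPoch z ![a, b] := by
  simp only [qPoch_two]
  exact differentiable_tprod_one_sub (summable_norm_pow_mul_pow ha hb)

lemma qPoch_one_step {a : ℂ} (ha : ‖a‖ < 1) (z : ℂ) :
    qPoch z ![a] = (1 - z) * qPoch (a * z) ![a] := by
  have h : ∀ n : ℕ, 1 - z * a ^ (n + 1) = 1 - a * z * a ^ n := fun n => by ring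
  rw [qPoch_one, qPoch_one, tprod_eq_zero_mul']
  · simp [h]
  · simpa only [h] using multipliable_one_sub (summable_norm_pow ha) (a * z)

/-- The factors with exponent zero of `a` are split off. This and its mirror image in `b` are the
only functional equations of double products used for the normalization: the first governs shifts by
p, the second shifts by q^{2N}. -/
lemma qPoch_two_step_left {a b : ℂ} (ha : ‖a‖ < 1) (hb : ‖b‖ < 1) (z : ℂ) :
    qPoch z ![a, b] = qPoch z ![b] * qPoch (a * z) ![a, b] := by
  have hin : ∀ z : ℂ, ∀ i : ℕ, Multipliable fun j : ℕ => 1 - z * (a ^ i * b ^ j) := fun z i => by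
    simpa only [mul_assoc] using multipliable_one_sub (summable_norm_pow hb) (z * a ^ i)
  have hm := fun z => multipliable_one_sub (summable_norm_pow_mul_pow ha hb) z
  have hout : ∀ z, qPoch z ![a, b] = ∏' i : ℕ, qPoch (z * a ^ i) ![b] := fun z => by
    rw [qPoch_two, (hm z).tprod_prod' (hin z)]
    simp only [qPoch_one, mul_assoc]
  have hout' : Multipliable fun i : ℕ => qPoch (a * z * a ^ i) ![b] := by
    have := ((hm (a * z)).hasProd.prod_fiberwise fun i => (hin _ i).hasProd).multipliable
    simpa only [qPoch_one, mul_assoc] using this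
  have h : ∀ i : ℕ, z * a ^ (i + 1) = a * z * a ^ i := fun i => by ring
  rw [hout, hout, tprod_eq_zero_mul']
  · simp [h]
  · simpa only [h] using hout'

lemma qPoch_two_comm (z a b : ℂ) : qPoch z ![a, b] = qPoch z ![b, a] := by
  rw [qPoch_two, qPoch_two, ← (Equiv.prodComm ℕ ℕ).tprod_eq]
  simp [mul_comm]

lemma qPoch_two_step_right {a b : ℂ} (ha : ‖a‖ < 1) (hb : ‖b‖ < 1) (z : ℂ) :
    qPoch z ![a, b] = qPoch z ![a] * qPoch (b * z) ![a, b] := by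
  rw [qPoch_two_comm, qPoch_two_step_left hb ha, qPoch_two_comm (b * z)]

lemma one_sub_ne_zero_of_norm_lt {z : ℂ} (hz : ‖z‖ < 1) : 1 - z ≠ 0 := by
  intro h
  rw [← sub_eq_zero.mp h, norm_one] at hz
  exact lt_irrefl _ hz

lemma qPoch_one_ne_zero {a z : ℂ} (ha : ‖a‖ < 1) (hz : ∀ n : ℕ, z * a ^ n ≠ 1) :
    qPoch z ![a] ≠ 0 := by
  rw [qPoch_one]
  exact tprod_one_sub_ne_zero (summable_norm_pow ha) fun i => sub_ne_zero.mpr (hz i).symm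

lemma qPoch_one_ne_zero_of_norm_lt {a z : ℂ} (ha : ‖a‖ < 1) (hz : ‖z‖ < 1) :
    qPoch z ![a] ≠ 0 := by
  rw [qPoch_one]
  refine tprod_one_sub_ne_zero (summable_norm_pow ha) fun i => one_sub_ne_zero_of_norm_lt ?_
  rw [norm_mul, norm_pow]
  exact mul_lt_one_of_nonneg_of_lt_one_left (norm_nonneg _) hz (pow_le_one₀ (norm_nonneg _) ha.le)

lemma qPoch_two_ne_zero_of_norm_lt {a b z : ℂ} (ha : ‖a‖ < 1) (hb : ‖b‖ < 1) (hz : ‖z‖ < 1) :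
    qPoch z ![a, b] ≠ 0 := by
  rw [qPoch_two]
  refine tprod_one_sub_ne_zero (summable_norm_pow_mul_pow ha hb) fun i =>
    one_sub_ne_zero_of_norm_lt ?_
  rw [norm_mul, norm_mul, norm_pow, norm_pow]
  exact mul_lt_one_of_nonneg_of_lt_one_left (norm_nonneg _) hz (mul_le_one₀
    (pow_le_one₀ (norm_nonneg _) ha.le) (by positivity) (pow_le_one₀ (norm_nonneg _) hb.le))

/-! ### The exponential `ePi` -/

lemma ePi_add (x y : ℂ) : ePi (x + y) = ePi x * ePi y := by
  simp [ePi, mul_add, exp_add]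

lemma ePi_zero : ePi 0 = 1 := by simp [ePi]

lemma ePi_ne_zero (x : ℂ) : ePi x ≠ 0 := exp_ne_zero _

lemma ePi_neg (x : ℂ) : ePi (-x) = (ePi x)⁻¹ := by
  simp [ePi, exp_neg]

lemma ePi_sub (x y : ℂ) : ePi (x - y) = ePi x / ePi y := by
  rw [sub_eq_add_neg, ePi_add, ePi_neg, div_eq_mul_inv]

lemma ePi_pow (x : ℂ) (n : ℕ) : ePi x ^ n = ePi (n * x) := by
  rw [ePi, ePi, ← exp_nat_mul]; ring_nf

lemma ePi_zpow (x : ℂ) (n : ℤ) : ePi x ^ n = ePi (n * x) := by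
  rw [ePi, ePi, ← exp_int_mul]; ring_nf

lemma ePi_one : ePi 1 = -1 := by
  rw [ePi, mul_one, exp_pi_mul_I]

lemma ePi_two_int (n : ℤ) : ePi (2 * n) = 1 := by
  rw [ePi, exp_eq_one_iff]
  exact ⟨n, by ring⟩

lemma ePi_eq_one_iff (x : ℂ) : ePi (2 * x) = 1 ↔ ∃ n : ℤ, x = n := by
  rw [ePi, exp_eq_one_iff]
  have : (2 * Real.pi * I : ℂ) ≠ 0 := by simp [Real.pi_ne_zero]
  refine exists_congr fun n => ⟨fun h => ?_, fun h => by rw [h]; ring⟩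
  apply mul_left_cancel₀ this
  linear_combination h

lemma norm_ePi (x : ℂ) : ‖ePi x‖ = Real.exp (-(Real.pi * x.im)) := by
  simp [ePi, norm_exp]

lemma norm_ePi_lt_one {x : ℂ} (hx : 0 < x.im) : ‖ePi x‖ < 1 := by
  rw [norm_ePi, Real.exp_lt_one_iff]
  have := mul_pos Real.pi_pos hx
  linarith

@[fun_prop]
lemma differentiable_ePi : Differentiable ℂ ePi := by
  unfold ePi; fun_prop

@[fun_prop]
lemma continuous_ePi : Continuous ePi := differentiable_ePi.continuous

/-! ### Theta functions -/

/-- A doubly quasi-periodic entire function with multipliers of modulus one is constant. -/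
lemma eq_of_quasiPeriodic {τ a b : ℂ} (hτ : 0 < τ.im) (ha : ‖a‖ = 1) (hb : ‖b‖ = 1) {f : ℂ → ℂ}
    (hf : Differentiable ℂ f) (h1 : ∀ x, f (x + 1) = a * f x) (h2 : ∀ x, f (x + τ) = b * f x)
    (x y : ℂ) : f x = f y := by
  have n1 : ∀ n : ℤ, ∀ x, ‖f (x + n)‖ = ‖f x‖ := fun n => by
    induction n using Int.induction_on with
    | zero => simp
    | succ n ih =>
      intro x
      have := h1 (x + n)
      push_cast
      rw [← add_assoc, this, norm_mul, ha, one_mul]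
      exact_mod_cast ih x
    | pred n ih =>
      intro x
      have := h1 (x + ((-n - 1 : ℤ) : ℂ))
      rw [show x + ((-n - 1 : ℤ) : ℂ) + 1 = x + ((-n : ℤ) : ℂ) by push_cast; ring] at this
      rw [← ih x, this, norm_mul, ha, one_mul]
  have n2 : ∀ n : ℤ, ∀ x, ‖f (x + n * τ)‖ = ‖f x‖ := fun n => by
    induction n using Int.induction_on with
    | zero => simp
    | succ n ih =>
      intro x
      have := h2 (x + n * τ)
      rw [show x + ((n + 1 : ℤ) : ℂ) * τ = x + n * τ + τ by push_cast; ring, this, norm_mul, hb,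
        one_mul]
      exact_mod_cast ih x
    | pred n ih =>
      intro x
      have := h2 (x + ((-n - 1 : ℤ) : ℂ) * τ)
      rw [show x + ((-n - 1 : ℤ) : ℂ) * τ + τ = x + ((-n : ℤ) : ℂ) * τ by push_cast; ring] at this
      rw [← ih x, this, norm_mul, hb, one_mul]
  refine hf.apply_eq_apply_of_bounded ?_ x y
  have hK : IsCompact ((fun p : ℝ × ℝ => ‖f (p.1 + p.2 * τ)‖) ''
      (Set.Icc 0 1 ×ˢ Set.Icc 0 1)) := by
    refine (isCompact_Icc.prod isCompact_Icc).image ?_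
    have := hf.continuous
    fun_prop
  obtain ⟨C, hC⟩ := hK.isBounded.exists_norm_le
  refine isBounded_iff_forall_norm_le.mpr ⟨C, ?_⟩
  rintro _ ⟨x, rfl⟩
  -- Real coordinates of `x` in the basis 1, τ. Removing their integer parts moves `x` into the
  -- compact fundamental parallelogram without changing the modulus of `f`.
  set t : ℝ := x.im / τ.im
  set s : ℝ := x.re - t * τ.re
  have hx : x = s + t * τ := by
    apply Complex.ext
    · simp [s]
    · simp [t, hτ.ne']
  have hx' : x = ((Int.fract s : ℝ) : ℂ) + ((Int.fract t : ℝ) : ℂ) * τ + (⌊t⌋ : ℂ) * τ + (⌊s⌋ : ℂ) := by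
    have h1 : (s : ℂ) = ((Int.fract s : ℝ) : ℂ) + (⌊s⌋ : ℂ) := by
      exact_mod_cast (Int.fract_add_floor s).symm
    have h2 : (t : ℂ) = ((Int.fract t : ℝ) : ℂ) + (⌊t⌋ : ℂ) := by
      exact_mod_cast (Int.fract_add_floor t).symm
    rw [hx]
    linear_combination h1 + h2 * τ
  rw [hx', n1, n2]
  have := hC _ ⟨(Int.fract s, Int.fract t), ⟨⟨Int.fract_nonneg _, (Int.fract_lt_one _).le⟩,
    ⟨Int.fract_nonneg _, (Int.fract_lt_one _).le⟩⟩, rfl⟩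
  simpa using this

lemma eq_zero_of_quasiPeriodic {τ a b : ℂ} (hτ : 0 < τ.im) (ha : ‖a‖ = 1) (hb : ‖b‖ = 1)
    (hab : a ≠ 1 ∨ b ≠ 1) {f : ℂ → ℂ} (hf : Differentiable ℂ f)
    (h1 : ∀ x, f (x + 1) = a * f x) (h2 : ∀ x, f (x + τ) = b * f x) (x : ℂ) : f x = 0 := by
  have hc := eq_of_quasiPeriodic hτ ha hb hf h1 h2
  rcases hab with h | h
  · have h1 := h1 x
    rw [hc (x + 1) x] at h1
    have : (a - 1) * f x = 0 := by linear_combination -h1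
    exact (mul_eq_zero.mp this).resolve_left (sub_ne_zero.mpr h)
  · have h2 := h2 x
    rw [hc (x + τ) x] at h2
    have : (b - 1) * f x = 0 := by linear_combination -h2
    exact (mul_eq_zero.mp this).resolve_left (sub_ne_zero.mpr h)

/-- The odd Jacobi theta function in product form, up to a constant. -/
def theta (τ x : ℂ) : ℂ :=
  ePi (-x) * (qPoch (ePi (2 * x)) ![ePi (2 * τ)] *
    qPoch (ePi (2 * τ) * (ePi (2 * x))⁻¹) ![ePi (2 * τ)])

lemma norm_nome_lt_one {τ : ℂ} (hτ : 0 < τ.im) : ‖ePi (2 * τ)‖ < 1 :=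
  norm_ePi_lt_one (by simpa using hτ)

section
variable {τ : ℂ} (hτ : 0 < τ.im)
include hτ

lemma differentiable_theta : Differentiable ℂ (theta τ) := by
  have h := differentiable_qPoch_one (norm_nome_lt_one hτ)
  have h1 : Differentiable ℂ fun x => qPoch (ePi (2 * x)) ![ePi (2 * τ)] :=
    h.comp (by fun_prop : Differentiable ℂ fun x => ePi (2 * x))
  have h2 : Differentiable ℂ fun x => qPoch (ePi (2 * τ) * (ePi (2 * x))⁻¹) ![ePi (2 * τ)] := by
    simp only [← ePi_neg]
    exact h.comp (by fun_prop : Differentiable ℂ fun x => ePi (2 * τ) * ePi (-(2 * x)))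
  unfold theta
  fun_prop

lemma continuous_theta : Continuous (theta τ) := (differentiable_theta hτ).continuous

omit hτ in
lemma theta_add_one (x : ℂ) : theta τ (x + 1) = -theta τ x := by
  have h : ePi (2 * (x + 1)) = ePi (2 * x) := by
    have := ePi_two_int 1
    rw [mul_add, ePi_add]; simp_all
  rw [theta, theta, h, neg_add, ePi_add, ePi_neg 1, ePi_one]
  ring

lemma theta_neg (x : ℂ) : theta τ (-x) = -theta τ x := by
  have hp := norm_nome_lt_one hτ
  have hy : ePi (2 * x) = ePi x * ePi x := by rw [two_mul, ePi_add]
  have h0 := ePi_ne_zero x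
  rw [theta, theta, qPoch_one_step hp (ePi (2 * -x)), qPoch_one_step hp (ePi (2 * x)),
    mul_neg, ePi_neg (2 * x), inv_inv, neg_neg, ePi_neg, hy]
  field_simp
  ring

lemma theta_add_period (x : ℂ) : theta τ (x + τ) = -ePi (-τ - 2 * x) * theta τ x := by
  have hp := norm_nome_lt_one hτ
  have e1 : ePi (2 * τ) * (ePi (2 * (x + τ)))⁻¹ = (ePi (2 * x))⁻¹ := by
    rw [mul_add, ePi_add]
    field_simp [ePi_ne_zero]
  have e2 : ePi (2 * (x + τ)) = ePi (2 * τ) * ePi (2 * x) := by rw [← ePi_add]; ring_nf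
  have e3 : ePi (-τ - 2 * x) = (ePi τ)⁻¹ * (ePi x * ePi x)⁻¹ := by
    rw [ePi_sub, ePi_neg, two_mul, ePi_add, div_eq_mul_inv]
  have hy : ePi (2 * x) = ePi x * ePi x := by rw [two_mul, ePi_add]
  have h0 := ePi_ne_zero x
  have h1 := ePi_ne_zero τ
  rw [theta, theta, e1, e2, qPoch_one_step hp (ePi (2 * x)), qPoch_one_step hp (ePi (2 * x))⁻¹,
    neg_add, ePi_add, e3, ePi_neg, ePi_neg, hy]
  field_simp
  ring

lemma theta_zero : theta τ 0 = 0 := by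
  have := theta_neg hτ 0
  rw [neg_zero] at this
  linear_combination this / 2

lemma exists_lattice_of_theta_eq_zero {x : ℂ} (h : theta τ x = 0) :
    ∃ m n : ℤ, x = m * τ + n := by
  have hp := norm_nome_lt_one hτ
  by_contra! hx
  refine mul_ne_zero (ePi_ne_zero _) (mul_ne_zero (qPoch_one_ne_zero hp fun k hk => ?_)
    (qPoch_one_ne_zero hp fun k hk => ?_)) h
  · rw [ePi_pow, ← ePi_add, show 2 * x + k * (2 * τ) = 2 * (x + k * τ) by ring,
      ePi_eq_one_iff] at hk
    obtain ⟨n, hn⟩ := hk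
    exact hx (-k) n (by push_cast; linear_combination hn)
  · rw [ePi_pow, ← ePi_neg, ← ePi_add, ← ePi_add,
      show 2 * τ + -(2 * x) + k * (2 * τ) = 2 * (τ - x + k * τ) by ring, ePi_eq_one_iff] at hk
    obtain ⟨n, hn⟩ := hk
    exact hx (k + 1) (-n) (by push_cast; linear_combination -hn)

omit hτ in
/-- A property that is invariant under `x ↦ x ± 1` and `x ↦ x ± τ` holds on the whole lattice
coset. -/
lemma lattice_induction {P : ℂ → Prop} {x : ℂ} (h0 : P x) (h1 : ∀ x, P x ↔ P (x + 1))
    (h2 : ∀ x, P x ↔ P (x + τ)) (m n : ℤ) : P (x + (m * τ + n)) := by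
  have hm : P (x + m * τ) := by
    induction m using Int.induction_on with
    | zero => simpa using h0
    | succ m ih =>
      have := (h2 _).mp ih
      push_cast at this ⊢
      rwa [add_mul, one_mul, ← add_assoc]
    | pred m ih =>
      refine (h2 _).mpr ?_
      convert ih using 1
      push_cast; ring
  induction n using Int.induction_on with
  | zero => simpa using hm
  | succ n ih =>
    have := (h1 _).mp ih
    push_cast at this ⊢
    rwa [← add_assoc, ← add_assoc, add_assoc x]
  | pred n ih =>
    refine (h1 _).mpr ?_
    convert ih using 1
    push_cast; ring

lemma theta_lattice (m n : ℤ) : theta τ (m * τ + n) = 0 := by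
  have := lattice_induction (τ := τ) (P := fun x => theta τ x = 0) (theta_zero hτ)
    (fun x => by simp [theta_add_one]) (fun x => by simp [theta_add_period hτ, ePi_ne_zero]) m n
  simpa using this

lemma theta_eq_zero_iff {x : ℂ} : theta τ x = 0 ↔ ∃ m n : ℤ, x = m * τ + n :=
  ⟨exists_lattice_of_theta_eq_zero hτ, by rintro ⟨m, n, rfl⟩; exact theta_lattice hτ m n⟩

/-- The factor 1 - e^{2πix} carries the zero at the origin. What remains there is a product of
values of q-products at arguments of modulus less than one, hence nonzero. -/
lemma deriv_theta_zero : deriv (theta τ) 0 ≠ 0 := by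
  have hp := norm_nome_lt_one hτ
  have hq := differentiable_qPoch_one hp
  set g : ℂ → ℂ := fun x => ePi (-x) * (qPoch (ePi (2 * τ) * ePi (2 * x)) ![ePi (2 * τ)] *
    qPoch (ePi (2 * τ) * ePi (-(2 * x))) ![ePi (2 * τ)]) with hg
  have hgd : DifferentiableAt ℂ g 0 := by
    have h1 : Differentiable ℂ fun x => qPoch (ePi (2 * τ) * ePi (2 * x)) ![ePi (2 * τ)] :=
      hq.comp (by fun_prop : Differentiable ℂ fun x => ePi (2 * τ) * ePi (2 * x))
    have h2 : Differentiable ℂ fun x => qPoch (ePi (2 * τ) * ePi (-(2 * x))) ![ePi (2 * τ)] :=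
      hq.comp (by fun_prop : Differentiable ℂ fun x => ePi (2 * τ) * ePi (-(2 * x)))
    have : Differentiable ℂ g := by simp only [hg]; fun_prop
    exact this 0
  have hth : theta τ = fun x => (1 - ePi (2 * x)) * g x := by
    funext x
    rw [theta, qPoch_one_step hp (ePi (2 * x)), hg]
    simp only [ePi_neg]; ring
  have hd : HasDerivAt (fun x => 1 - ePi (2 * x)) (-(2 * Real.pi * I)) 0 := by
    have : HasDerivAt (fun x : ℂ => Real.pi * I * (2 * x)) (Real.pi * I * (2 * 1)) 0 :=
      ((hasDerivAt_id (0 : ℂ)).const_mul 2).const_mul _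
    have := (this.cexp).const_sub 1
    simp only [mul_zero, exp_zero, one_mul] at this
    simp only [ePi]
    convert! this using 1
    ring
  rw [hth, (hd.fun_mul hgd.hasDerivAt).deriv]
  simp only [mul_zero, ePi_zero, sub_self, zero_mul, add_zero]
  refine mul_ne_zero (by simp [Real.pi_ne_zero]) ?_
  rw [hg]
  simp only [mul_zero, neg_zero, ePi_zero, mul_one, one_mul]
  exact mul_ne_zero (qPoch_one_ne_zero_of_norm_lt hp hp) (qPoch_one_ne_zero_of_norm_lt hp hp)

/-- Translation by a lattice vector multiplies `theta` by a nowhere vanishing entire function, so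
the simplicity of the zero at the origin is transported to every lattice point. -/
lemma deriv_theta_ne_zero {x : ℂ} (hx : theta τ x = 0) : deriv (theta τ) x ≠ 0 := by
  obtain ⟨m, n, rfl⟩ := exists_lattice_of_theta_eq_zero hτ hx
  have key : ∃ E : ℂ → ℂ, Differentiable ℂ E ∧ (∀ x, E x ≠ 0) ∧
      ∀ x, theta τ (x + (0 + (m * τ + n))) = E x * theta τ x := by
    refine lattice_induction (τ := τ) (P := fun y => ∃ E : ℂ → ℂ, Differentiable ℂ E ∧ (∀ x, E x ≠ 0) ∧
      ∀ x, theta τ (x + y) = E x * theta τ x) ⟨fun _ => 1, by fun_prop, by simp, by simp⟩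
      (fun y => ?_) (fun y => ?_) m n
    · constructor
      · rintro ⟨E, h1, h2, h3⟩
        refine ⟨fun x => -E x, h1.neg, by simpa using h2, fun x => ?_⟩
        rw [← add_assoc, theta_add_one, h3]; ring
      · rintro ⟨E, h1, h2, h3⟩
        refine ⟨fun x => -E x, h1.neg, by simpa using h2, fun x => ?_⟩
        have := h3 x
        rw [← add_assoc, theta_add_one] at this
        linear_combination -this
    · constructor
      · rintro ⟨E, h1, h2, h3⟩
        refine ⟨fun x => -ePi (-τ - 2 * (x + y)) * E x, by fun_prop,
          fun x => mul_ne_zero (neg_ne_zero.mpr (ePi_ne_zero _)) (h2 x), fun x => ?_⟩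
        rw [← add_assoc, theta_add_period hτ, h3]; ring
      · rintro ⟨E, h1, h2, h3⟩
        refine ⟨fun x => -ePi (τ + 2 * (x + y)) * E x, by fun_prop,
          fun x => mul_ne_zero (neg_ne_zero.mpr (ePi_ne_zero _)) (h2 x), fun x => ?_⟩
        have := h3 x
        rw [← add_assoc, theta_add_period hτ] at this
        rw [mul_assoc, ← this]
        have h : ePi (τ + 2 * (x + y)) * ePi (-τ - 2 * (x + y)) = 1 := by
          rw [← ePi_add]; ring_nf; exact ePi_zero
        linear_combination -theta τ (x + y) * h
  obtain ⟨E, h1, h2, h3⟩ := key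
  have hd : HasDerivAt (fun x => theta τ (x + (m * τ + n))) (E 0 * deriv (theta τ) 0) 0 := by
    have := (h1 0).hasDerivAt.mul ((differentiable_theta hτ) 0).hasDerivAt
    rw [theta_zero hτ, mul_zero, zero_add] at this
    refine this.congr_of_eventuallyEq (Filter.Eventually.of_forall fun x => ?_)
    simpa using h3 x
  have h4 := hd.deriv
  rw [deriv_comp_add_const, zero_add] at h4
  rw [h4]
  exact mul_ne_zero (h2 0) (deriv_theta_zero hτ)

open Filter Topology in
/-- An entire function that vanishes at the zeros of `theta` is divisible by `theta`. -/
lemma exists_eq_theta_mul {f : ℂ → ℂ} (hf : Differentiable ℂ f)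
    (h0 : ∀ x, theta τ x = 0 → f x = 0) :
    ∃ h : ℂ → ℂ, Differentiable ℂ h ∧ ∀ x, f x = theta τ x * h x := by
  classical
  have hθ := differentiable_theta hτ
  -- At the zeros the quotient takes its l'Hôpital value. Near such a zero it is then the quotient
  -- of the two divided slopes, whose denominator does not vanish.
  set h : ℂ → ℂ := fun x =>
    if theta τ x = 0 then deriv f x / deriv (theta τ) x else f x / theta τ x with hh
  refine ⟨h, fun x₀ => ?_, fun x => ?_⟩
  · by_cases hx : theta τ x₀ = 0
    · have hdθ : DifferentiableAt ℂ (dslope (theta τ) x₀) x₀ :=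
        ((Complex.differentiableOn_dslope univ_mem).mpr hθ.differentiableOn).differentiableAt
          univ_mem
      have hdf : DifferentiableAt ℂ (dslope f x₀) x₀ :=
        ((Complex.differentiableOn_dslope univ_mem).mpr hf.differentiableOn).differentiableAt
          univ_mem
      have hne : dslope (theta τ) x₀ x₀ ≠ 0 := by
        rw [dslope_same]; exact deriv_theta_ne_zero hτ hx
      refine (hdf.div hdθ hne).congr_of_eventuallyEq ?_
      filter_upwards [hdθ.continuousAt.eventually_ne hne] with x hx'
      rcases eq_or_ne x x₀ with rfl | hxx
      · simp [hh, hx]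
      · have e1 : theta τ x = (x - x₀) * dslope (theta τ) x₀ x := by
          have := sub_smul_dslope (theta τ) x₀ x
          rw [hx, smul_eq_mul, sub_zero] at this
          exact this.symm
        have e2 : f x = (x - x₀) * dslope f x₀ x := by
          have := sub_smul_dslope f x₀ x
          rw [h0 _ hx, smul_eq_mul, sub_zero] at this
          exact this.symm
        have hs := sub_ne_zero.mpr hxx
        simp only [hh, e1, e2, Pi.div_apply, mul_eq_zero, hs, hx', or_self, if_false]
        rw [mul_div_mul_left _ _ hs]
    · refine ((hf x₀).div (hθ x₀) hx).congr_of_eventuallyEq ?_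
      filter_upwards [(hθ x₀).continuousAt.eventually_ne hx] with x hx'
      simp [hh, hx']
  · by_cases hx : theta τ x = 0
    · rw [h0 x hx, hx, zero_mul]
    · simp only [hh, hx, if_false]
      field_simp

lemma theta_ne_zero_half : theta τ (1 / 2) ≠ 0 := by
  intro h
  obtain ⟨m, n, h⟩ := exists_lattice_of_theta_eq_zero hτ h
  have h1 := congrArg Complex.im h
  have h2 := congrArg Complex.re h
  have hm : m = 0 := by
    simp at h1
    exact_mod_cast h1.resolve_right hτ.ne'
  subst hm
  simp at h2
  have : (1 : ℝ) = 2 * n := by linarith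
  norm_cast at this
  omega

open Filter Topology in
-- Zeros of a nonzero entire function are isolated. Density allows identities between continuous
-- functions to be checked after multiplication by `theta`, or away from its zeros.
lemma dense_theta_ne_zero : Dense {x : ℂ | theta τ x ≠ 0} := by
  have h : (theta τ) ⁻¹' {0}ᶜ ∈ codiscrete ℂ :=
    AnalyticOnNhd.preimage_zero_mem_codiscrete (x := 1 / 2)
      (fun x _ => (differentiable_theta hτ).analyticAt x) (theta_ne_zero_half hτ)
  rw [mem_codiscrete'] at h
  rw [← compl_compl {x : ℂ | theta τ x ≠ 0}, ← interior_eq_empty_iff_dense_compl]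
  by_contra hne
  obtain ⟨x, hx⟩ := Set.nonempty_iff_ne_empty.mpr hne
  have hd := h.2
  have : 𝓝[≠] x ⊓ 𝓟 ((theta τ) ⁻¹' {0}ᶜ)ᶜ = ⊥ := by
    have := (mem_codiscrete.mp (mem_codiscrete'.mpr h)) x
    exact this.eq_bot
  have hle : 𝓝[≠] x ≤ 𝓟 ((theta τ) ⁻¹' {0}ᶜ)ᶜ := by
    refine le_principal_iff.mpr (mem_nhdsWithin_of_mem_nhds ?_)
    exact mem_interior_iff_mem_nhds.mp hx
  rw [inf_eq_left.mpr hle] at this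
  exact (NormedField.nhdsNE_neBot x).ne this

lemma eq_of_theta_mul_eq {f g : ℂ → ℂ} (hf : Continuous f) (hg : Continuous g)
    (h : ∀ x, theta τ x * f x = theta τ x * g x) : f = g :=
  hf.ext_on (dense_theta_ne_zero hτ) hg fun x hx => mul_left_cancel₀ hx (h x)

end

/-! ### Theta functions of order one twisted by a character. -/

/-- Entire functions with the quasi-periodicity of `theta`, twisted by the characters `a`, `b`. -/
structure ThetaLike (τ a b : ℂ) (f : ℂ → ℂ) : Prop where
  differentiable : Differentiable ℂ f
  add_one : ∀ x, f (x + 1) = -a * f x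
  add_period : ∀ x, f (x + τ) = -b * ePi (-τ - 2 * x) * f x

namespace ThetaLike

variable {τ : ℂ} {a b : ℂ} {f : ℂ → ℂ}

lemma eq_zero_of_theta_eq_zero (hτ : 0 < τ.im) (ha : a ≠ 0) (hb : b ≠ 0) (hf : ThetaLike τ a b f)
    (h0 : f 0 = 0) {x : ℂ} (hx : theta τ x = 0) : f x = 0 := by
  obtain ⟨m, n, rfl⟩ := exists_lattice_of_theta_eq_zero hτ hx
  have := lattice_induction (τ := τ) (P := fun x => f x = 0) h0
    (fun x => by simp [hf.add_one, ha]) (fun x => by simp [hf.add_period, hb, ePi_ne_zero]) m n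
  simpa using this

/-- The zeros of `f` contain those of `theta`, and in the quotient the automorphy factors cancel so
that only the characters `a`, `b` survive. -/
lemma exists_quotient (hτ : 0 < τ.im) (ha : a ≠ 0) (hb : b ≠ 0) (hf : ThetaLike τ a b f)
    (h0 : f 0 = 0) : ∃ h : ℂ → ℂ, Differentiable ℂ h ∧ (∀ x, f x = theta τ x * h x) ∧
      (∀ x, h (x + 1) = a * h x) ∧ (∀ x, h (x + τ) = b * h x) := by
  obtain ⟨h, hd, hh⟩ := exists_eq_theta_mul hτ hf.differentiable fun x hx =>
    hf.eq_zero_of_theta_eq_zero hτ ha hb h0 hx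
  have hc := hd.continuous
  refine ⟨h, hd, hh, ?_, ?_⟩
  · refine fun x => congrFun (eq_of_theta_mul_eq hτ (f := fun x => h (x + 1))
      (g := fun x => a * h x) (by fun_prop) (by fun_prop) fun x => ?_) x
    have := hf.add_one x
    rw [hh, hh, theta_add_one] at this
    linear_combination -this
  · refine fun x => congrFun (eq_of_theta_mul_eq hτ (f := fun x => h (x + τ))
      (g := fun x => b * h x) (by fun_prop) (by fun_prop) fun x => ?_) x
    have := hf.add_period x
    rw [hh, hh, theta_add_period hτ] at this
    have h1 := ePi_ne_zero (-τ - 2 * x)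
    apply mul_left_cancel₀ h1
    linear_combination -this

lemma eq_zero (hτ : 0 < τ.im) (ha : ‖a‖ = 1) (hb : ‖b‖ = 1) (hab : a ≠ 1 ∨ b ≠ 1)
    (hf : ThetaLike τ a b f) (h0 : f 0 = 0) (x : ℂ) : f x = 0 := by
  obtain ⟨h, hd, hh, h1, h2⟩ := hf.exists_quotient hτ (by rintro rfl; simp at ha)
    (by rintro rfl; simp at hb) h0
  rw [hh, eq_zero_of_quasiPeriodic hτ ha hb hab hd h1 h2, mul_zero]

lemma comp_neg (hf : ThetaLike τ 1 1 f) : ThetaLike τ 1 1 fun x => f (-x) := by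
  refine ⟨hf.differentiable.comp differentiable_neg, fun x => ?_, fun x => ?_⟩
  · have := hf.add_one (-(x + 1))
    rw [show -(x + 1) + 1 = -x by ring] at this
    rw [this]; ring
  · have := hf.add_period (-(x + τ))
    rw [show -(x + τ) + τ = -x by ring] at this
    rw [this]
    have h : ePi (-τ - 2 * x) * ePi (-τ - 2 * -(x + τ)) = 1 := by
      rw [← ePi_add]; ring_nf; exact ePi_zero
    linear_combination -f (-(x + τ)) * h

/-- Symmetrize around 1/2: in f(x+1/2) + f(-(x+1/2)) the half-period shift flips the sign of the
multiplier for τ, so this function has a nontrivial twist. It vanishes at x = 0 by the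
antiperiodicity of `f`, hence everywhere, and its value at x = -1/2 is 2 f(0). -/
lemma apply_zero (hτ : 0 < τ.im) (hf : ThetaLike τ 1 1 f) : f 0 = 0 := by
  have hg := hf.comp_neg
  have hk : ThetaLike τ 1 (-1) fun x => f (x + 1 / 2) + f (-(x + 1 / 2)) := by
    refine ⟨?_, fun x => ?_, fun x => ?_⟩
    · have := hf.differentiable; fun_prop
    · have h1 := hf.add_one (x + 1 / 2)
      have h2 := hg.add_one (x + 1 / 2)
      rw [show x + 1 + 1 / 2 = x + 1 / 2 + 1 by ring, h1, h2]; ring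
    · have h1 := hf.add_period (x + 1 / 2)
      have h2 := hg.add_period (x + 1 / 2)
      have h3 : ePi (-τ - 2 * (x + 1 / 2)) = -ePi (-τ - 2 * x) := by
        rw [show -τ - 2 * (x + 1 / 2) = (-τ - 2 * x) - 1 by ring, ePi_sub, ePi_one]; ring
      rw [show x + τ + 1 / 2 = x + 1 / 2 + τ by ring, h1, h2, h3]; ring
  have h0 : f (0 + 1 / 2) + f (-(0 + 1 / 2)) = 0 := by
    have := hf.add_one (-(1 / 2))
    rw [show (-(1 / 2) + 1 : ℂ) = 0 + 1 / 2 by ring] at this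
    rw [this]; simp
  have := hk.eq_zero hτ (by simp) (by simp) (Or.inr (by norm_num)) h0 (-(1 / 2))
  simp at this
  exact this

lemma exists_eq_const_mul (hτ : 0 < τ.im) (hf : ThetaLike τ 1 1 f) :
    ∃ C : ℂ, ∀ x, f x = C * theta τ x := by
  obtain ⟨h, hd, hh, h1, h2⟩ := hf.exists_quotient hτ one_ne_zero one_ne_zero (hf.apply_zero hτ)
  refine ⟨h 0, fun x => ?_⟩
  rw [hh, eq_of_quasiPeriodic hτ (by simp) (by simp) hd h1 h2 x 0, mul_comm]

end ThetaLike

/-! ### Theta functions with characteristics -/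

/-- The zeroth Fourier coefficient is 1: integrating the series term by term over [0, 1] would give
0 = 1 if the function vanished identically. -/
lemma exists_jacobiTheta₂_ne_zero {τ : ℂ} (hτ : 0 < τ.im) : ∃ z, jacobiTheta₂ z τ ≠ 0 := by
  by_contra! h
  have key := intervalIntegral.hasSum_intervalIntegral_of_summable_norm (a := 0) (b := 1)
    (f := fun n : ℤ => (⟨fun x : ℝ => jacobiTheta₂_term n x τ, by
      unfold jacobiTheta₂_term; fun_prop⟩ : C(ℝ, ℂ))) ?_
  · have h0 : ∀ n : ℤ, (∫ x in (0 : ℝ)..1, jacobiTheta₂_term n x τ) = if n = 0 then 1 else 0 := by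
      intro n
      have hn : ∀ x : ℝ, jacobiTheta₂_term n x τ =
          exp (Real.pi * I * n ^ 2 * τ) * exp ((2 * Real.pi * I * n) * x) := fun x => by
        rw [jacobiTheta₂_term, ← exp_add]; ring_nf
      simp only [hn]
      rw [intervalIntegral.integral_const_mul]
      split_ifs with h
      · simp [h]
      · rw [integral_exp_mul_complex (by simp [h, Real.pi_ne_zero])]
        have : exp (2 * Real.pi * I * n * (1 : ℝ)) = 1 := by
          rw [exp_eq_one_iff]; exact ⟨n, by push_cast; ring⟩
        rw [this]; simp
    have h1 : (∫ x in (0 : ℝ)..1, ∑' n : ℤ, jacobiTheta₂_term n x τ) = 0 := by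
      have : ∀ x : ℝ, ∑' n : ℤ, jacobiTheta₂_term n x τ = 0 := fun x => h x
      simp [this]
    simp only [ContinuousMap.coe_mk] at key
    rw [h1] at key
    simp only [h0] at key
    exact one_ne_zero ((hasSum_ite_eq (0 : ℤ) (1 : ℂ)).unique key)
  · refine Summable.of_nonneg_of_le (fun _ => norm_nonneg _) (fun n => ?_)
      (summable_pow_mul_jacobiTheta₂_term_bound 0 hτ 0)
    rw [ContinuousMap.norm_le _ (by positivity)]
    intro x
    simpa using norm_jacobiTheta₂_term_le (S := 0) hτ (z := (x : ℝ)) (τ := τ) (by simp) le_rfl n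

lemma thetaChar_half (x τ : ℂ) : thetaChar (1 / 2) (1 / 2) x τ =
    ePi (τ / 4 + x + 1 / 2) * jacobiTheta₂ (x + 1 / 2 + τ / 2) τ := by
  rw [thetaChar, jacobiTheta₂, ← tsum_mul_left]
  refine tsum_congr fun m => ?_
  rw [jacobiTheta₂_term, ePi, ← exp_add]
  ring_nf

lemma thetaChar_eq (a b x τ : ℂ) : thetaChar (1 / 2 + a) (1 / 2 + b) x τ =
    ePi (a ^ 2 * τ + 2 * a * (x + 1 / 2 + b)) * thetaChar (1 / 2) (1 / 2) (x + b + a * τ) τ := by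
  rw [thetaChar, thetaChar, ← tsum_mul_left]
  refine tsum_congr fun m => ?_
  rw [ePi, ← exp_add]
  ring_nf

/-- The Jacobi triple product up to a constant, obtained from the uniqueness of order-one theta
functions. The value of the constant is irrelevant because the R-matrix contains only quotients; its
non-vanishing is what matters. -/
lemma exists_thetaChar_half_eq {τ : ℂ} (hτ : 0 < τ.im) :
    ∃ C : ℂ, C ≠ 0 ∧ ∀ x, thetaChar (1 / 2) (1 / 2) x τ = C * theta τ x := by
  have hl : ThetaLike τ 1 1 fun x => thetaChar (1 / 2) (1 / 2) x τ := by
    simp only [thetaChar_half]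
    refine ⟨fun x => ?_, fun x => ?_, fun x => ?_⟩
    · have h1 : DifferentiableAt ℂ (fun x => jacobiTheta₂ (x + 1 / 2 + τ / 2) τ) x :=
        (differentiableAt_jacobiTheta₂_fst (x + 1 / 2 + τ / 2) hτ).comp x
          (f := fun x : ℂ => x + 1 / 2 + τ / 2) (by fun_prop)
      have h2 : DifferentiableAt ℂ (fun x => ePi (τ / 4 + x + 1 / 2)) x := by
        have := differentiable_ePi
        fun_prop
      exact h2.mul h1
    · rw [show x + 1 + 1 / 2 + τ / 2 = x + 1 / 2 + τ / 2 + 1 by ring, jacobiTheta₂_add_left,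
        show τ / 4 + (x + 1) + 1 / 2 = τ / 4 + x + 1 / 2 + 1 by ring, ePi_add _ 1, ePi_one]
      ring
    · rw [show x + τ + 1 / 2 + τ / 2 = x + 1 / 2 + τ / 2 + τ by ring, jacobiTheta₂_add_left']
      have h : exp (-Real.pi * I * (τ + 2 * (x + 1 / 2 + τ / 2))) = ePi (-2 * τ - 2 * x - 1) := by
        rw [ePi]; ring_nf
      have h2 : ePi (τ / 4 + (x + τ) + 1 / 2) * ePi (-2 * τ - 2 * x - 1) =
          -1 * ePi (-τ - 2 * x) * ePi (τ / 4 + x + 1 / 2) := by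
        rw [← ePi_one, ← ePi_add, ← ePi_add, ← ePi_add,
          show τ / 4 + (x + τ) + 1 / 2 + (-2 * τ - 2 * x - 1) =
            1 + (-τ - 2 * x) + (τ / 4 + x + 1 / 2) - 2 by ring, ePi_sub]
        have := ePi_two_int 1
        simp at this
        simp [this]
      rw [h, ← mul_assoc, h2, mul_assoc]
  obtain ⟨C, hC⟩ := hl.exists_eq_const_mul hτ
  refine ⟨C, ?_, hC⟩
  rintro rfl
  obtain ⟨z, hz⟩ := exists_jacobiTheta₂_ne_zero hτ
  have := hC (z - 1 / 2 - τ / 2)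
  rw [thetaChar_half, zero_mul, mul_eq_zero] at this
  refine hz ?_
  have := this.resolve_left (ePi_ne_zero _)
  rwa [show z - 1 / 2 - τ / 2 + 1 / 2 + τ / 2 = z by ring] at this

/-! ### Functions of order two -/

/-- A theta function of order two that vanishes at the origin. -/
lemma exists_eq_theta_mul_theta {τ : ℂ} (hτ : 0 < τ.im) {g : ℂ → ℂ} (v : ℂ)
    (hg : Differentiable ℂ g) (h0 : g 0 = 0) (h1 : ∀ x, g (x + 1) = g x)
    (h2 : ∀ x, g (x + τ) = ePi (-2 * τ - 4 * x + 2 * v) * g x) :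
    ∃ C : ℂ, ∀ x, g x = C * (theta τ x * theta τ (x - v)) := by
  obtain ⟨h, hd, hh⟩ := exists_eq_theta_mul hτ hg fun x hx => by
    obtain ⟨m, n, rfl⟩ := exists_lattice_of_theta_eq_zero hτ hx
    have := lattice_induction (τ := τ) (P := fun x => g x = 0) h0
      (fun x => by simp [h1]) (fun x => by simp [h2, ePi_ne_zero]) m n
    simpa using this
  have hc := hd.continuous
  have k1 : ∀ x, h (x + 1) = -h x := by
    refine fun x => congrFun (eq_of_theta_mul_eq hτ (f := fun x => h (x + 1))
      (g := fun x => -h x) (by fun_prop) (by fun_prop) fun x => ?_) x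
    have := h1 x
    rw [hh, hh, theta_add_one] at this
    linear_combination -this
  have k2 : ∀ x, h (x + τ) = -ePi (-τ - 2 * x + 2 * v) * h x := by
    refine fun x => congrFun (eq_of_theta_mul_eq hτ (f := fun x => h (x + τ))
      (g := fun x => -ePi (-τ - 2 * x + 2 * v) * h x) (by fun_prop) (by fun_prop) fun x => ?_) x
    have := h2 x
    rw [hh, hh, theta_add_period hτ, show -2 * τ - 4 * x + 2 * v =
      (-τ - 2 * x) + (-τ - 2 * x + 2 * v) by ring, ePi_add] at this
    apply mul_left_cancel₀ (ePi_ne_zero (-τ - 2 * x))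
    linear_combination -this
  -- The quotient by `theta` has order one with its zero displaced to `v`; translating by `v`
  -- removes the twist.
  have hl : ThetaLike τ 1 1 fun x => h (x + v) := by
    refine ⟨by fun_prop, fun x => ?_, fun x => ?_⟩
    · rw [add_right_comm, k1]; ring
    · rw [add_right_comm, k2, show -τ - 2 * (x + v) + 2 * v = -τ - 2 * x by ring]; ring
  obtain ⟨C, hC⟩ := hl.exists_eq_const_mul hτ
  refine ⟨C, fun x => ?_⟩
  have := hC (x - v)
  rw [sub_add_cancel] at this
  rw [hh, this]; ring

/-! ### Products over a set of torsion points -/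

lemma prod_val_eq_prod_range {M : Type*} [CommMonoid M] (N : ℕ) [NeZero N] (f : ℕ → M) :
    ∏ k : ZMod N, f k.val = ∏ k ∈ Finset.range N, f k := by
  cases N with
  | zero => exact absurd rfl (NeZero.ne 0)
  | succ n => exact Fin.prod_univ_eq_prod_range f (n + 1)

lemma prod_range_shift (N : ℕ) [NeZero N] (g : ℕ → ℂ) (c : ℂ) (h : g N = c * g 0) :
    ∏ k ∈ Finset.range N, g (k + 1) = c * ∏ k ∈ Finset.range N, g k := by
  cases N with
  | zero => exact absurd rfl (NeZero.ne 0)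
  | succ n => rw [Finset.prod_range_succ, h, Finset.prod_range_succ' g]; ring

lemma prod_range_ePi (n : ℕ) (a b : ℂ) :
    ∏ k ∈ Finset.range n, ePi (a + k * b) = ePi (n * a + n * (n - 1) / 2 * b) := by
  induction n with
  | zero => simp [ePi_zero]
  | succ n ih =>
    rw [Finset.prod_range_succ, ih, ← ePi_add]
    congr 1; push_cast; ring

section

variable (N : ℕ) [NeZero N] (τ : ℂ)

/-- The torsion point `(α₁τ + α₂)/N`. -/
def tors (α : ZMod N × ZMod N) : ℂ := (α.1.val * τ + α.2.val) / N

/-- The product of the translates of `theta` by the `N`-torsion points. -/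
def thetaTors (u : ℂ) : ℂ := ∏ α : ZMod N × ZMod N, theta τ (u + tors N τ α)

variable {τ} (hτ : 0 < τ.im)

lemma natCast_ne_zero : (N : ℂ) ≠ 0 := by exact_mod_cast NeZero.ne N

include hτ

variable {N} in
lemma theta_add_tors_ne_zero {u : ℂ} (hu : theta τ (N * u) ≠ 0) (a b : ℤ) :
    theta τ (u + (a * τ + b) / N) ≠ 0 := by
  intro h
  obtain ⟨m, n, h⟩ := exists_lattice_of_theta_eq_zero hτ h
  have hN := natCast_ne_zero N
  apply hu
  have : N * u = ((N * m - a : ℤ) : ℂ) * τ + ((N * n - b : ℤ) : ℂ) := by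
    push_cast
    field_simp at h
    linear_combination h
  rw [this, theta_lattice hτ]

variable {N} in
lemma theta_tors_ne_zero {α : ZMod N × ZMod N} (hα : α ≠ 0) : theta τ (tors N τ α) ≠ 0 := by
  intro h
  obtain ⟨m, n, h⟩ := exists_lattice_of_theta_eq_zero hτ h
  have hN := natCast_ne_zero N
  rw [tors] at h
  field_simp at h
  have h' : ((α.1.val - N * m : ℤ) : ℂ) * τ + ((α.2.val - N * n : ℤ) : ℂ) = 0 := by
    push_cast; linear_combination h
  have him := congrArg Complex.im h'
  rw [add_im, mul_im, intCast_im, intCast_im, intCast_re, zero_mul, add_zero, add_zero,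
    zero_im, mul_eq_zero] at him
  have h1 : (α.1.val - N * m : ℤ) = 0 := by exact_mod_cast him.resolve_right hτ.ne'
  rw [h1] at h'
  have h2 : (α.2.val - N * n : ℤ) = 0 := by
    rw [Int.cast_zero, zero_mul, zero_add] at h'
    exact_mod_cast h'
  apply hα
  have e1 : (α.1.val : ℤ) = N * m := by linarith
  have e2 : (α.2.val : ℤ) = N * n := by linarith
  have e1 := congrArg (Int.cast : ℤ → ZMod N) e1
  have e2 := congrArg (Int.cast : ℤ → ZMod N) e2
  simp at e1 e2
  exact Prod.ext e1 e2

variable {N} in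
lemma thetaTors_ne_zero {u : ℂ} (hu : theta τ (N * u) ≠ 0) : thetaTors N τ u ≠ 0 := by
  refine Finset.prod_ne_zero_iff.mpr fun α _ => ?_
  have := theta_add_tors_ne_zero hτ hu α.1.val α.2.val
  simpa [tors] using this

lemma differentiable_thetaTors : Differentiable ℂ (thetaTors N τ) := by
  have := differentiable_theta hτ
  unfold thetaTors
  exact Differentiable.fun_finsetProd fun α _ => by fun_prop

omit hτ in
-- The translation permutes the torsion points cyclically in the second coordinate. Only the
-- wrap-around costs a sign, once for each of the N values of the first coordinate.
lemma thetaTors_add_one (u : ℂ) :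
    thetaTors N τ (u + 1 / N) = (-1) ^ N * thetaTors N τ u := by
  have hN := natCast_ne_zero N
  have h : ∀ α₁ : ZMod N, ∏ α₂ : ZMod N, theta τ (u + 1 / N + tors N τ (α₁, α₂)) =
      -1 * ∏ α₂ : ZMod N, theta τ (u + tors N τ (α₁, α₂)) := fun α₁ => by
    have e := prod_range_shift N (fun k => theta τ (u + (α₁.val * τ + k) / N)) (-1) (by
      simp only [Nat.cast_zero]
      rw [show u + (α₁.val * τ + N) / N = u + (α₁.val * τ + 0) / N + 1 by field_simp; ring,
        theta_add_one]
      ring)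
    rw [← prod_val_eq_prod_range, ← prod_val_eq_prod_range] at e
    refine (Finset.prod_congr rfl fun k _ => ?_).trans
      (e.trans (congrArg _ (Finset.prod_congr rfl fun k _ => ?_)))
    · congr 1; simp only [tors]; push_cast; ring
    · rw [tors]
  rw [thetaTors, thetaTors, Fintype.prod_prod_type, Fintype.prod_prod_type]
  simp only [h, Finset.prod_mul_distrib, Finset.prod_const, Finset.card_univ, ZMod.card]

/-- Cyclic permutation in the first coordinate; the N wrap-around multipliers depend on the second
coordinate, and their product contributes the extra exponent -(N-1). -/
lemma thetaTors_add_period (u : ℂ) : thetaTors N τ (u + τ / N) =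
    (-1) ^ N * ePi (-N * τ - 2 * N * u - (N - 1)) * thetaTors N τ u := by
  have hN := natCast_ne_zero N
  have h : ∀ α₂ : ZMod N, ∏ α₁ : ZMod N, theta τ (u + τ / N + tors N τ (α₁, α₂)) =
      -1 * ePi ((-τ - 2 * u) + α₂.val * (-2 / N)) *
        ∏ α₁ : ZMod N, theta τ (u + tors N τ (α₁, α₂)) := fun α₂ => by
    have e := prod_range_shift N (fun k => theta τ (u + (k * τ + α₂.val) / N))
      (-1 * ePi ((-τ - 2 * u) + α₂.val * (-2 / N))) (by
      simp only [Nat.cast_zero]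
      rw [show u + (N * τ + α₂.val) / N = u + (0 * τ + α₂.val) / N + τ by field_simp; ring,
        theta_add_period hτ]
      congr 2
      · rw [neg_one_mul]
        congr 2
        ring)
    rw [← prod_val_eq_prod_range, ← prod_val_eq_prod_range] at e
    refine (Finset.prod_congr rfl fun k _ => ?_).trans
      (e.trans (congrArg _ (Finset.prod_congr rfl fun k _ => ?_)))
    · congr 1; simp only [tors]; push_cast; ring
    · rw [tors]
  rw [thetaTors, thetaTors, Fintype.prod_prod_type_right, Fintype.prod_prod_type_right]
  simp only [h, Finset.prod_mul_distrib, Finset.prod_const, Finset.card_univ, ZMod.card]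
  rw [prod_val_eq_prod_range N fun k => ePi ((-τ - 2 * u) + k * (-2 / N)), prod_range_ePi]
  congr 3
  field_simp
  ring

omit hτ [NeZero N] in
lemma ePi_pred : ePi ((N : ℂ) - 1) = -(-1) ^ N := by
  have := ePi_pow 1 N
  rw [ePi_one, mul_one] at this
  rw [ePi_sub, ← this, ePi_one]; ring

omit hτ [NeZero N] in
lemma neg_one_pow_mul_self : ((-1 : ℂ) ^ N) * (-1) ^ N = 1 := by
  rw [← mul_pow]; simp

/-- An entire multiple `e` of a function `f` with poles at the `N`-torsion points: if `f` is
quasi-periodic for the lattice `(ℤτ + ℤ)/N`, then `e` is essentially a theta function. -/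
lemma thetaLike_of_torsion {f e : ℂ → ℂ} {a b s : ℂ} (he : Differentiable ℂ e)
    (hfe : ∀ u, theta τ (N * u) ≠ 0 → e u = f u * thetaTors N τ u)
    (h1 : ∀ u, f (u + 1 / N) = a * f u) (h2 : ∀ u, f (u + τ / N) = b * ePi (-2 * s) * f u) :
    ThetaLike τ a b fun t => ePi ((N - 1) * (t - s)) * e ((t - s) / N) := by
  have hN := natCast_ne_zero N
  have hec := he.continuous
  have k0 : ∀ t, theta τ t ≠ 0 → e (t / N) = f (t / N) * thetaTors N τ (t / N) := fun t ht =>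
    hfe _ (by rwa [mul_div_cancel₀ _ hN])
  have hs := neg_one_pow_mul_self N
  -- The factorization of `e` is known only away from the zeros of `theta`; both translation laws
  -- extend to all `t` by density and continuity.
  have k1 : ∀ t, e ((t + 1) / N) = a * (-1) ^ N * e (t / N) := by
    refine fun t => congrFun (Continuous.ext_on (dense_theta_ne_zero hτ)
      (f := fun t => e ((t + 1) / N)) (g := fun t => a * (-1) ^ N * e (t / N))
      (by fun_prop) (by fun_prop) fun t (ht : theta τ t ≠ 0) => ?_) t
    have ht' : theta τ (t + 1) ≠ 0 := by rw [theta_add_one]; exact neg_ne_zero.mpr ht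
    simp only
    rw [k0 _ ht, k0 _ ht', add_div, h1, thetaTors_add_one]; ring
  have k2 : ∀ t, e ((t + τ) / N) = b * ePi (-2 * s) *
      ((-1) ^ N * ePi (-N * τ - 2 * t - (N - 1))) * e (t / N) := by
    refine fun t => congrFun (Continuous.ext_on (dense_theta_ne_zero hτ)
      (f := fun t => e ((t + τ) / N)) (g := fun t => b * ePi (-2 * s) *
      ((-1) ^ N * ePi (-N * τ - 2 * t - (N - 1))) * e (t / N))
      (by fun_prop) (by fun_prop) fun t (ht : theta τ t ≠ 0) => ?_) t
    have ht' : theta τ (t + τ) ≠ 0 := by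
      rw [theta_add_period hτ]; exact mul_ne_zero (neg_ne_zero.mpr (ePi_ne_zero _)) ht
    simp only
    rw [k0 _ ht, k0 _ ht', add_div, h2, thetaTors_add_period N hτ, mul_assoc 2 (N : ℂ),
      mul_div_cancel₀ _ hN]; ring
  have hp := ePi_pred N
  refine ⟨by fun_prop, fun t => ?_, fun t => ?_⟩
  · rw [add_sub_right_comm, k1, show (N - 1) * (t - s + 1) = (N - 1) * (t - s) + (N - 1 : ℂ) by ring,
      ePi_add, hp]
    linear_combination -a * ePi ((N - 1) * (t - s)) * e ((t - s) / N) * hs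
  · rw [add_sub_right_comm, k2]
    have : ePi ((N - 1) * (t - s + τ)) * (ePi (-2 * s) * ePi (-N * τ - 2 * (t - s) - (N - 1))) *
        ePi (N - 1) = ePi ((N - 1) * (t - s)) * ePi (-τ - 2 * t) := by
      simp only [← ePi_add]; congr 1; ring
    rw [hp] at this
    linear_combination -b * e ((t - s) / N) * this

lemma exists_theta_mul_ne_zero : ∃ u, theta τ (N * u) ≠ 0 :=
  ⟨1 / 2 / N, by rw [mul_div_cancel₀ _ (natCast_ne_zero N)]; exact theta_ne_zero_half hτ⟩

/-- The product formula over the torsion points. -/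
lemma exists_thetaTors_eq : ∃ C : ℂ, C ≠ 0 ∧
    ∀ u, thetaTors N τ u = C * ePi (-(N - 1) * (N * u)) * theta τ (N * u) := by
  have hN := natCast_ne_zero N
  obtain ⟨C, hC⟩ := (thetaLike_of_torsion N hτ (f := fun _ => 1) (a := 1) (b := 1) (s := 0)
    (differentiable_thetaTors N hτ) (by simp) (by simp) (by simp [ePi_zero])).exists_eq_const_mul hτ
  have key : ∀ u, thetaTors N τ u = C * ePi (-(N - 1) * (N * u)) * theta τ (N * u) := fun u => by
    have := hC (N * u)
    rw [sub_zero, mul_div_cancel_left₀ _ hN] at this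
    have h : ePi (-(N - 1) * (N * u)) * ePi ((N - 1) * (N * u)) = 1 := by
      rw [← ePi_add]; ring_nf; exact ePi_zero
    linear_combination ePi (-(N - 1) * (N * u)) * this - thetaTors N τ u * h
  refine ⟨C, ?_, key⟩
  rintro rfl
  obtain ⟨u, hu⟩ := exists_theta_mul_ne_zero N hτ
  exact thetaTors_ne_zero hτ hu (by rw [key]; ring)

end

/-! ### The coefficient functions of the `R`-matrix -/

section

variable (N : ℕ) [NeZero N] (τ : ℂ)

lemma stdAddChar_intCast (k : ℤ) : ZMod.stdAddChar (k : ZMod N) = ePi (2 * k / N) := by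
  rw [ZMod.stdAddChar_coe, ePi]; ring_nf

lemma stdAddChar_val (k : ZMod N) : ZMod.stdAddChar k = ePi (2 * k.val / N) := by
  have := stdAddChar_intCast N k.val
  simpa using this

/-- The coefficient functions, with integral characteristics. -/
def wInt (a b : ℤ) (x u : ℂ) : ℂ :=
  ePi (2 * a * x / N) * theta τ (x + u + (a * τ + b) / N) / theta τ (u + (a * τ + b) / N)

/-- The coefficient functions `w_α(x; u)` of the `R`-matrix. -/
def wCoef (α : ZMod N × ZMod N) (x u : ℂ) : ℂ := wInt N τ α.1.val α.2.val x u

variable {τ} (hτ : 0 < τ.im)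

lemma wInt_add_right (a b : ℤ) (x u : ℂ) : wInt N τ a (b + N) x u = wInt N τ a b x u := by
  have hN := natCast_ne_zero N
  have h : ∀ y : ℂ, y + (a * τ + ((b + N : ℤ) : ℂ)) / N = y + (a * τ + b) / N + 1 := fun y => by
    push_cast; field_simp; ring
  simp only [wInt, h, theta_add_one, mul_neg, neg_div_neg_eq]

include hτ in
-- The exponential prefactor in `wInt` is the one that cancels the ratio of the multipliers of
-- numerator and denominator, so that the coefficients depend on the characteristics only modulo N.
lemma wInt_add_left (a b : ℤ) (x u : ℂ) : wInt N τ (a + N) b x u = wInt N τ a b x u := by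
  have hN := natCast_ne_zero N
  have h : ∀ y : ℂ, y + (((a + N : ℤ) : ℂ) * τ + b) / N = y + (a * τ + b) / N + τ := fun y => by
    push_cast; field_simp; ring
  have e : ePi (2 * ((a + N : ℤ) : ℂ) * x / N) *
      ePi (-τ - 2 * (x + u + (a * τ + b) / N)) =
      ePi (2 * a * x / N) * ePi (-τ - 2 * (u + (a * τ + b) / N)) := by
    rw [← ePi_add, ← ePi_add]; congr 1; push_cast; field_simp; ring
  have h0 := ePi_ne_zero (-τ - 2 * (u + (a * τ + b) / N))
  simp only [wInt, h, theta_add_period hτ]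
  rw [show ePi (2 * ((a + N : ℤ) : ℂ) * x / N) * (-ePi (-τ - 2 * (x + u + (a * τ + b) / N)) *
    theta τ (x + u + (a * τ + b) / N)) = -ePi (-τ - 2 * (u + (a * τ + b) / N)) *
    (ePi (2 * a * x / N) * theta τ (x + u + (a * τ + b) / N)) by
      linear_combination -theta τ (x + u + (a * τ + b) / N) * e]
  rw [mul_div_mul_left _ _ (neg_ne_zero.mpr h0)]

include hτ in
lemma wInt_congr {a a' b b' : ℤ} (ha : (a : ZMod N) = a') (hb : (b : ZMod N) = b') (x u : ℂ) :
    wInt N τ a b x u = wInt N τ a' b' x u := by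
  obtain ⟨k, hk⟩ := (ZMod.intCast_eq_intCast_iff_dvd_sub a a' N).mp ha
  obtain ⟨l, hl⟩ := (ZMod.intCast_eq_intCast_iff_dvd_sub b b' N).mp hb
  have h1 : Function.Periodic (fun a => wInt N τ a b x u) (N : ℤ) := fun a =>
    wInt_add_left N hτ a b x u
  have h2 : Function.Periodic (fun b => wInt N τ a' b x u) (N : ℤ) := fun b =>
    wInt_add_right N a' b x u
  have h1' : wInt N τ (a + k * N) b x u = wInt N τ a b x u := h1.int_mul k a
  have h2' : wInt N τ a' (b + l * N) x u = wInt N τ a' b x u := h2.int_mul l b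
  rw [show b' = b + l * N by linarith, h2', ← h1', show a + k * N = a' by linarith]

variable {N}

include hτ in
lemma wCoef_eq_wInt {α : ZMod N × ZMod N} {a b : ℤ} (ha : (a : ZMod N) = α.1)
    (hb : (b : ZMod N) = α.2) (x u : ℂ) : wCoef N τ α x u = wInt N τ a b x u :=
  wInt_congr N hτ (by simp [ha]) (by simp [hb]) x u

include hτ in
-- Moving `u` by a torsion point moves the label α. After reindexing, sums over all labels are
-- therefore quasi-periodic for the finer lattice (ℤτ + ℤ)/N.
lemma wCoef_add_one_div (α : ZMod N × ZMod N) (x u : ℂ) :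
    wCoef N τ α x (u + 1 / N) = wCoef N τ (α + (0, 1)) x u := by
  rw [wCoef_eq_wInt hτ (α := α + (0, 1)) (a := α.1.val) (b := α.2.val + 1) (by simp) (by simp)]
  have h : ∀ y : ℂ, y + 1 / N + (((α.1.val : ℤ) : ℂ) * τ + ((α.2.val : ℤ) : ℂ)) / N =
      y + (((α.1.val : ℤ) : ℂ) * τ + ((α.2.val + 1 : ℤ) : ℂ)) / N := fun y => by push_cast; ring
  rw [wCoef, wInt, wInt, ← add_assoc x, h, h]

include hτ in
lemma wCoef_add_period_div (α : ZMod N × ZMod N) (x u : ℂ) :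
    wCoef N τ α x (u + τ / N) = ePi (-2 * (x / N)) * wCoef N τ (α + (1, 0)) x u := by
  rw [wCoef_eq_wInt hτ (α := α + (1, 0)) (a := α.1.val + 1) (b := α.2.val) (by simp) (by simp)]
  have h : ∀ y : ℂ, y + τ / N + (((α.1.val : ℤ) : ℂ) * τ + ((α.2.val : ℤ) : ℂ)) / N =
      y + (((α.1.val + 1 : ℤ) : ℂ) * τ + ((α.2.val : ℤ) : ℂ)) / N := fun y => by push_cast; ring
  rw [wCoef, wInt, wInt, ← add_assoc x, h, h, ← mul_div_assoc, ← mul_assoc, ← ePi_add]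
  congr 3
  push_cast; ring

include hτ in
lemma wCoef_neg (α : ZMod N × ZMod N) (x u : ℂ) :
    wCoef N τ α x (-u) = wCoef N τ (-α) (-x) u := by
  rw [wCoef_eq_wInt hτ (α := -α) (a := -α.1.val) (b := -α.2.val) (by simp) (by simp)]
  rw [wCoef, wInt, wInt, show x + -u + (((α.1.val : ℤ) : ℂ) * τ + ((α.2.val : ℤ) : ℂ)) / N =
    -(-x + u + (((-α.1.val : ℤ) : ℂ) * τ + ((-α.2.val : ℤ) : ℂ)) / N) by push_cast; ring,
    show -u + (((α.1.val : ℤ) : ℂ) * τ + ((α.2.val : ℤ) : ℂ)) / N =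
    -(u + (((-α.1.val : ℤ) : ℂ) * τ + ((-α.2.val : ℤ) : ℂ)) / N) by push_cast; ring,
    theta_neg hτ, theta_neg hτ, mul_neg, neg_div_neg_eq]
  congr 3; push_cast; ring

lemma wCoef_apply (α : ZMod N × ZMod N) (x u : ℂ) : wCoef N τ α x u =
    ePi (2 * α.1.val * x / N) * theta τ (x + u + tors N τ α) / theta τ (u + tors N τ α) := by
  simp [wCoef, wInt, tors]

include hτ in
lemma theta_add_tors_ne_zero' {u : ℂ} (hu : theta τ (N * u) ≠ 0) (α : ZMod N × ZMod N) :
    theta τ (u + tors N τ α) ≠ 0 := by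
  have := theta_add_tors_ne_zero hτ hu α.1.val α.2.val
  simpa [tors] using this

include hτ in
lemma wCoef_zero {u : ℂ} (hu : theta τ (N * u) ≠ 0) (α : ZMod N × ZMod N) :
    wCoef N τ α 0 u = 1 := by
  rw [wCoef_apply, mul_zero, zero_div, ePi_zero, zero_add, one_mul,
    div_self (theta_add_tors_ne_zero' hτ hu α)]

include hτ in
lemma differentiable_wCoef (α : ZMod N × ZMod N) (u : ℂ) :
    Differentiable ℂ fun x => wCoef N τ α x u := by
  have := differentiable_theta hτ
  simp only [wCoef_apply, div_eq_mul_inv]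
  fun_prop

lemma wCoef_add_one (α : ZMod N × ZMod N) (x u : ℂ) :
    wCoef N τ α (x + 1) u = -ZMod.stdAddChar α.1 * wCoef N τ α x u := by
  rw [wCoef_apply, wCoef_apply, show x + 1 + u + tors N τ α = x + u + tors N τ α + 1 by ring,
    theta_add_one, stdAddChar_val, mul_add, add_div, ePi_add, mul_one]
  ring

include hτ in
lemma wCoef_add_period (α : ZMod N × ZMod N) (x u : ℂ) :
    wCoef N τ α (x + τ) u =
      -ZMod.stdAddChar (-α.2) * ePi (-τ - 2 * x - 2 * u) * wCoef N τ α x u := by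
  have hN := natCast_ne_zero N
  rw [wCoef_apply, wCoef_apply, show x + τ + u + tors N τ α = x + u + tors N τ α + τ by ring,
    theta_add_period hτ, AddChar.map_neg_eq_inv, stdAddChar_val, ← ePi_neg]
  have : ePi (2 * α.1.val * (x + τ) / N) * ePi (-τ - 2 * (x + u + tors N τ α)) =
      ePi (-(2 * α.2.val / N)) * ePi (-τ - 2 * x - 2 * u) * ePi (2 * α.1.val * x / N) := by
    simp only [← ePi_add, tors]; congr 1; field_simp; ring
  rw [show ePi (2 * α.1.val * (x + τ) / N) * (-ePi (-τ - 2 * (x + u + tors N τ α)) *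
    theta τ (x + u + tors N τ α)) = -(ePi (2 * α.1.val * (x + τ) / N) *
    ePi (-τ - 2 * (x + u + tors N τ α))) * theta τ (x + u + tors N τ α) by ring, this]
  ring

end

/-! ### Sums of products of two coefficient functions -/

section

variable {N : ℕ} [NeZero N] {τ : ℂ} (hτ : 0 < τ.im)

/-- The sums `∑_β χ(β) w_{β+γ}(x; u) w_β(y; u)`. -/
def wSum (χ : AddChar (ZMod N × ZMod N) ℂ) (γ : ZMod N × ZMod N) (x y u : ℂ) : ℂ :=
  ∑ β, χ β * (wCoef N τ (β + γ) x u * wCoef N τ β y u)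

include hτ

/-- Since γ ≠ 0, the two coefficients in each summand have denominators indexed by different torsion
points, so `thetaTors` clears both; `e` is written with these two factors deleted from the product.
Reindexing β after a torsion translation of `u` pulls out the value of χ. -/
lemma thetaLike_wSum (χ : AddChar (ZMod N × ZMod N) ℂ) {γ : ZMod N × ZMod N} (hγ : γ ≠ 0)
    (x y : ℂ) : ∃ e : ℂ → ℂ, Continuous e ∧
      (∀ u, theta τ (N * u) ≠ 0 → e u = wSum (τ := τ) χ γ x y u * thetaTors N τ u) ∧
      ThetaLike τ (χ (-(0, 1))) (χ (-(1, 0))) fun t =>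
        ePi ((N - 1) * (t - (x + y) / N)) * e ((t - (x + y) / N) / N) := by
  classical
  have hθ := differentiable_theta hτ
  set n : ZMod N × ZMod N → ℂ → ℂ → ℂ := fun α x u =>
    ePi (2 * α.1.val * x / N) * theta τ (x + u + tors N τ α) with hn
  set e : ℂ → ℂ := fun u => ∑ β, χ β * (n (β + γ) x u * n β y u *
    ∏ δ ∈ (Finset.univ.erase β).erase (β + γ), theta τ (u + tors N τ δ)) with he
  have hed : Differentiable ℂ e := by
    refine Differentiable.fun_sum fun β _ => ?_
    have : Differentiable ℂ fun u => ∏ δ ∈ (Finset.univ.erase β).erase (β + γ),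
        theta τ (u + tors N τ δ) := Differentiable.fun_finsetProd fun α _ => by fun_prop
    simp only [hn]
    fun_prop
  have hf : ∀ u, theta τ (N * u) ≠ 0 →
      e u = wSum (τ := τ) χ γ x y u * thetaTors N τ u := fun u hu => by
    rw [wSum, Finset.sum_mul]
    refine Finset.sum_congr rfl fun β _ => ?_
    have h1 := theta_add_tors_ne_zero' hτ hu (β + γ)
    have h2 := theta_add_tors_ne_zero' hτ hu β
    rw [thetaTors, ← Finset.mul_prod_erase Finset.univ _ (Finset.mem_univ β),
      ← Finset.mul_prod_erase (Finset.univ.erase β) _ (by simpa using hγ :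
        β + γ ∈ Finset.univ.erase β), wCoef_apply, wCoef_apply]
    simp only [hn]
    field_simp
  refine ⟨e, hed.continuous, hf, thetaLike_of_torsion N hτ (f := wSum (τ := τ) χ γ x y) hed hf
    (fun u => ?_) fun u => ?_⟩
  · rw [wSum, wSum, ← (Equiv.subRight ((0, 1) : ZMod N × ZMod N)).sum_comp, Finset.mul_sum]
    refine Finset.sum_congr rfl fun β _ => ?_
    rw [wCoef_add_one_div hτ, wCoef_add_one_div hτ, Equiv.subRight_apply, sub_eq_add_neg,
      AddChar.map_add_eq_mul, show β + -(0, 1) + γ + (0, 1) = β + γ by abel,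
      show β + -(0, 1) + (0, 1) = β by abel]
    ring
  · rw [wSum, wSum, ← (Equiv.subRight ((1, 0) : ZMod N × ZMod N)).sum_comp, Finset.mul_sum]
    refine Finset.sum_congr rfl fun β _ => ?_
    rw [wCoef_add_period_div hτ, wCoef_add_period_div hτ, Equiv.subRight_apply, sub_eq_add_neg,
      AddChar.map_add_eq_mul, show β + -(1, 0) + γ + (1, 0) = β + γ by abel,
      show β + -(1, 0) + (1, 0) = β by abel,
      show -2 * ((x + y) / (N : ℂ)) = -2 * (x / N) + -2 * (y / N) by ring, ePi_add]
    ring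

/-- With trivial twist the associated theta function vanishes at its origin automatically. The
condition on x + y says that the given `u` corresponds to this origin. -/
lemma sum_wCoef_mul_wCoef_eq_zero {γ : ZMod N × ZMod N} (hγ : γ ≠ 0) {x y u : ℂ}
    (hu : theta τ (N * u) ≠ 0) (hxy : x + y = -(N ^ 2 * u)) :
    ∑ β, wCoef N τ (β + γ) x u * wCoef N τ β y u = 0 := by
  have hN := natCast_ne_zero N
  obtain ⟨e, -, hf, hl⟩ := thetaLike_wSum hτ (1 : AddChar (ZMod N × ZMod N) ℂ) hγ x y
  simp only [AddChar.one_apply] at hl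
  have h0 := hl.apply_zero hτ
  rw [show (0 - (x + y) / N) / (N : ℂ) = u by rw [hxy]; field_simp; ring] at h0
  have h1 := (mul_eq_zero.mp h0).resolve_left (ePi_ne_zero _)
  rw [hf u hu] at h1
  have h2 := (mul_eq_zero.mp h1).resolve_right (thetaTors_ne_zero hτ hu)
  simpa [wSum] using h2

/-- The crossing relation for the coefficient functions. -/
lemma exists_sum_wCoef_mul_wCoef_eq (hN : 2 ≤ N) {u : ℂ} (hu : theta τ (N * u) ≠ 0) :
    ∃ C : ℂ, ∀ x, ∑ β, wCoef N τ β (x - N ^ 2 * u) u * wCoef N τ β (-x) u =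
      C * (theta τ x * theta τ (x - N ^ 2 * u)) := by
  have : Fact (1 < N) := ⟨hN⟩
  refine exists_eq_theta_mul_theta hτ _ ?_ ?_ (fun x => ?_) fun x => ?_
  · refine Differentiable.fun_sum fun β _ => ?_
    have := differentiable_wCoef hτ β u
    have h1 : Differentiable ℂ fun x => wCoef N τ β (x - N ^ 2 * u) u :=
      this.comp (differentiable_id.sub_const _)
    have h2 : Differentiable ℂ fun x => wCoef N τ β (-x) u := this.comp differentiable_neg
    fun_prop
  -- The zero at the origin is an off-diagonal identity in disguise: the coefficients equal 1 when
  -- their argument is 0, so the shift by (1, 0) disappears after reindexing. This label is nonzero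
  -- because N ≥ 2.
  · have h := sum_wCoef_mul_wCoef_eq_zero hτ (γ := ((1, 0) : ZMod N × ZMod N)) (by simp)
      (x := -(N ^ 2 * u)) (y := 0) hu (by ring)
    rw [← Equiv.sum_comp (Equiv.addRight ((1, 0) : ZMod N × ZMod N))]
    simp only [wCoef_zero hτ hu, Equiv.coe_addRight, neg_zero, zero_sub, mul_one] at h ⊢
    exact h
  · refine Finset.sum_congr rfl fun β _ => ?_
    have h := wCoef_add_one (τ := τ) β (-(x + 1)) u
    rw [show -(x + 1) + 1 = -x by ring] at h
    rw [h, show x + 1 - N ^ 2 * u = x - N ^ 2 * u + 1 by ring, wCoef_add_one]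
    ring
  · rw [Finset.mul_sum]
    refine Finset.sum_congr rfl fun β _ => ?_
    have h := wCoef_add_period hτ β (-(x + τ)) u
    rw [show -(x + τ) + τ = -x by ring] at h
    rw [h, show x + τ - N ^ 2 * u = x - N ^ 2 * u + τ by ring, wCoef_add_period hτ]
    have e : ePi (-2 * τ - 4 * x + 2 * (N ^ 2 * u)) * ePi (-τ - 2 * -(x + τ) - 2 * u) =
        ePi (-τ - 2 * (x - N ^ 2 * u) - 2 * u) := by
      rw [← ePi_add]; congr 1; ring
    rw [← e]; ring

open Filter Topology in
/-- The off-diagonal part of the unitarity relation for the coefficient functions. -/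
lemma sum_char_mul_wCoef_mul_wCoef_eq_zero {χ : AddChar (ZMod N × ZMod N) ℂ}
    {γ : ZMod N × ZMod N} (hγ : γ ≠ 0) (hχ : χ ≠ 1) (hχγ : χ γ = 1) {x u : ℂ}
    (hu : theta τ (N * u) ≠ 0) :
    ∑ β, χ β * (wCoef N τ (β + γ) x u * wCoef N τ β (-x) u) = 0 := by
  classical
  have hN := natCast_ne_zero N
  have hθ := continuous_theta hτ
  obtain ⟨e, hec, hf, hl⟩ := thetaLike_wSum hτ χ hγ x (-x)
  have hne : χ (-(0, 1)) ≠ 1 ∨ χ (-(1, 0)) ≠ 1 := by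
    by_contra! h
    apply hχ
    have h1 : χ (0, 1) = 1 := by
      have := h.1
      rwa [AddChar.map_neg_eq_inv, inv_eq_one] at this
    have h2 : χ (1, 0) = 1 := by
      have := h.2
      rwa [AddChar.map_neg_eq_inv, inv_eq_one] at this
    ext ⟨a, b⟩
    rw [show (a, b) = a.val • ((1, 0) : ZMod N × ZMod N) + b.val • ((0, 1) : ZMod N × ZMod N) by
      ext <;> simp, AddChar.map_add_eq_mul, AddChar.map_nsmul_eq_pow, AddChar.map_nsmul_eq_pow,
      h1, h2]
    simp
  have hnear : ∀ᶠ v in 𝓝[≠] (0 : ℂ), theta τ (N * v) ≠ 0 := by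
    have hd : HasDerivAt (fun v => theta τ (N * v)) (deriv (theta τ) 0 * N) 0 := by
      have h1 : HasDerivAt (fun v : ℂ => (N : ℂ) * v) N 0 := by
        simpa using (hasDerivAt_id (0 : ℂ)).const_mul (N : ℂ)
      have h2 : HasDerivAt (theta τ) (deriv (theta τ) 0) ((N : ℂ) * 0) := by
        rw [mul_zero]; exact (differentiable_theta hτ 0).hasDerivAt
      exact h2.comp 0 h1
    have := hd.eventually_ne (c := 0) (mul_ne_zero (deriv_theta_zero hτ) hN)
    simpa using this
  have hcont : ∀ α : ZMod N × ZMod N, α ≠ 0 → ∀ z,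
      Tendsto (fun v => wCoef N τ α z v) (𝓝[≠] 0) (𝓝 (wCoef N τ α z 0)) := fun α hα z => by
    have : ContinuousAt (fun v => wCoef N τ α z v) 0 := by
      simp only [wCoef_apply]
      refine ContinuousAt.div (by fun_prop) (by fun_prop) ?_
      rw [zero_add]; exact theta_tors_ne_zero hτ hα
    exact this.tendsto.mono_left nhdsWithin_le_nhds
  have hzero : ∀ z, Tendsto (fun v => wCoef N τ 0 z v * theta τ v) (𝓝[≠] 0) (𝓝 (theta τ z)) := by
    intro z
    have : Tendsto (fun v => theta τ (z + v)) (𝓝[≠] 0) (𝓝 (theta τ z)) := by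
      have : Continuous fun v => theta τ (z + v) := by fun_prop
      have := this.tendsto 0
      rw [add_zero] at this
      exact this.mono_left nhdsWithin_le_nhds
    refine this.congr' ?_
    filter_upwards [hnear] with v hv
    have h0 := theta_add_tors_ne_zero' hτ hv 0
    rw [wCoef_apply]
    simp only [tors, Prod.fst_zero, Prod.snd_zero, ZMod.val_zero, Nat.cast_zero, zero_mul,
      mul_zero, zero_div, add_zero, ePi_zero, one_mul] at h0 ⊢
    field_simp
  have hth0 : Tendsto (theta τ) (𝓝[≠] 0) (𝓝 0) := by
    have := hθ.tendsto 0
    rw [theta_zero hτ] at this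
    exact this.mono_left nhdsWithin_le_nhds
  set A : ℂ := wCoef N τ γ x 0 * theta τ x with hA
  -- Only the labels 0 and -γ have a pole at v = 0. Their residues are opposite, by the oddness of
  -- `theta`, the reflection rule for `wCoef` and χ(γ) = 1.
  have hterm : ∀ β, Tendsto (fun v => χ β * (wCoef N τ (β + γ) x v * wCoef N τ β (-x) v) *
      theta τ v) (𝓝[≠] 0) (𝓝 ((if β = 0 then -A else 0) + if β = -γ then A else 0)) := by
    intro β
    by_cases hβ : β = 0
    · subst hβ
      rw [if_pos rfl, if_neg (by simpa [eq_comm] using hγ), add_zero]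
      have := (hcont γ hγ x).mul (hzero (-x))
      rw [theta_neg hτ, mul_neg, ← hA] at this
      refine this.congr fun v => ?_
      rw [AddChar.map_zero_eq_one, zero_add]; ring
    · by_cases hβ' : β = -γ
      · subst hβ'
        rw [if_neg hβ, if_pos rfl, zero_add]
        have := (hzero x).mul (hcont (-γ) hβ (-x))
        rw [← wCoef_neg hτ γ x 0, neg_zero, mul_comm, ← hA] at this
        refine this.congr fun v => ?_
        rw [AddChar.map_neg_eq_inv, hχγ, neg_add_cancel]; ring
      · rw [if_neg hβ, if_neg hβ', add_zero]
        have h1 : β + γ ≠ 0 := fun h => hβ' (eq_neg_of_add_eq_zero_left h)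
        have := (((hcont _ h1 x).mul (hcont β hβ (-x))).const_mul (χ β)).mul hth0
        rwa [mul_zero] at this
  have hsum : Tendsto (fun v => wSum (τ := τ) χ γ x (-x) v * theta τ v) (𝓝[≠] 0) (𝓝 0) := by
    have := tendsto_finsetSum Finset.univ fun β _ => hterm β
    simp only [← Finset.sum_mul, Finset.sum_add_distrib, Finset.sum_ite_eq', Finset.mem_univ,
      if_true, neg_add_cancel] at this
    exact this
  -- The residues cancel, so the theta function attached to the sum vanishes at the origin; its
  -- nontrivial twist then makes it vanish identically.
  have he0 : e 0 = 0 := by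
    have h1 : Tendsto e (𝓝[≠] 0) (𝓝 (e 0)) := (hec.tendsto 0).mono_left nhdsWithin_le_nhds
    refine tendsto_nhds_unique h1 ?_
    have h2 : Tendsto (fun v => ∏ δ ∈ Finset.univ.erase 0, theta τ (v + tors N τ δ)) (𝓝[≠] 0)
        (𝓝 (∏ δ ∈ Finset.univ.erase 0, theta τ (0 + tors N τ δ))) := by
      have : Continuous fun v => ∏ δ ∈ Finset.univ.erase 0, theta τ (v + tors N τ δ) := by fun_prop
      exact (this.tendsto 0).mono_left nhdsWithin_le_nhds
    have h3 := hsum.mul h2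
    rw [zero_mul] at h3
    refine h3.congr' ?_
    filter_upwards [hnear] with v hv
    rw [hf v hv, thetaTors, ← Finset.mul_prod_erase Finset.univ _ (Finset.mem_univ 0)]
    simp [tors]
    ring
  have hz := hl.eq_zero hτ (AddChar.norm_apply _ _) (AddChar.norm_apply _ _) hne
    (by simp [he0]) (N * u)
  simp only [add_neg_cancel, zero_div, sub_zero, mul_div_cancel_left₀ u hN] at hz
  have h1 := (mul_eq_zero.mp hz).resolve_left (ePi_ne_zero _)
  rw [hf u hu] at h1
  exact (mul_eq_zero.mp h1).resolve_right (thetaTors_ne_zero hτ hu)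

end

/-! ### The diagonal part of the unitarity relation -/

section
open Filter Topology

/-- An even entire function with value `1` at the origin has a second-order expansion there. -/
lemma exists_tendsto_sub_one_div_sq {A : ℂ → ℂ} (hA : Differentiable ℂ A) (h0 : A 0 = 1)
    (heven : ∀ x, A (-x) = A x) :
    ∃ a, Tendsto (fun x => (A x - 1) / x ^ 2) (𝓝[≠] 0) (𝓝 a) := by
  have hd : deriv A 0 = 0 := by
    have h1 : deriv (fun x => A (-x)) 0 = -deriv A (-0) := deriv_comp_neg A 0
    simp only [heven, neg_zero] at h1
    have h1 : deriv A 0 = -deriv A 0 := h1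
    linear_combination h1 / 2
  have hB : Differentiable ℂ (dslope A 0) := by
    have := (Complex.differentiableOn_dslope (univ_mem : Set.univ ∈ 𝓝 (0 : ℂ))).mpr
      hA.differentiableOn
    exact fun x => this.differentiableAt univ_mem
  have hC : Differentiable ℂ (dslope (dslope A 0) 0) := by
    have := (Complex.differentiableOn_dslope (univ_mem : Set.univ ∈ 𝓝 (0 : ℂ))).mpr
      hB.differentiableOn
    exact fun x => this.differentiableAt univ_mem
  refine ⟨dslope (dslope A 0) 0 0, ?_⟩
  refine ((hC.continuous.tendsto 0).mono_left nhdsWithin_le_nhds).congr' ?_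
  filter_upwards [self_mem_nhdsWithin] with x hx
  have hx : x ≠ 0 := hx
  have e1 := sub_smul_dslope A 0 x
  have e2 := sub_smul_dslope (dslope A 0) 0 x
  rw [dslope_same, hd] at e2
  simp only [sub_zero, smul_eq_mul, h0] at e1 e2
  rw [← e1, ← e2]
  field_simp

lemma tendsto_one_of_tendsto_sub_one_div_sq {A : ℂ → ℂ} {a : ℂ}
    (h : Tendsto (fun x => (A x - 1) / x ^ 2) (𝓝[≠] 0) (𝓝 a)) : Tendsto A (𝓝[≠] 0) (𝓝 1) := by
  have h2 : Tendsto (fun x : ℂ => x ^ 2) (𝓝[≠] 0) (𝓝 0) := by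
    have : Continuous fun x : ℂ => x ^ 2 := by fun_prop
    have := this.tendsto 0
    rw [zero_pow two_ne_zero] at this
    exact this.mono_left nhdsWithin_le_nhds
  have h3 := (h.mul h2).add_const 1
  rw [mul_zero, zero_add] at h3
  refine h3.congr' ?_
  filter_upwards [self_mem_nhdsWithin] with x hx
  have hx : x ≠ 0 := hx
  field_simp
  ring

/-- For functions of the form 1 + a x² + o(x²) the coefficients `a` add up under multiplication. -/
lemma tendsto_prod_sub_one_div_sq {ι : Type*} (s : Finset ι) {A : ι → ℂ → ℂ} {a : ι → ℂ}
    (h : ∀ i, Tendsto (fun x => (A i x - 1) / x ^ 2) (𝓝[≠] 0) (𝓝 (a i))) :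
    Tendsto (fun x => ((∏ i ∈ s, A i x) - 1) / x ^ 2) (𝓝[≠] 0) (𝓝 (∑ i ∈ s, a i)) := by
  classical
  induction s using Finset.induction_on with
  | empty => simp
  | insert i s hi ih =>
    rw [Finset.sum_insert hi]
    have h1 := ((h i).mul (tendsto_one_of_tendsto_sub_one_div_sq ih)).add ih
    rw [mul_one] at h1
    refine h1.congr fun x => ?_
    rw [Finset.prod_insert hi]
    ring

variable {N : ℕ} [NeZero N] {τ : ℂ} (hτ : 0 < τ.im)
include hτ

/-- The diagonal part of the unitarity relation for the coefficient functions. -/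
lemma sum_wCoef_mul_wCoef_neg {u : ℂ} (hu : theta τ (N * u) ≠ 0) (x : ℂ) :
    ∑ β, wCoef N τ β x u * wCoef N τ β (-x) u =
      N ^ 2 * (theta τ (N * u + x) * theta τ (N * u - x) / theta τ (N * u) ^ 2) := by
  have hN := natCast_ne_zero N
  have hθ := differentiable_theta hτ
  have hub := theta_add_tors_ne_zero' hτ hu
  set A : ℂ → ℂ → ℂ := fun v x => theta τ (v + x) * theta τ (v - x) / theta τ v ^ 2 with hA
  have hAd : ∀ v, Differentiable ℂ (A v) := fun v => by
    simp only [hA, div_eq_mul_inv]; fun_prop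
  have hA0 : ∀ v, theta τ v ≠ 0 → A v 0 = 1 := fun v hv => by
    simp only [hA, add_zero, sub_zero]; field_simp
  have hAe : ∀ v x, A v (-x) = A v x := fun v x => by
    simp only [hA, sub_neg_eq_add, ← sub_eq_add_neg]; ring
  have hA1 : ∀ v x, A v (x + 1) = A v x := fun v x => by
    have h1 := theta_add_one (τ := τ) (v - (x + 1))
    rw [show v - (x + 1) + 1 = v - x by ring] at h1
    simp only [hA, h1, ← add_assoc, theta_add_one]; ring
  have hAτ : ∀ v x, A v (x + τ) = ePi (-2 * τ - 4 * x) * A v x := fun v x => by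
    have h1 := theta_add_period hτ (v - (x + τ))
    rw [show v - (x + τ) + τ = v - x by ring] at h1
    simp only [hA, h1, ← add_assoc, theta_add_period hτ]
    have e : ePi (-2 * τ - 4 * x) * ePi (-τ - 2 * (v - (x + τ))) = ePi (-τ - 2 * (v + x)) := by
      rw [← ePi_add]; congr 1; ring
    rw [← e]; ring
  have hw : ∀ β, ∀ x, wCoef N τ β x u * wCoef N τ β (-x) u = A (u + tors N τ β) x := fun β x => by
    rw [wCoef_apply, wCoef_apply]
    simp only [hA]
    have e : ePi (2 * β.1.val * x / N) * ePi (2 * β.1.val * -x / N) = 1 := by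
      rw [← ePi_add]; ring_nf; exact ePi_zero
    rw [show x + u + tors N τ β = u + tors N τ β + x by ring,
      show -x + u + tors N τ β = u + tors N τ β - x by ring]
    linear_combination theta τ (u + tors N τ β + x) * theta τ (u + tors N τ β - x) /
      theta τ (u + tors N τ β) ^ 2 * e
  simp only [hw]
  -- The difference of the two sides is a theta function of order two vanishing at 0, hence a
  -- multiple of the square of `theta`. It remains to compare coefficients of x².
  obtain ⟨C, hC⟩ := exists_eq_theta_mul_theta hτ
    (g := fun x => ∑ β, A (u + tors N τ β) x - N ^ 2 * A (N * u) x) 0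
    ((Differentiable.fun_sum fun β _ => hAd _).sub ((hAd _).const_mul _))
    (by simp [hA0 _ hu, hA0 _ (hub _), pow_two])
    (fun x => by simp only [hA1])
    (fun x => by simp only [hAτ, ← Finset.mul_sum, mul_zero, add_zero]; ring)
  simp only [sub_zero] at hC
  choose a ha using fun v (hv : theta τ v ≠ 0) =>
    exists_tendsto_sub_one_div_sq (hAd v) (hA0 v hv) (hAe v)
  -- The product formula over the torsion points is applied at u + x, u - x and u; the constants and
  -- the exponential prefactors cancel in the quotient.
  have hprod : ∀ x, ∏ β, A (u + tors N τ β) x = A (N * u) (N * x) := fun x => by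
    obtain ⟨c, hc, hD⟩ := exists_thetaTors_eq N hτ
    have e1 : ∏ β, A (u + tors N τ β) x =
        thetaTors N τ (u + x) * thetaTors N τ (u - x) / thetaTors N τ u ^ 2 := by
      simp only [hA, Finset.prod_div_distrib, Finset.prod_mul_distrib, Finset.prod_pow, thetaTors]
      simp only [add_right_comm, sub_add_eq_add_sub]
    rw [e1, hD, hD, hD]
    have e2 : ePi (-(N - 1) * (N * (u + x))) * ePi (-(N - 1) * (N * (u - x))) =
        ePi (-(N - 1) * (N * u)) ^ 2 := by
      rw [pow_two, ← ePi_add, ← ePi_add]; congr 1; ring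
    simp only [hA, ← mul_add, ← mul_sub]
    have h0 := ePi_ne_zero (-(N - 1) * (N * u))
    rw [show c * ePi (-(N - 1) * (N * (u + x))) * theta τ (N * (u + x)) *
      (c * ePi (-(N - 1) * (N * (u - x))) * theta τ (N * (u - x))) =
      c ^ 2 * (ePi (-(N - 1) * (N * (u + x))) * ePi (-(N - 1) * (N * (u - x)))) *
      (theta τ (N * (u + x)) * theta τ (N * (u - x))) by ring, e2]
    generalize ePi (-(N - 1) * (N * u)) = g at h0
    field_simp
  -- The product identity turns into a sum of second-order coefficients. The factor N² comes from
  -- the substitution x ↦ Nx on its right-hand side.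
  have hsum : ∑ β, a (u + tors N τ β) (hub β) = N ^ 2 * a (N * u) hu := by
    have h1 := tendsto_prod_sub_one_div_sq Finset.univ fun β => ha (u + tors N τ β) (hub β)
    refine tendsto_nhds_unique h1 ?_
    have h2 : Tendsto (fun x : ℂ => (N : ℂ) * x) (𝓝[≠] 0) (𝓝[≠] 0) := by
      refine tendsto_nhdsWithin_iff.mpr ⟨?_, ?_⟩
      · have : Continuous fun x : ℂ => (N : ℂ) * x := by fun_prop
        have := this.tendsto 0
        rw [mul_zero] at this
        exact this.mono_left nhdsWithin_le_nhds
      · filter_upwards [self_mem_nhdsWithin] with x hx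
        exact mul_ne_zero hN hx
    refine (((ha (N * u) hu).comp h2).const_mul ((N : ℂ) ^ 2)).congr fun x => ?_
    simp only [Function.comp, hprod]
    field_simp
  have hC0 : C = 0 := by
    have h1 : Tendsto (fun x => (∑ β, A (u + tors N τ β) x - N ^ 2 * A (N * u) x) / x ^ 2)
        (𝓝[≠] 0) (𝓝 0) := by
      have h2 := (tendsto_finsetSum Finset.univ fun β _ => ha (u + tors N τ β) (hub β)).sub
        ((ha (N * u) hu).const_mul ((N : ℂ) ^ 2))
      rw [hsum, sub_self] at h2
      refine h2.congr fun x => ?_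
      simp only [← Finset.sum_div, Finset.sum_sub_distrib, Finset.sum_const, Finset.card_univ,
        Fintype.card_prod, ZMod.card, nsmul_eq_mul]
      push_cast
      ring
    have h3 : Tendsto (fun x => C * (theta τ x / x) ^ 2) (𝓝[≠] 0)
        (𝓝 (C * deriv (theta τ) 0 ^ 2)) := by
      have := hasDerivAt_iff_tendsto_slope_zero.mp (hθ 0).hasDerivAt
      simp only [zero_add, theta_zero hτ, sub_zero, smul_eq_mul] at this
      refine ((this.pow 2).const_mul C).congr fun x => ?_
      rw [div_eq_inv_mul]
    have h4 := tendsto_nhds_unique h1 (h3.congr fun x => by rw [hC]; ring)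
    exact (mul_eq_zero.mp h4.symm).resolve_right (pow_ne_zero 2 (deriv_theta_zero hτ))
  have := hC x
  rw [hC0, zero_mul, sub_eq_zero] at this
  exact this

end

/-! ### The matrices `I_α` and their gauge transforms -/

section

variable (N : ℕ) [NeZero N]

/-- The explicit form of the matrices `I_{(a,b)}`. -/
def weylMat (a b : ZMod N) : Matrix (ZMod N) (ZMod N) ℂ :=
  Matrix.of fun i j => if i + a = j then ZMod.stdAddChar (i * b) else 0

lemma weylMat_mul (a b a' b' : ZMod N) : weylMat N a b * weylMat N a' b' =
    ZMod.stdAddChar (a * b') • weylMat N (a + a') (b + b') := by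
  ext i k
  simp only [Matrix.mul_apply, weylMat, Matrix.of_apply, Matrix.smul_apply, ite_mul, zero_mul,
    Finset.sum_ite_eq, Finset.mem_univ, if_true]
  simp only [mul_ite, mul_zero, smul_eq_mul, add_assoc, ← AddChar.map_add_eq_mul]
  congr 2
  ring

lemma weylMat_zero : weylMat N 0 0 = 1 := by
  ext i j
  simp [weylMat, Matrix.one_apply]

lemma gMat_eq : gMat N = weylMat N 0 1 := by
  ext i j
  simp only [gMat, weylMat, Matrix.diagonal_apply, Matrix.of_apply, add_zero, mul_one,
    stdAddChar_val]

lemma hMat_eq : hMat N = weylMat N 1 0 := by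
  ext i j
  simp [hMat, weylMat]

lemma IMat_eq (α : ZMod N × ZMod N) : IMat N α = weylMat N α.1 α.2 := by
  have hg : ∀ k : ℕ, gMat N ^ k = weylMat N 0 k := fun k => by
    induction k with
    | zero => simp [weylMat_zero]
    | succ k ih => rw [pow_succ, ih, gMat_eq, weylMat_mul]; simp
  have hh : ∀ k : ℕ, hMat N ^ k = weylMat N k 0 := fun k => by
    induction k with
    | zero => simp [weylMat_zero]
    | succ k ih => rw [pow_succ, ih, hMat_eq, weylMat_mul]; simp
  rw [IMat, hg, hh, weylMat_mul]
  simp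

lemma isUnit_det_gHalf : IsUnit (gHalf N).det := by
  rw [gHalf, Matrix.det_diagonal, isUnit_iff_ne_zero]
  exact Finset.prod_ne_zero_iff.mpr fun i _ => ePi_ne_zero _

lemma gHalf_mul_self : gHalf N * gHalf N = gMat N := by
  rw [gHalf, gMat, Matrix.diagonal_mul_diagonal]
  congr 1; funext i
  rw [← ePi_add]; ring_nf

/-- The gauge transform of `I_α` by `g^{1/2}`. -/
def XMat (α : ZMod N × ZMod N) : Matrix (ZMod N) (ZMod N) ℂ :=
  gHalf N * weylMat N α.1 α.2 * (gHalf N)⁻¹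

/-- The inverse of `XMat`. -/
def XInv (α : ZMod N × ZMod N) : Matrix (ZMod N) (ZMod N) ℂ :=
  ZMod.stdAddChar (α.1 * α.2) • XMat N (-α)

lemma XMat_mul (α β : ZMod N × ZMod N) :
    XMat N α * XMat N β = ZMod.stdAddChar (α.1 * β.2) • XMat N (α + β) := by
  rw [XMat, XMat, XMat, Matrix.mul_assoc (gHalf N * weylMat N α.1 α.2),
    ← Matrix.mul_assoc (gHalf N)⁻¹, ← Matrix.mul_assoc (gHalf N)⁻¹, Matrix.nonsing_inv_mul _ (isUnit_det_gHalf N), Matrix.one_mul,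
    ← Matrix.mul_assoc, Matrix.mul_assoc (gHalf N), weylMat_mul]
  simp

lemma XMat_zero : XMat N 0 = 1 := by
  rw [XMat, Prod.fst_zero, Prod.snd_zero, weylMat_zero, Matrix.mul_one,
    Matrix.mul_nonsing_inv _ (isUnit_det_gHalf N)]

lemma XInv_zero : XInv N 0 = 1 := by
  simp [XInv, XMat_zero]

lemma XMat_mul_XInv (α : ZMod N × ZMod N) : XMat N α * XInv N α = 1 := by
  rw [XInv, Matrix.mul_smul, XMat_mul, add_neg_cancel, XMat_zero, smul_smul,
    ← AddChar.map_add_eq_mul]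
  simp

lemma gauge_IMat (α : ZMod N × ZMod N) : gHalf N * IMat N α * (gHalf N)⁻¹ = XMat N α := by
  rw [IMat_eq, XMat]

lemma gauge_IMat_inv (α : ZMod N × ZMod N) :
    gHalf N * (IMat N α)⁻¹ * (gHalf N)⁻¹ = XInv N α := by
  rw [← Matrix.inv_eq_right_inv (XMat_mul_XInv N α), ← gauge_IMat, Matrix.mul_inv_rev,
    Matrix.mul_inv_rev, Matrix.nonsing_inv_nonsing_inv _ (isUnit_det_gHalf N), Matrix.mul_assoc]

/-- Conjugation by `G = g^{1/2} h g^{1/2}`. -/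
lemma XMat_mul_GMat (α : ZMod N × ZMod N) :
    XMat N α * GMat N = ZMod.stdAddChar (α.1 - α.2) • (GMat N * XMat N α) := by
  have e1 : XMat N α * GMat N = gHalf N * (weylMat N α.1 α.2 * hMat N) * gHalf N := by
    rw [XMat, GMat]
    simp only [Matrix.mul_assoc]
    rw [← Matrix.mul_assoc (gHalf N)⁻¹ (gHalf N), Matrix.nonsing_inv_mul _ (isUnit_det_gHalf N),
      Matrix.one_mul]
  -- With g^{-1/2} = g⁻¹ g^{1/2}, both orders of the product stand between two copies of g^{1/2},
  -- and only integral powers of g remain to be commuted.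
  have e2 : GMat N * XMat N α = gHalf N * (hMat N * gMat N * weylMat N α.1 α.2 * (gMat N)⁻¹) *
      gHalf N := by
    have : (gHalf N)⁻¹ = (gMat N)⁻¹ * gHalf N := by
      rw [← gHalf_mul_self, Matrix.mul_inv_rev, Matrix.mul_assoc,
        Matrix.nonsing_inv_mul _ (isUnit_det_gHalf N), Matrix.mul_one]
    rw [XMat, GMat, this, ← gHalf_mul_self]
    simp only [Matrix.mul_assoc]
  have hg : IsUnit (gMat N).det := by
    rw [← gHalf_mul_self, Matrix.det_mul]
    exact (isUnit_det_gHalf N).mul (isUnit_det_gHalf N)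
  have e3 : weylMat N α.1 α.2 * hMat N = ZMod.stdAddChar (α.1 - α.2) •
      (hMat N * gMat N * weylMat N α.1 α.2 * (gMat N)⁻¹) := by
    have : weylMat N α.1 α.2 * hMat N * gMat N =
        ZMod.stdAddChar (α.1 - α.2) • (hMat N * gMat N * weylMat N α.1 α.2) := by
      rw [hMat_eq, gMat_eq, Matrix.mul_assoc, weylMat_mul, Matrix.mul_smul,
        Matrix.smul_mul, weylMat_mul, weylMat_mul, smul_smul, smul_smul, smul_smul,
        ← AddChar.map_add_eq_mul, ← AddChar.map_add_eq_mul, ← AddChar.map_add_eq_mul]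
      congr 2
      · ring
      · ring
      · ring
    rw [← Matrix.smul_mul, ← this, Matrix.mul_nonsing_inv_cancel_right _ _ hg]
  rw [e1, e2, e3]
  simp

lemma isUnit_det_GMat : IsUnit (GMat N).det := by
  have : IsUnit (hMat N).det := by
    have h := congrArg Matrix.det (weylMat_mul N 1 0 (-1) 0)
    rw [Matrix.det_mul, mul_zero, AddChar.map_zero_eq_one, one_smul, add_neg_cancel, add_zero,
      weylMat_zero, Matrix.det_one, ← hMat_eq] at h
    exact IsUnit.of_mul_eq_one _ h
  rw [GMat, Matrix.det_mul, Matrix.det_mul]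
  exact ((isUnit_det_gHalf N).mul this).mul (isUnit_det_gHalf N)

/-! ### The `R`-matrix up to normalization -/

/-- The `R`-matrix up to normalization. -/
def SMat (τ x u : ℂ) : Matrix (ZMod N × ZMod N) (ZMod N × ZMod N) ℂ :=
  ∑ α, wCoef N τ α x u • (XMat N α ⊗ₖ XInv N α)

/-- The matrix `SMat` with its two tensor factors exchanged. -/
def SFlip (τ x u : ℂ) : Matrix (ZMod N × ZMod N) (ZMod N × ZMod N) ℂ :=
  ∑ α, wCoef N τ α x u • (XInv N α ⊗ₖ XMat N α)

/-- The normalization of the `R`-matrix. -/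
def rho (ξ ζ τ : ℂ) : ℂ :=
  tauN N (ζ / 2 - ξ) ζ * (ePi (ξ * (2 / N - 2)) * kappaInv N ξ ζ τ *
    (theta τ ζ / theta τ (ξ + ζ))) / N

variable {N} {τ : ℂ} (hτ : 0 < τ.im)

include hτ in
-- Characteristics become a translation by a torsion point; of the exponential factors, only the
-- part depending on ξ survives in the quotient.
lemma W_eq (α : ZMod N × ZMod N) (ξ ζ : ℂ) :
    W N α ξ ζ τ = wCoef N τ α ξ (ζ / N) / N := by
  obtain ⟨C, hC, h⟩ := exists_thetaChar_half_eq hτ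
  have hN := natCast_ne_zero N
  rw [W, thetaChar_eq, thetaChar_eq, h, h, wCoef_apply,
    show ξ + ζ / N + (α.2.val : ℂ) / N + (α.1.val : ℂ) / N * τ = ξ + ζ / N + tors N τ α by
      simp only [tors]; ring,
    show ζ / N + (α.2.val : ℂ) / N + (α.1.val : ℂ) / N * τ = ζ / N + tors N τ α by
      simp only [tors]; ring,
    show (α.1.val / N : ℂ) ^ 2 * τ + 2 * (α.1.val / N) * (ξ + ζ / N + 1 / 2 + α.2.val / N) =
      2 * α.1.val * ξ / N + ((α.1.val / N : ℂ) ^ 2 * τ + 2 * (α.1.val / N) *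
        (ζ / N + 1 / 2 + α.2.val / N)) by ring, ePi_add]
  have h0 := ePi_ne_zero ((α.1.val / N : ℂ) ^ 2 * τ + 2 * (α.1.val / N) *
        (ζ / N + 1 / 2 + α.2.val / N))
  generalize ePi ((α.1.val / N : ℂ) ^ 2 * τ + 2 * (α.1.val / N) *
        (ζ / N + 1 / 2 + α.2.val / N)) = E at h0
  -- If the denominator vanishes, both sides are 0 by the convention for division by zero.
  by_cases hz : theta τ (ζ / N + tors N τ α) = 0
  · simp [hz]
  · field_simp

include hτ in
lemma RHat_eq (ξ ζ : ℂ) : RHat N ξ ζ τ = rho N ξ ζ τ • SMat N τ ξ (ζ / N) := by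
  obtain ⟨C, hC, h⟩ := exists_thetaChar_half_eq hτ
  rw [RHat, RMat, RTilde, h, h, mul_div_mul_left _ _ hC, Matrix.mul_smul, Matrix.smul_mul,
    smul_smul, rho]
  generalize tauN N (ζ / 2 - ξ) ζ * (ePi (ξ * (2 / N - 2)) * kappaInv N ξ ζ τ *
    (theta τ ζ / theta τ (ξ + ζ))) = r
  rw [div_eq_mul_inv, mul_smul]
  congr 1
  rw [Matrix.mul_sum, Matrix.sum_mul, SMat, Finset.smul_sum]
  refine Finset.sum_congr rfl fun α _ => ?_
  rw [W_eq hτ, Matrix.mul_smul, Matrix.smul_mul, ← Matrix.mul_kronecker_mul,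
    ← Matrix.mul_kronecker_mul, gauge_IMat, gauge_IMat_inv, smul_smul, div_eq_inv_mul]

/-- The symplectic character of the discrete Heisenberg group. -/
def sympChar (γ : ZMod N × ZMod N) : AddChar (ZMod N × ZMod N) ℂ where
  toFun β := ZMod.stdAddChar (β.1 * γ.2 - γ.1 * β.2)
  map_zero_eq_one' := by simp
  map_add_eq_mul' a b := by
    rw [← AddChar.map_add_eq_mul]; congr 1; simp; ring

lemma sympChar_apply (γ β : ZMod N × ZMod N) :
    sympChar γ β = ZMod.stdAddChar (β.1 * γ.2 - γ.1 * β.2) := rfl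

lemma sympChar_self (γ : ZMod N × ZMod N) : sympChar γ γ = 1 := by
  simp [sympChar_apply]

lemma sympChar_ne_one {γ : ZMod N × ZMod N} (hγ : γ ≠ 0) : sympChar γ ≠ 1 := by
  intro h
  apply hγ
  have h1 := DFunLike.congr_fun h ((1, 0) : ZMod N × ZMod N)
  have h2 := DFunLike.congr_fun h ((0, 1) : ZMod N × ZMod N)
  simp only [sympChar_apply, AddChar.one_apply, one_mul, mul_zero, sub_zero, zero_mul, mul_one,
    zero_sub] at h1 h2
  have hz : ∀ k : ZMod N, ZMod.stdAddChar k = (1 : ℂ) → k = 0 := fun k hk =>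
    ZMod.injective_stdAddChar (by rw [hk, AddChar.map_zero_eq_one])
  exact Prod.ext (neg_eq_zero.mp (hz _ h2)) (hz _ h1)

/-- The cocycles of the two tensor factors combine to the symplectic character; this is the source
of the twist in the off-diagonal sums for unitarity. -/
lemma XMat_mul_XInv_kronecker (β γ : ZMod N × ZMod N) :
    (XMat N (β + γ) ⊗ₖ XInv N (β + γ)) * (XInv N β ⊗ₖ XMat N β) =
      sympChar γ β • (XMat N γ ⊗ₖ XInv N γ) := by
  rw [← Matrix.mul_kronecker_mul]
  simp only [XInv, Matrix.mul_smul, Matrix.smul_mul, XMat_mul, smul_smul, Matrix.smul_kronecker,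
    Matrix.kronecker_smul, ← AddChar.map_add_eq_mul, sympChar_apply]
  rw [show β + γ + -β = γ by abel, show -(β + γ) + β = -γ by abel]
  congr 2
  simp only [Prod.fst_add, Prod.snd_add, Prod.fst_neg, Prod.snd_neg]
  ring

include hτ in
/-- Unitarity. -/
lemma SMat_mul_SFlip {u : ℂ} (hu : theta τ (N * u) ≠ 0) (x : ℂ) :
    SMat N τ x u * SFlip N τ (-x) u =
      (N ^ 2 * (theta τ (N * u + x) * theta τ (N * u - x) / theta τ (N * u) ^ 2)) • 1 := by
  have key : SMat N τ x u * SFlip N τ (-x) u =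
      ∑ γ, (∑ β, sympChar γ β * (wCoef N τ (β + γ) x u * wCoef N τ β (-x) u)) •
        (XMat N γ ⊗ₖ XInv N γ) := by
    rw [SMat, SFlip, Finset.mul_sum]
    simp only [Finset.sum_smul]
    rw [Finset.sum_comm]
    refine Finset.sum_congr rfl fun β _ => ?_
    rw [Finset.sum_mul, ← Equiv.sum_comp (Equiv.addLeft β)]
    refine Finset.sum_congr rfl fun γ _ => ?_
    rw [Equiv.coe_addLeft, Matrix.mul_smul, Matrix.smul_mul, XMat_mul_XInv_kronecker, smul_smul,
      smul_smul]
    congr 1; ring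
  rw [key, Finset.sum_eq_single 0]
  · have : ∀ β, sympChar (0 : ZMod N × ZMod N) β = 1 := fun β => by simp [sympChar_apply]
    simp only [this, one_mul, add_zero]
    rw [sum_wCoef_mul_wCoef_neg hτ hu, XMat_zero, XInv_zero, Matrix.one_kronecker_one]
  · intro γ _ hγ
    rw [sum_char_mul_wCoef_mul_wCoef_eq_zero hτ hγ (sympChar_ne_one hγ) (sympChar_self γ) hu,
      zero_smul]
  · simp

end

/-! ### Partial traces over an algebra -/

section

variable {N : ℕ} [NeZero N] {A : Type} [Ring A] [Algebra ℂ A]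

lemma scal_mul {n : Type} [Fintype n] (X Y : Matrix n n ℂ) :
    (scal (X * Y) : Matrix n n A) = scal X * scal Y := by
  rw [scal, scal, scal, Matrix.map_mul]

lemma scal_one {n : Type} [Fintype n] [DecidableEq n] :
    (scal (1 : Matrix n n ℂ) : Matrix n n A) = 1 := by
  rw [scal, Matrix.map_one _ (map_zero _) (map_one _)]

lemma scal_smul {n : Type} (c : ℂ) (X : Matrix n n ℂ) :
    (scal (c • X) : Matrix n n A) = c • scal X := by
  ext i j
  simp [scal, Algebra.smul_def]

lemma scal_sum {n ι : Type*} (s : Finset ι) (X : ι → Matrix n n ℂ) :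
    (∑ i ∈ s, X i).map (algebraMap ℂ A) = ∑ i ∈ s, (X i).map (algebraMap ℂ A) := by
  ext i j
  simp [Matrix.sum_apply]

omit [Algebra ℂ A] in
lemma leg₁_mul (X Y : Matrix (ZMod N) (ZMod N) A) : leg₁ (X * Y) = leg₁ X * leg₁ Y := by
  ext ⟨a, b⟩ ⟨c, d⟩
  simp only [leg₁, Matrix.kroneckerMap_apply, Matrix.mul_apply, Fintype.sum_prod_type,
    Matrix.one_apply, mul_ite, mul_one, mul_zero]
  split_ifs with h
  · subst h; simp
  · simp [h]

omit [NeZero N] [Algebra ℂ A] in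
lemma leg₁_one : leg₁ (1 : Matrix (ZMod N) (ZMod N) A) = 1 := by
  rw [leg₁, Matrix.one_kronecker_one]

lemma leg₁_scal_mul_leg₂ (X : Matrix (ZMod N) (ZMod N) ℂ) (Y : Matrix (ZMod N) (ZMod N) A) :
    leg₁ (scal X) * leg₂ Y = leg₂ Y * leg₁ (scal X) := by
  ext ⟨a, b⟩ ⟨c, d⟩
  simp [leg₁, leg₂, Matrix.kroneckerMap_apply, Matrix.mul_apply, Fintype.sum_prod_type,
    Matrix.one_apply, scal, Algebra.commutes]

lemma leg₁_mul_leg₂_scal (X : Matrix (ZMod N) (ZMod N) A) (Y : Matrix (ZMod N) (ZMod N) ℂ) :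
    leg₁ X * leg₂ (scal Y) = leg₂ (scal Y) * leg₁ X := by
  ext ⟨a, b⟩ ⟨c, d⟩
  simp [leg₁, leg₂, Matrix.kroneckerMap_apply, Matrix.mul_apply, Fintype.sum_prod_type,
    Matrix.one_apply, scal, Algebra.commutes]

omit [Algebra ℂ A] in
lemma leg₂_mul (X Y : Matrix (ZMod N) (ZMod N) A) : leg₂ (X * Y) = leg₂ X * leg₂ Y := by
  ext ⟨a, b⟩ ⟨c, d⟩
  simp only [leg₂, Matrix.kroneckerMap_apply, Matrix.mul_apply, Fintype.sum_prod_type,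
    Matrix.one_apply, ite_mul, one_mul, zero_mul]
  split_ifs with h
  · subst h; simp
  · simp [h]

lemma scal_kronecker (X Y : Matrix (ZMod N) (ZMod N) ℂ) :
    (scal (X ⊗ₖ Y) : Matrix _ _ A) = leg₁ (scal X) * leg₂ (scal Y) := by
  ext ⟨a, b⟩ ⟨c, d⟩
  simp [leg₁, leg₂, Matrix.kroneckerMap_apply, Matrix.mul_apply, Fintype.sum_prod_type,
    Matrix.one_apply, scal]

/-- The partial trace over the first tensor factor. -/
def ptr : Matrix (ZMod N × ZMod N) (ZMod N × ZMod N) A →ₗ[ℂ] Matrix (ZMod N) (ZMod N) A where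
  toFun Z := Matrix.of fun b b' => ∑ a, Z (a, b) (a, b')
  map_add' X Y := by ext; simp [Finset.sum_add_distrib]
  map_smul' c X := by ext; simp [Finset.smul_sum]

lemma ptr_apply (Z : Matrix (ZMod N × ZMod N) (ZMod N × ZMod N) A) (b b' : ZMod N) :
    ptr Z b b' = ∑ a, Z (a, b) (a, b') := rfl

lemma ptr_leg₂_mul (Y : Matrix (ZMod N) (ZMod N) A)
    (Z : Matrix (ZMod N × ZMod N) (ZMod N × ZMod N) A) : ptr (leg₂ Y * Z) = Y * ptr Z := by
  ext b b'
  simp only [ptr_apply, leg₂, Matrix.kroneckerMap_apply, Matrix.mul_apply, Fintype.sum_prod_type,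
    Matrix.one_apply, ite_mul, one_mul, zero_mul, Finset.sum_ite_irrel, Finset.sum_const_zero,
    Finset.sum_ite_eq, Finset.mem_univ, if_true, Finset.mul_sum]
  exact Finset.sum_comm

lemma ptr_mul_leg₂ (Y : Matrix (ZMod N) (ZMod N) A)
    (Z : Matrix (ZMod N × ZMod N) (ZMod N × ZMod N) A) : ptr (Z * leg₂ Y) = ptr Z * Y := by
  ext b b'
  simp only [ptr_apply, leg₂, Matrix.kroneckerMap_apply, Matrix.mul_apply, Fintype.sum_prod_type,
    Matrix.one_apply, ite_mul, one_mul, zero_mul, mul_ite, mul_zero, Finset.sum_ite_irrel,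
    Finset.sum_const_zero,
    Finset.sum_ite_eq', Finset.mem_univ, if_true, Finset.sum_mul]
  exact Finset.sum_comm

lemma ptr_leg₁ (Z : Matrix (ZMod N) (ZMod N) A) : ptr (leg₁ Z) = Matrix.scalar _ Z.trace := by
  ext b b'
  simp only [ptr_apply, leg₁, Matrix.kroneckerMap_apply, Matrix.one_apply, Matrix.trace,
    Matrix.diag, Matrix.scalar_apply, Matrix.diagonal_apply, mul_ite, mul_one, mul_zero]
  split_ifs <;> simp

lemma trace_mul_scal (Z : Matrix (ZMod N) (ZMod N) A) (X : Matrix (ZMod N) (ZMod N) ℂ) :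
    (Z * scal X).trace = (scal X * Z).trace := by
  simp only [Matrix.trace, Matrix.diag, Matrix.mul_apply, scal, Matrix.map_apply]
  rw [Finset.sum_comm]
  refine Finset.sum_congr rfl fun i _ => Finset.sum_congr rfl fun j _ => ?_
  rw [Algebra.commutes]

/-- Numerical matrices commute with the entries of `T`, so the trace over the first factor is cyclic
with respect to them. This reverses the order of X and X', while Y and Y' keep theirs. -/
lemma ptr_kronecker_mul (X Y X' Y' : Matrix (ZMod N) (ZMod N) ℂ)
    (T : Matrix (ZMod N) (ZMod N) A) :
    ptr (scal (X ⊗ₖ Y) * leg₁ T * scal (X' ⊗ₖ Y')) =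
      Matrix.scalar _ (scal (X' * X) * T).trace * scal (Y * Y') := by
  have : scal (X ⊗ₖ Y) * leg₁ T * scal (X' ⊗ₖ Y') =
      leg₁ (scal X * T * scal X') * leg₂ (scal (Y * Y')) := by
    rw [scal_kronecker, scal_kronecker, scal_mul, leg₂_mul, leg₁_mul, leg₁_mul]
    simp only [mul_assoc]
    congr 1
    rw [← mul_assoc (leg₂ (scal Y)), ← leg₁_mul_leg₂_scal, mul_assoc]
    congr 1
    rw [← mul_assoc (leg₂ (scal Y)), ← leg₁_mul_leg₂_scal, mul_assoc]
  rw [this, ptr_mul_leg₂, ptr_leg₁, trace_mul_scal, ← mul_assoc, ← scal_mul]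

variable {τ : ℂ} (hτ : 0 < τ.im)

/-- Because of the reversed order in the first factor the β-dependent phases now cancel, in contrast
with unitarity; the crossing sums carry the trivial character. -/
lemma XInv_mul_XMat_smul (β γ : ZMod N × ZMod N) (T : Matrix (ZMod N) (ZMod N) A) :
    Matrix.scalar (ZMod N) (scal (XInv N β * XMat N (β + γ)) * T).trace *
      scal (XInv N (β + γ) * XMat N β) =
    Matrix.scalar _ (scal (XMat N γ) * T).trace * scal (XInv N γ) := by
  have hsc : ∀ (c : ℂ) (a : A), Matrix.scalar (ZMod N) (c • a) = c • Matrix.scalar (ZMod N) a :=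
    fun c a => by ext i j; simp [Matrix.diagonal_apply]
  simp only [XInv, Matrix.smul_mul, XMat_mul, smul_smul, scal_smul, Matrix.trace_smul, hsc,
    Matrix.mul_smul, ← AddChar.map_add_eq_mul]
  rw [show -β + (β + γ) = γ by abel, show -(β + γ) + β = -γ by abel]
  congr 2
  simp only [Prod.fst_add, Prod.snd_add, Prod.fst_neg]
  ring

include hτ in
variable (N) in
/-- Crossing unitarity. -/
lemma exists_ptr_crossing (hN : 2 ≤ N) {u : ℂ} (hu : theta τ (N * u) ≠ 0) :
    ∃ C : ℂ, ∀ (A : Type) [Ring A] [Algebra ℂ A] (x : ℂ) (T : Matrix (ZMod N) (ZMod N) A),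
      ptr (scal (SMat N τ (x - N ^ 2 * u) u) * leg₁ T * scal (SFlip N τ (-x) u)) =
        (C * (theta τ x * theta τ (x - N ^ 2 * u))) • Matrix.scalar _ T.trace := by
  obtain ⟨C, hC⟩ := exists_sum_wCoef_mul_wCoef_eq hτ hN hu
  refine ⟨C, fun A _ _ x T => ?_⟩
  have key : ptr (scal (SMat N τ (x - N ^ 2 * u) u) * leg₁ T * scal (SFlip N τ (-x) u)) =
      ∑ γ, (∑ β, wCoef N τ (β + γ) (x - N ^ 2 * u) u * wCoef N τ β (-x) u) •
        (Matrix.scalar (ZMod N) (scal (XMat N γ) * T).trace * scal (XInv N γ)) := by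
    simp only [SMat, SFlip]
    rw [scal, scal_sum, scal, scal_sum, Finset.mul_sum, map_sum]
    simp only [Finset.sum_smul]
    rw [Finset.sum_comm]
    refine Finset.sum_congr rfl fun β _ => ?_
    rw [Finset.sum_mul, Finset.sum_mul, map_sum, ← Equiv.sum_comp (Equiv.addLeft β)]
    refine Finset.sum_congr rfl fun γ _ => ?_
    rw [Equiv.coe_addLeft]
    change ptr (scal _ * leg₁ T * scal _) = _
    rw [scal_smul, scal_smul, Matrix.smul_mul, Matrix.smul_mul, Matrix.mul_smul, map_smul,
      map_smul, ptr_kronecker_mul, XInv_mul_XMat_smul, smul_smul]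
  rw [key, Finset.sum_eq_single 0]
  · simp only [add_zero]
    rw [hC, XMat_zero, XInv_zero, scal_one, one_mul, mul_one]
  · intro γ _ hγ
    rw [sum_wCoef_mul_wCoef_eq_zero hτ hγ hu (by ring), zero_smul]
  · simp

end

/-! ### Scalar factors -/

section
open Filter Topology

lemma eventually_ne_zero_of_differentiable {f : ℂ → ℂ} (hf : Differentiable ℂ f) {x : ℂ}
    (hx : f x ≠ 0) : ∀ᶠ ξ in codiscrete ℂ, f ξ ≠ 0 :=
  AnalyticOnNhd.preimage_zero_mem_codiscrete (fun x _ => hf.analyticAt x) hx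

lemma tendsto_comp_affine_codiscrete (a b : ℂ) (ha : a ≠ 0) :
    Tendsto (fun ξ => a * ξ + b) (codiscrete ℂ) (codiscrete ℂ) := by
  intro s hs
  rw [mem_map, mem_codiscrete]
  rw [mem_codiscrete] at hs
  intro x
  have h := hs (a * x + b)
  rw [disjoint_principal_right, compl_compl] at h ⊢
  have : Tendsto (fun ξ => a * ξ + b) (𝓝[≠] x) (𝓝[≠] (a * x + b)) := by
    refine tendsto_nhdsWithin_iff.mpr ⟨?_, ?_⟩
    · have : Continuous fun ξ => a * ξ + b := by fun_prop
      exact (this.tendsto x).mono_left nhdsWithin_le_nhds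
    · filter_upwards [self_mem_nhdsWithin] with y hy h
      exact hy (mul_left_cancel₀ ha (add_right_cancel h))
  exact this h

lemma eventually_add {P : ℂ → Prop} (h : ∀ᶠ ξ in codiscrete ℂ, P ξ) (b : ℂ) :
    ∀ᶠ ξ in codiscrete ℂ, P (ξ + b) := by
  simpa using (tendsto_comp_affine_codiscrete 1 b one_ne_zero).eventually h

lemma eventually_neg {P : ℂ → Prop} (h : ∀ᶠ ξ in codiscrete ℂ, P ξ) :
    ∀ᶠ ξ in codiscrete ℂ, P (-ξ) := by
  simpa using (tendsto_comp_affine_codiscrete (-1) 0 (by norm_num)).eventually h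

/-- As Im ξ tends to +∞ the argument tends to 0, where `f` does not vanish. The composite is thus
not identically zero and its zeros are isolated. -/
lemma eventually_comp_ePi_ne_zero {f : ℂ → ℂ} (hf : Differentiable ℂ f) (h0 : f 0 ≠ 0) (c : ℂ) :
    ∀ᶠ ξ in codiscrete ℂ, f (c * ePi (2 * ξ)) ≠ 0 := by
  have ht : Tendsto (fun T : ℝ => c * ePi (2 * (T * I))) atTop (𝓝 0) := by
    rw [← mul_zero c]
    refine Tendsto.const_mul _ (tendsto_zero_iff_norm_tendsto_zero.mpr ?_)
    have : ∀ T : ℝ, ‖ePi (2 * (T * I))‖ = Real.exp (-((2 * Real.pi) * T)) := fun T => by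
      rw [norm_ePi]; congr 1; simp; ring
    simp only [this]
    exact Real.tendsto_exp_neg_atTop_nhds_zero.comp
      (tendsto_id.const_mul_atTop (by positivity))
  have hev := (hf.continuous.tendsto 0).eventually_ne h0
  obtain ⟨T, hT⟩ := (ht.eventually hev).exists
  exact eventually_ne_zero_of_differentiable (f := fun ξ => f (c * ePi (2 * ξ)))
    (hf.comp (by fun_prop : Differentiable ℂ fun ξ => c * ePi (2 * ξ))) hT

lemma eventually_comp_ePi_inv_ne_zero {f : ℂ → ℂ} (hf : Differentiable ℂ f) (h0 : f 0 ≠ 0)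
    (c : ℂ) : ∀ᶠ ξ in codiscrete ℂ, f (c * (ePi (2 * ξ))⁻¹) ≠ 0 := by
  have := eventually_neg (eventually_comp_ePi_ne_zero hf h0 c)
  simpa only [mul_neg, ePi_neg] using this

variable {p Q : ℂ} (hp : ‖p‖ < 1) (hQ : ‖Q‖ < 1)

include hp hQ in
lemma eventually_qPoch_two_ne_zero (c : ℂ) :
    ∀ᶠ ξ in codiscrete ℂ, qPoch (c * ePi (2 * ξ)) ![p, Q] ≠ 0 :=
  eventually_comp_ePi_ne_zero (differentiable_qPoch_two hp hQ)
    (qPoch_two_ne_zero_of_norm_lt hp hQ (by simp)) c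

include hp hQ in
lemma eventually_qPoch_two_inv_ne_zero (c : ℂ) :
    ∀ᶠ ξ in codiscrete ℂ, qPoch (c * (ePi (2 * ξ))⁻¹) ![p, Q] ≠ 0 :=
  eventually_comp_ePi_inv_ne_zero (differentiable_qPoch_two hp hQ)
    (qPoch_two_ne_zero_of_norm_lt hp hQ (by simp)) c

include hQ in
lemma eventually_qPoch_one_ne_zero (c : ℂ) :
    ∀ᶠ ξ in codiscrete ℂ, qPoch (c * ePi (2 * ξ)) ![Q] ≠ 0 :=
  eventually_comp_ePi_ne_zero (differentiable_qPoch_one hQ)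
    (qPoch_one_ne_zero_of_norm_lt hQ (by simp)) c

include hQ in
lemma eventually_qPoch_one_inv_ne_zero (c : ℂ) :
    ∀ᶠ ξ in codiscrete ℂ, qPoch (c * (ePi (2 * ξ))⁻¹) ![Q] ≠ 0 :=
  eventually_comp_ePi_inv_ne_zero (differentiable_qPoch_one hQ)
    (qPoch_one_ne_zero_of_norm_lt hQ (by simp)) c

include hQ in
lemma eventually_Theta_ne_zero (c : ℂ) :
    ∀ᶠ ξ in codiscrete ℂ, Theta Q (c * ePi (2 * ξ)) ≠ 0 := by
  filter_upwards [eventually_qPoch_one_ne_zero hQ c,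
    eventually_qPoch_one_inv_ne_zero hQ (Q * c⁻¹)] with ξ h1 h2
  rw [Theta, mul_inv, ← mul_assoc]
  exact mul_ne_zero (mul_ne_zero h1 h2) (qPoch_one_ne_zero_of_norm_lt hQ hQ)

include hQ in
lemma Theta_mul_nome {z : ℂ} (hQ0 : Q ≠ 0) (hz : z ≠ 0) : Theta Q (Q * z) = -z⁻¹ * Theta Q z := by
  rw [Theta, Theta, qPoch_one_step hQ z, mul_inv, mul_inv_cancel_left₀ hQ0,
    qPoch_one_step hQ z⁻¹]
  field_simp
  ring

include hQ in
lemma Theta_inv {z : ℂ} (hz : z ≠ 0) : Theta Q z⁻¹ = -z⁻¹ * Theta Q z := by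
  rw [Theta, Theta, qPoch_one_step hQ z, inv_inv, qPoch_one_step hQ z⁻¹]
  field_simp
  ring

/-- The scalar factor of the unitarity relation of the normalized `R`-matrix. -/
def unitFactor (Q t y : ℂ) : ℂ :=
  Theta Q (t * y) * Theta Q (t * y⁻¹) / (Theta Q y * Theta Q y⁻¹)

lemma unitFactor_inv (t y : ℂ) : unitFactor Q t y⁻¹ = unitFactor Q t y := by
  rw [unitFactor, unitFactor, inv_inv]; ring

include hQ in
-- Numerator and denominator both acquire the factor (Q y²)⁻¹, independent of `t`.
lemma unitFactor_mul_nome {t y : ℂ} (hQ0 : Q ≠ 0) (ht : t ≠ 0) (hy : y ≠ 0) :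
    unitFactor Q t (Q * y) = unitFactor Q t y := by
  have e1 : Theta Q (t * (Q * y)) = -(t * y)⁻¹ * Theta Q (t * y) := by
    rw [← Theta_mul_nome hQ hQ0 (mul_ne_zero ht hy)]; ring_nf
  have e2 : Theta Q (t * y⁻¹) = -(t * (Q * y)⁻¹)⁻¹ * Theta Q (t * (Q * y)⁻¹) := by
    rw [← Theta_mul_nome hQ hQ0 (mul_ne_zero ht (inv_ne_zero (mul_ne_zero hQ0 hy)))]
    congr 1; field_simp
  have e3 := Theta_mul_nome hQ hQ0 hy
  have e4 : Theta Q y⁻¹ = -((Q * y)⁻¹)⁻¹ * Theta Q (Q * y)⁻¹ := by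
    rw [← Theta_mul_nome hQ hQ0 (inv_ne_zero (mul_ne_zero hQ0 hy))]
    congr 1; field_simp
  have e5 : Theta Q (t * (Q * y)⁻¹) = -(t * (Q * y)⁻¹) * Theta Q (t * y⁻¹) := by
    rw [e2]; field_simp
  have e6 : Theta Q (Q * y)⁻¹ = -(Q * y)⁻¹ * Theta Q y⁻¹ := by
    rw [e4]; field_simp
  rw [unitFactor, unitFactor, e1, e5, e3, e6,
    show -(t * y)⁻¹ * Theta Q (t * y) * (-(t * (Q * y)⁻¹) * Theta Q (t * y⁻¹)) =
      (Q * y ^ 2)⁻¹ * (Theta Q (t * y) * Theta Q (t * y⁻¹)) by field_simp,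
    show -y⁻¹ * Theta Q y * (-(Q * y)⁻¹ * Theta Q y⁻¹) =
      (Q * y ^ 2)⁻¹ * (Theta Q y * Theta Q y⁻¹) by field_simp]
  exact mul_div_mul_left _ _ (inv_ne_zero (mul_ne_zero hQ0 (pow_ne_zero 2 hy)))

include hQ in
lemma unitFactor_eq {t y : ℂ} (ht : t ≠ 0) (hy : y ≠ 0) : unitFactor Q t y =
    t * (Theta Q (y * t) * Theta Q (y * t⁻¹) / Theta Q y ^ 2) := by
  have e1 : Theta Q (t * y⁻¹) = -(t * y⁻¹) * Theta Q (y * t⁻¹) := by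
    have := Theta_inv hQ (z := y * t⁻¹) (by positivity)
    rwa [mul_inv, inv_inv, mul_comm y⁻¹] at this
  rw [unitFactor, e1, Theta_inv hQ hy, mul_comm y t]
  field_simp

/-- The normalization of the `R`-matrix, as a function of `y = z²`, apart from elementary
factors. -/
def mFac (p Q t r y : ℂ) : ℂ :=
  (qPoch (p * Q * y⁻¹) ![p, Q] * qPoch (t * y) ![p, Q] * qPoch (p * y⁻¹) ![p, Q] *
      qPoch (r * y) ![p, Q]) /
    (qPoch (Q * y) ![p, Q] * qPoch (p * t * y⁻¹) ![p, Q] * qPoch y ![p, Q] *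
      qPoch (p * r * y⁻¹) ![p, Q])

include hp hQ

lemma eventually_mFac_ne_zero (t r : ℂ) :
    ∀ᶠ ξ in codiscrete ℂ, mFac p Q t r (ePi (2 * ξ)) ≠ 0 := by
  filter_upwards [eventually_qPoch_two_inv_ne_zero hp hQ (p * Q),
    eventually_qPoch_two_ne_zero hp hQ t, eventually_qPoch_two_inv_ne_zero hp hQ p,
    eventually_qPoch_two_ne_zero hp hQ r, eventually_qPoch_two_ne_zero hp hQ Q,
    eventually_qPoch_two_inv_ne_zero hp hQ (p * t), eventually_qPoch_two_ne_zero hp hQ 1,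
    eventually_qPoch_two_inv_ne_zero hp hQ (p * r)] with ξ h1 h2 h3 h4 h5 h6 h7 h8
  rw [one_mul] at h7
  simp [mFac, h1, h2, h3, h4, h5, h6, h7, h8]

/-- A shift by `p` removes one layer from each double product and leaves single products of base
`Q`. The relation r t = Q pairs them into the theta functions of `unitFactor`. -/
lemma eventually_mFac_shift {t r : ℂ} (hp0 : p ≠ 0) (ht : t ≠ 0) (hr : r * t = Q) :
    ∀ᶠ ξ in codiscrete ℂ, mFac p Q t r (p * ePi (2 * ξ)) * unitFactor Q t (ePi (2 * ξ)) =
      mFac p Q t r (ePi (2 * ξ)) := by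
  filter_upwards [eventually_qPoch_one_ne_zero hQ t, eventually_qPoch_one_ne_zero hQ r,
    eventually_qPoch_one_ne_zero hQ Q, eventually_qPoch_one_ne_zero hQ 1,
    eventually_qPoch_one_inv_ne_zero hQ t, eventually_qPoch_one_inv_ne_zero hQ r,
    eventually_qPoch_one_inv_ne_zero hQ Q, eventually_qPoch_one_inv_ne_zero hQ 1,
    eventually_qPoch_two_ne_zero hp hQ Q,
    eventually_qPoch_two_inv_ne_zero hp hQ (p * t), eventually_qPoch_two_ne_zero hp hQ 1,
    eventually_qPoch_two_inv_ne_zero hp hQ (p * r)] with ξ a1 a2 a3 a4 a5 a6 a7 a8 b1 b2 b3 b4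
  have hy := ePi_ne_zero (2 * ξ)
  generalize ePi (2 * ξ) = y at *
  rw [one_mul] at a4 a8 b3
  have c1 := qPoch_two_step_left hp hQ (t * y)
  have c2 := qPoch_two_step_left hp hQ (r * y)
  have c3 := qPoch_two_step_left hp hQ (Q * y)
  have c4 := qPoch_two_step_left hp hQ y
  have c5 := qPoch_two_step_left hp hQ (t * y⁻¹)
  have c6 := qPoch_two_step_left hp hQ (r * y⁻¹)
  have c7 := qPoch_two_step_left hp hQ (Q * y⁻¹)
  have c8 := qPoch_two_step_left hp hQ y⁻¹
  have e1 : p * Q * (p * y)⁻¹ = Q * y⁻¹ := by field_simp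
  have e2 : t * (p * y) = p * (t * y) := by ring
  have e3 : p * (p * y)⁻¹ = y⁻¹ := by field_simp
  have e4 : r * (p * y) = p * (r * y) := by ring
  have e5 : Q * (p * y) = p * (Q * y) := by ring
  have e6 : p * t * (p * y)⁻¹ = t * y⁻¹ := by field_simp
  have e7 : p * r * (p * y)⁻¹ = r * y⁻¹ := by field_simp
  have f1 : Q * (t * y)⁻¹ = r * y⁻¹ := by rw [← hr]; field_simp
  have f2 : Q * (t * y⁻¹)⁻¹ = r * y := by rw [← hr]; field_simp
  rw [unitFactor, Theta, Theta, Theta, Theta, f1, f2, inv_inv]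
  have hQQ := qPoch_one_ne_zero_of_norm_lt hQ hQ
  rw [c3] at b1
  rw [c4] at b3
  rw [mFac, mFac, e1, e2, e3, e4, e5, e6, e7, c1, c2, c3, c4, c5, c6, c7, c8, mul_assoc p Q,
    mul_assoc p t, mul_assoc p r]
  rw [mul_assoc p t] at b2
  rw [mul_assoc p r] at b4
  have b1' := right_ne_zero_of_mul b1
  have b3' := right_ne_zero_of_mul b3
  generalize qPoch (t * y) ![Q] = x1 at *
  generalize qPoch (r * y) ![Q] = x2 at *
  generalize qPoch (Q * y) ![Q] = x3 at *
  generalize qPoch y ![Q] = x4 at *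
  generalize qPoch (t * y⁻¹) ![Q] = x5 at *
  generalize qPoch (r * y⁻¹) ![Q] = x6 at *
  generalize qPoch (Q * y⁻¹) ![Q] = x7 at *
  generalize qPoch y⁻¹ ![Q] = x8 at *
  generalize qPoch Q ![Q] = x9 at *
  generalize qPoch (p * (t * y)) ![p, Q] = z1 at *
  generalize qPoch (p * (r * y)) ![p, Q] = z2 at *
  generalize qPoch (p * (Q * y)) ![p, Q] = z3 at *
  generalize qPoch (p * y) ![p, Q] = z4 at *
  generalize qPoch (p * (t * y⁻¹)) ![p, Q] = z5 at *
  generalize qPoch (p * (r * y⁻¹)) ![p, Q] = z6 at *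
  generalize qPoch (p * (Q * y⁻¹)) ![p, Q] = z7 at *
  generalize qPoch (p * y⁻¹) ![p, Q] = z8 at *
  field_simp

omit hp in
lemma eventually_unitFactor_ne_zero (t : ℂ) :
    ∀ᶠ ξ in codiscrete ℂ, unitFactor Q t (ePi (2 * ξ)) ≠ 0 := by
  filter_upwards [eventually_Theta_ne_zero hQ t, eventually_Theta_ne_zero hQ 1,
    eventually_neg (eventually_Theta_ne_zero hQ t), eventually_neg (eventually_Theta_ne_zero hQ 1)]
    with ξ h1 h2 h3 h4
  rw [mul_neg, ePi_neg] at h3 h4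
  rw [one_mul] at h2 h4
  rw [unitFactor]
  exact div_ne_zero (mul_ne_zero h1 h3) (mul_ne_zero h2 h4)

/-- Here one layer in the `Q` direction is removed. The remaining single products have base `p` and
assemble into values of `theta` of nome p. -/
lemma eventually_mFac_crossing {t r : ℂ} (hp0 : p ≠ 0) (hQ0 : Q ≠ 0) (ht : t ≠ 0)
    (hr : r * t = Q) :
    ∀ᶠ ξ in codiscrete ℂ,
      mFac p Q t r (ePi (2 * ξ) * Q⁻¹) * (qPoch (ePi (2 * ξ)) ![p] *
        qPoch (p * (ePi (2 * ξ))⁻¹) ![p] * (qPoch (ePi (2 * ξ) * Q⁻¹) ![p] *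
        qPoch (p * (ePi (2 * ξ) * Q⁻¹)⁻¹) ![p])) =
      mFac p Q t r (ePi (2 * ξ)) * (qPoch (ePi (2 * ξ) * t⁻¹) ![p] *
        qPoch (p * (ePi (2 * ξ) * t⁻¹)⁻¹) ![p] * (qPoch (ePi (2 * ξ) * r⁻¹) ![p] *
        qPoch (p * (ePi (2 * ξ) * r⁻¹)⁻¹) ![p])) := by
  have hr0 : r ≠ 0 := by rintro rfl; simp at hr; exact hQ0 hr.symm
  filter_upwards [eventually_qPoch_two_ne_zero hp hQ Q,
    eventually_qPoch_two_inv_ne_zero hp hQ (p * t), eventually_qPoch_two_ne_zero hp hQ 1,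
    eventually_qPoch_two_inv_ne_zero hp hQ (p * r), eventually_qPoch_two_ne_zero hp hQ Q⁻¹,
    eventually_qPoch_two_inv_ne_zero hp hQ (p * t * Q),
    eventually_qPoch_two_inv_ne_zero hp hQ (p * r * Q)] with ξ b1 b2 b3 b4 b5 b6 b7
  have hy := ePi_ne_zero (2 * ξ)
  generalize ePi (2 * ξ) = y at *
  rw [one_mul] at b3
  have c1 := qPoch_two_step_right hp hQ (y * t⁻¹)
  have c2 := qPoch_two_step_right hp hQ (y * r⁻¹)
  have c3 := qPoch_two_step_right hp hQ y
  have c4 := qPoch_two_step_right hp hQ (y * Q⁻¹)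
  have c5 := qPoch_two_step_right hp hQ (p * (y * t⁻¹)⁻¹)
  have c6 := qPoch_two_step_right hp hQ (p * (y * r⁻¹)⁻¹)
  have c7 := qPoch_two_step_right hp hQ (p * (y * Q⁻¹)⁻¹)
  have c8 := qPoch_two_step_right hp hQ (p * y⁻¹)
  have e1 : Q * (y * t⁻¹) = r * y := by rw [← hr]; field_simp
  have e2 : Q * (y * r⁻¹) = t * y := by rw [← hr]; field_simp
  have e3 : Q * (y * Q⁻¹) = y := by field_simp
  have e4 : p * (y * t⁻¹)⁻¹ = p * t * y⁻¹ := by field_simp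
  have e5 : p * (y * r⁻¹)⁻¹ = p * r * y⁻¹ := by field_simp
  have e6 : p * (y * Q⁻¹)⁻¹ = p * Q * y⁻¹ := by field_simp
  have e7 : Q * (p * t * y⁻¹) = p * t * Q * y⁻¹ := by ring
  have e8 : Q * (p * r * y⁻¹) = p * r * Q * y⁻¹ := by ring
  have e9 : Q * (p * Q * y⁻¹) = p * Q * (y * Q⁻¹)⁻¹ := by field_simp
  have e10 : t * (y * Q⁻¹) = y * r⁻¹ := by rw [← hr]; field_simp
  have e11 : r * (y * Q⁻¹) = y * t⁻¹ := by rw [← hr]; field_simp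
  have e12 : p * t * (y * Q⁻¹)⁻¹ = p * t * Q * y⁻¹ := by field_simp
  have e13 : p * r * (y * Q⁻¹)⁻¹ = p * r * Q * y⁻¹ := by field_simp
  have e14 : Q * (p * y⁻¹) = p * Q * y⁻¹ := by ring
  rw [e1] at c1
  rw [e2] at c2
  rw [e3] at c4
  rw [e4, e7] at c5
  rw [e5, e8] at c6
  rw [e6, e9] at c7
  rw [e14] at c8
  rw [mFac, mFac, e3, e10, e11, e12, e13, e6, e4, e5]
  rw [mul_comm] at b5
  rw [c1, c2, c7, c8, c5, c6, c3, c4]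
  rw [c5] at b2
  rw [c6] at b4
  rw [c3] at b3
  rw [c4] at b5
  have n1 := left_ne_zero_of_mul b2
  have n2 := left_ne_zero_of_mul b3
  have n3 := left_ne_zero_of_mul b4
  have n4 := left_ne_zero_of_mul b5
  have n5 := right_ne_zero_of_mul b5
  generalize qPoch (y * t⁻¹) ![p] = x1 at *
  generalize qPoch (y * r⁻¹) ![p] = x2 at *
  generalize qPoch y ![p] = x3 at *
  generalize qPoch (y * Q⁻¹) ![p] = x4 at *
  generalize qPoch (p * t * y⁻¹) ![p] = x5 at *
  generalize qPoch (p * r * y⁻¹) ![p] = x6 at *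
  generalize qPoch (p * Q * y⁻¹) ![p] = x7 at *
  generalize qPoch (p * y⁻¹) ![p] = x8 at *
  generalize qPoch (r * y) ![p, Q] = z1 at *
  generalize qPoch (t * y) ![p, Q] = z2 at *
  generalize qPoch (Q * y) ![p, Q] = z3 at *
  generalize qPoch y ![p, Q] = z4 at *
  generalize qPoch (p * t * Q * y⁻¹) ![p, Q] = z5 at *
  generalize qPoch (p * r * Q * y⁻¹) ![p, Q] = z6 at *
  generalize qPoch (p * Q * (y * Q⁻¹)⁻¹) ![p, Q] = z7 at *
  generalize qPoch (p * Q * y⁻¹) ![p, Q] = z8 at *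
  field_simp
  rw [c7, c3]
  ring

/-- The theta quotient coming from `tauN` moves factors p between the double products of `kappaInv`,
giving the more symmetric form for which the shift and crossing rules are simple. -/
lemma eventually_Theta_mul_eq_mFac {t r : ℂ} (ht : t ≠ 0) (hr : r * t = Q) :
    ∀ᶠ ξ in codiscrete ℂ,
      Theta Q (t * (ePi (2 * ξ))⁻¹) / Theta Q (ePi (2 * ξ)) *
      ((qPoch (Q * (ePi (2 * ξ))⁻¹) ![p, Q] * qPoch (t * ePi (2 * ξ)) ![p, Q] *
        qPoch (p * (ePi (2 * ξ))⁻¹) ![p, Q] * qPoch (p * r * ePi (2 * ξ)) ![p, Q]) /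
      (qPoch (Q * ePi (2 * ξ)) ![p, Q] * qPoch (t * (ePi (2 * ξ))⁻¹) ![p, Q] *
        qPoch (p * ePi (2 * ξ)) ![p, Q] * qPoch (p * r * (ePi (2 * ξ))⁻¹) ![p, Q])) =
      mFac p Q t r (ePi (2 * ξ)) := by
  filter_upwards [eventually_Theta_ne_zero hQ 1, eventually_qPoch_one_inv_ne_zero hQ t,
    eventually_qPoch_one_ne_zero hQ r, eventually_qPoch_two_ne_zero hp hQ 1,
    eventually_qPoch_two_inv_ne_zero hp hQ t,
    eventually_qPoch_two_ne_zero hp hQ r] with ξ a1 a2 a3 b1 b2 b3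
  have hy := ePi_ne_zero (2 * ξ)
  generalize ePi (2 * ξ) = y at *
  rw [one_mul] at a1 b1
  have f1 : Q * (t * y⁻¹)⁻¹ = r * y := by rw [← hr]; field_simp
  rw [Theta] at a1
  rw [Theta, Theta, f1, mFac]
  have hQQ := right_ne_zero_of_mul a1
  have n1 := left_ne_zero_of_mul (left_ne_zero_of_mul a1)
  have n2 := right_ne_zero_of_mul (left_ne_zero_of_mul a1)
  have c1 := qPoch_two_step_left hp hQ (t * y⁻¹)
  have c2 := qPoch_two_step_left hp hQ (r * y)
  have c3 := qPoch_two_step_left hp hQ y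
  have c4 := qPoch_two_step_left hp hQ (Q * y⁻¹)
  rw [mul_assoc p Q, mul_assoc p t, mul_assoc p r y]
  rw [c1] at b2
  rw [c2] at b3
  rw [c3] at b1
  have m1 := right_ne_zero_of_mul b1
  have m2 := right_ne_zero_of_mul b2
  have m3 := right_ne_zero_of_mul b3
  rw [c1, c2, c3, c4]
  generalize qPoch (t * y⁻¹) ![Q] = x1 at *
  generalize qPoch (r * y) ![Q] = x2 at *
  generalize qPoch y ![Q] = x3 at *
  generalize qPoch (Q * y⁻¹) ![Q] = x4 at *
  generalize qPoch Q ![Q] = x5 at *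
  generalize qPoch (p * (t * y⁻¹)) ![p, Q] = z1 at *
  generalize qPoch (p * (r * y)) ![p, Q] = z2 at *
  generalize qPoch (p * y) ![p, Q] = z3 at *
  generalize qPoch (p * (Q * y⁻¹)) ![p, Q] = z4 at *
  field_simp

end

/-! ### The normalization of the `R`-matrix -/

section
open Filter Topology

variable (N : ℕ) [NeZero N] {ζ τ : ℂ} (hζ : 0 < ζ.im) (hτ : 0 < τ.im)

/-- The constant factor of the normalization of the `R`-matrix. -/
def rhoConst (ζ τ : ℂ) : ℂ := ePi (ζ / 2 * (2 / N - 2)) * theta τ ζ / N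

/-- The scalar factor of the unitarity relation in the additive variable. -/
def unitFun (ζ ξ : ℂ) : ℂ := unitFactor (ePi ζ ^ (2 * N)) (ePi ζ ^ 2) (ePi (2 * ξ))

include hζ in
lemma norm_ePi_pow_lt_one : ‖ePi ζ ^ (2 * N)‖ < 1 := by
  rw [norm_pow]
  exact pow_lt_one₀ (norm_nonneg _) (norm_ePi_lt_one hζ) (by have := NeZero.ne N; omega)

lemma ePi_pow_mul (ζ : ℂ) : ePi ζ ^ (2 * N - 2) * ePi ζ ^ 2 = ePi ζ ^ (2 * N) := by
  rw [← pow_add]; congr 1; have := NeZero.ne N; omega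

include hζ hτ in
-- The fractional powers of z in `tauN` and in the R-matrix multiply to a constant, so that only
-- `mFac` and one theta function still depend on ξ.
lemma eventually_rho_eq : ∀ᶠ ξ in codiscrete ℂ, rho N ξ ζ τ =
    rhoConst N ζ τ * mFac (ePi (2 * τ)) (ePi ζ ^ (2 * N)) (ePi ζ ^ 2) (ePi ζ ^ (2 * N - 2))
      (ePi (2 * ξ)) / theta τ (ξ + ζ) := by
  filter_upwards [eventually_Theta_mul_eq_mFac (norm_nome_lt_one hτ) (norm_ePi_pow_lt_one N hζ)
    (pow_ne_zero 2 (ePi_ne_zero ζ)) (ePi_pow_mul N ζ)] with ξ h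
  have ev : ePi (ζ / 2 - ξ) ^ 2 = ePi ζ * (ePi (2 * ξ))⁻¹ := by
    rw [ePi_pow, ← ePi_neg, ← ePi_add]; congr 1; push_cast; ring
  have ex : ePi ξ ^ 2 = ePi (2 * ξ) := by rw [ePi_pow]; norm_num
  have ec : ePi ((ζ / 2 - ξ) * (2 / N - 2)) * ePi (ξ * (2 / N - 2)) =
      ePi (ζ / 2 * (2 / N - 2)) := by rw [← ePi_add]; ring_nf
  have hq := ePi_ne_zero ζ
  have hy := ePi_ne_zero (2 * ξ)
  rw [rho, rhoConst, tauN, kappaInv, ← ec, ← h]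
  simp only [ev, ex]
  rw [show ePi ζ * (ePi ζ * (ePi (2 * ξ))⁻¹) = ePi ζ ^ 2 * (ePi (2 * ξ))⁻¹ by ring,
    show ePi ζ * (ePi ζ * (ePi (2 * ξ))⁻¹)⁻¹ = ePi (2 * ξ) by field_simp]
  ring

include hτ in
lemma eventually_theta_ne_zero : ∀ᶠ ξ in codiscrete ℂ, theta τ ξ ≠ 0 :=
  eventually_ne_zero_of_differentiable (differentiable_theta hτ) (theta_ne_zero_half hτ)

include hζ hτ in
lemma eventually_rho_ne_zero (h : theta τ ζ ≠ 0) : ∀ᶠ ξ in codiscrete ℂ, rho N ξ ζ τ ≠ 0 := by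
  filter_upwards [eventually_rho_eq N hζ hτ,
    eventually_mFac_ne_zero (norm_nome_lt_one hτ) (norm_ePi_pow_lt_one N hζ) (ePi ζ ^ 2)
      (ePi ζ ^ (2 * N - 2)), eventually_add (eventually_theta_ne_zero hτ) ζ] with ξ h1 h2 h3
  rw [h1, rhoConst]
  exact div_ne_zero (mul_ne_zero (div_ne_zero (mul_ne_zero (ePi_ne_zero _) h)
    (natCast_ne_zero N)) h2) h3

include hζ in
lemma eventually_unitFun_ne_zero : ∀ᶠ ξ in codiscrete ℂ, unitFun N ζ ξ ≠ 0 :=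
  eventually_unitFactor_ne_zero (norm_ePi_pow_lt_one N hζ) _

lemma ePi_two_mul_add_one (ξ : ℂ) : ePi (2 * (ξ + 1)) = ePi (2 * ξ) := by
  rw [mul_add, ePi_add, (ePi_eq_one_iff (x := 1)).mpr ⟨1, by simp⟩, mul_one]

omit [NeZero N] in
lemma unitFun_add_one (ζ ξ : ℂ) : unitFun N ζ (ξ + 1) = unitFun N ζ ξ := by
  rw [unitFun, ePi_two_mul_add_one, unitFun]

omit [NeZero N] in
lemma unitFun_neg (ζ ξ : ℂ) : unitFun N ζ (-ξ) = unitFun N ζ ξ := by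
  rw [unitFun, mul_neg, ePi_neg, unitFactor_inv, unitFun]

include hζ in
lemma unitFun_add_mul (ξ : ℂ) : unitFun N ζ (ξ + N * ζ) = unitFun N ζ ξ := by
  have : ePi (2 * (ξ + N * ζ)) = ePi ζ ^ (2 * N) * ePi (2 * ξ) := by
    rw [ePi_pow, ← ePi_add]; congr 1; push_cast; ring
  rw [unitFun, this, unitFactor_mul_nome (norm_ePi_pow_lt_one N hζ)
    (pow_ne_zero _ (ePi_ne_zero ζ)) (pow_ne_zero _ (ePi_ne_zero ζ)) (ePi_ne_zero _), unitFun]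

/-- The scalar relating the `R`-matrix at `ξ + τ + 1` and at `ξ`. -/
def shiftFun (ζ ξ : ℂ) : ℂ := ePi (2 * ζ - 2 * ζ / N) / unitFun N ζ ξ

include hζ hτ in
-- The multiplier of the theta function in the denominator of `rho` absorbs that of the coefficients
-- up to a constant. The resulting scalar `shiftFun` does not involve τ, so the same function serves
-- for τ*.
lemma eventually_rho_shift : ∀ᶠ ξ in codiscrete ℂ,
    rho N (ξ + τ + 1) ζ τ * ePi (-τ - 2 * ξ - 2 * (ζ / N)) = shiftFun N ζ ξ * rho N ξ ζ τ := by
  have h := eventually_add (eventually_rho_eq N hζ hτ) (τ + 1)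
  filter_upwards [eventually_rho_eq N hζ hτ, h, eventually_unitFun_ne_zero N hζ,
    eventually_mFac_shift (norm_nome_lt_one hτ) (norm_ePi_pow_lt_one N hζ) (ePi_ne_zero _)
      (pow_ne_zero 2 (ePi_ne_zero ζ)) (ePi_pow_mul N ζ)] with ξ h1 h2 h3 h4
  rw [add_assoc, h1, h2, ← h4, shiftFun, ← add_assoc, ePi_two_mul_add_one,
    show 2 * (ξ + τ) = 2 * τ + 2 * ξ by ring, ePi_add (2 * τ),
    show ξ + τ + 1 + ζ = (ξ + ζ) + τ + 1 by ring, theta_add_one, theta_add_period hτ,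
    ← unitFun, show -τ - 2 * ξ - 2 * (ζ / N) = -τ - 2 * (ξ + ζ) + (2 * ζ - 2 * ζ / N) by ring,
    ePi_add]
  have := ePi_ne_zero (-τ - 2 * (ξ + ζ))
  generalize ePi (-τ - 2 * (ξ + ζ)) = E at *
  generalize mFac (ePi (2 * τ)) _ _ _ _ = m
  field_simp

include hζ hτ in
-- The theta values on the left are those of the crossing relation, those on the right come from the
-- inverse of R̂. This is the identity that makes the factor in crossing unitarity constant in ξ.
lemma eventually_rho_crossing : ∀ᶠ ξ in codiscrete ℂ,
    rho N (ξ - N * ζ) ζ τ * (theta τ ξ * theta τ (ξ - N * ζ)) =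
      rho N ξ ζ τ * (theta τ (ζ + ξ) * theta τ (ξ - ζ)) := by
  have h := eventually_add (eventually_rho_eq N hζ hτ) (-(N * ζ))
  filter_upwards [eventually_rho_eq N hζ hτ, h,
    eventually_add (eventually_theta_ne_zero hτ) ζ,
    eventually_add (eventually_theta_ne_zero hτ) (-(N * ζ) + ζ),
    eventually_mFac_crossing (norm_nome_lt_one hτ) (norm_ePi_pow_lt_one N hζ) (ePi_ne_zero _)
      (pow_ne_zero (2 * N) (ePi_ne_zero ζ)) (pow_ne_zero 2 (ePi_ne_zero ζ)) (ePi_pow_mul N ζ)]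
    with ξ h1 h2 t1 t2 h4
  have y1 : ePi (2 * (ξ - N * ζ)) = ePi (2 * ξ) * (ePi ζ ^ (2 * N))⁻¹ := by
    rw [ePi_pow, ← ePi_neg, ← ePi_add]; congr 1; push_cast; ring
  have y2 : ePi (2 * (ξ - ζ)) = ePi (2 * ξ) * (ePi ζ ^ 2)⁻¹ := by
    rw [ePi_pow, ← ePi_neg, ← ePi_add]; congr 1; push_cast; ring
  have y3 : ePi (2 * (ξ - N * ζ + ζ)) = ePi (2 * ξ) * (ePi ζ ^ (2 * N - 2))⁻¹ := by
    have := NeZero.one_le (n := N)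
    rw [ePi_pow, ← ePi_neg, ← ePi_add]; congr 1; push_cast [show 2 ≤ 2 * N by omega]; ring
  have key : mFac (ePi (2 * τ)) (ePi ζ ^ (2 * N)) (ePi ζ ^ 2) (ePi ζ ^ (2 * N - 2))
      (ePi (2 * (ξ - N * ζ))) * (theta τ ξ * theta τ (ξ - N * ζ)) =
      mFac (ePi (2 * τ)) (ePi ζ ^ (2 * N)) (ePi ζ ^ 2) (ePi ζ ^ (2 * N - 2))
      (ePi (2 * ξ)) * (theta τ (ξ - ζ) * theta τ (ξ - N * ζ + ζ)) := by
    simp only [theta, y1, y2, y3]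
    have e : ePi (-(ξ - ζ)) * ePi (-(ξ - N * ζ + ζ)) = ePi (-ξ) * ePi (-(ξ - N * ζ)) := by
      rw [← ePi_add, ← ePi_add]; congr 1; ring
    linear_combination (ePi (-ξ) * ePi (-(ξ - N * ζ))) * h4 -
      (mFac (ePi (2 * τ)) (ePi ζ ^ (2 * N)) (ePi ζ ^ 2) (ePi ζ ^ (2 * N - 2))
      (ePi (2 * ξ)) * (qPoch (ePi (2 * ξ) * (ePi ζ ^ 2)⁻¹) ![ePi (2 * τ)] *
        qPoch (ePi (2 * τ) * (ePi (2 * ξ) * (ePi ζ ^ 2)⁻¹)⁻¹) ![ePi (2 * τ)] *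
        (qPoch (ePi (2 * ξ) * (ePi ζ ^ (2 * N - 2))⁻¹) ![ePi (2 * τ)] *
        qPoch (ePi (2 * τ) * (ePi (2 * ξ) * (ePi ζ ^ (2 * N - 2))⁻¹)⁻¹) ![ePi (2 * τ)]))) * e
  rw [← sub_eq_add_neg] at h2
  rw [← add_assoc, ← sub_eq_add_neg] at t2
  rw [h1, h2, add_comm ζ ξ]
  generalize mFac (ePi (2 * τ)) _ _ _ (ePi (2 * (ξ - N * ζ))) = m1 at *
  generalize mFac (ePi (2 * τ)) _ _ _ _ = m2 at *
  field_simp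
  linear_combination (rhoConst N ζ τ) * key

end

/-! ### Quasi-periodicity, inversion and crossing of the `R`-matrix -/

section
open Filter Topology

variable (N : ℕ) [NeZero N] {ζ τ : ℂ}

lemma wCoef_add_period_add_one (hτ : 0 < τ.im) (α : ZMod N × ZMod N) (x u : ℂ) :
    wCoef N τ α (x + τ + 1) u =
      ePi (-τ - 2 * x - 2 * u) * (ZMod.stdAddChar (α.1 - α.2) * wCoef N τ α x u) := by
  rw [wCoef_add_one, wCoef_add_period hτ, sub_eq_add_neg α.1, AddChar.map_add_eq_mul]
  ring

lemma inv_GMat_mul_XMat_mul_GMat (α : ZMod N × ZMod N) :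
    (GMat N)⁻¹ * XMat N α * GMat N = ZMod.stdAddChar (α.1 - α.2) • XMat N α := by
  rw [Matrix.mul_assoc, XMat_mul_GMat, Matrix.mul_smul,
    Matrix.nonsing_inv_mul_cancel_left _ _ (isUnit_det_GMat N)]

lemma eventually_rho_mul_wCoef_shift (hζ : 0 < ζ.im) (hτ : 0 < τ.im) :
    ∀ᶠ ξ in codiscrete ℂ, ∀ α : ZMod N × ZMod N,
      rho N (ξ + τ + 1) ζ τ * wCoef N τ α (ξ + τ + 1) (ζ / N) =
        shiftFun N ζ ξ * (ZMod.stdAddChar (α.1 - α.2) *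
          (rho N ξ ζ τ * wCoef N τ α ξ (ζ / N))) := by
  filter_upwards [eventually_rho_shift N hζ hτ] with ξ h α
  rw [wCoef_add_period_add_one N hτ, ← mul_assoc, h]
  ring

/-- The phase which the coefficient of label α acquires is exactly the one by which G conjugates
X_α. -/
lemma eventually_RHat_shift (hζ : 0 < ζ.im) (hτ : 0 < τ.im) :
    ∀ᶠ ξ in codiscrete ℂ, RHat N (ξ + τ + 1) ζ τ = shiftFun N ζ ξ •
      (((GMat N)⁻¹ ⊗ₖ 1) * RHat N ξ ζ τ * (GMat N ⊗ₖ 1)) := by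
  filter_upwards [eventually_rho_mul_wCoef_shift N hζ hτ] with ξ h
  rw [RHat_eq hτ, RHat_eq hτ, SMat, SMat, Finset.smul_sum, Finset.smul_sum, Finset.mul_sum,
    Finset.sum_mul, Finset.smul_sum]
  refine Finset.sum_congr rfl fun α _ => ?_
  rw [smul_smul, h, smul_smul, Matrix.mul_smul, Matrix.smul_mul, ← Matrix.mul_kronecker_mul,
    ← Matrix.mul_kronecker_mul, inv_GMat_mul_XMat_mul_GMat, Matrix.one_mul, Matrix.mul_one,
    Matrix.smul_kronecker, smul_smul, smul_smul]
  congr 1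
  ring

/-- After k steps the phase is the k-th power of the one-step phase, an N-th root of unity; it
disappears when N divides k, and only scalars remain. -/
lemma eventually_RHat_add_mul (hζ : 0 < ζ.im) (hτ : 0 < τ.im) {n : ℕ} (hn : N ∣ n) :
    ∀ᶠ ξ in codiscrete ℂ, RHat N (ξ + n * (τ + 1)) ζ τ =
      (∏ j ∈ Finset.range n, shiftFun N ζ (ξ + j * (τ + 1))) • RHat N ξ ζ τ := by
  have key : ∀ k : ℕ, ∀ᶠ ξ in codiscrete ℂ, ∀ α : ZMod N × ZMod N,
      rho N (ξ + k * (τ + 1)) ζ τ * wCoef N τ α (ξ + k * (τ + 1)) (ζ / N) =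
        (∏ j ∈ Finset.range k, shiftFun N ζ (ξ + j * (τ + 1))) *
          (ZMod.stdAddChar ((k : ZMod N) * (α.1 - α.2)) *
          (rho N ξ ζ τ * wCoef N τ α ξ (ζ / N))) := by
    intro k
    induction k with
    | zero => simp
    | succ k ih =>
      filter_upwards [ih, eventually_add (eventually_rho_mul_wCoef_shift N hζ hτ)
        (k * (τ + 1))] with ξ h1 h2 α
      rw [show ξ + (k + 1 : ℕ) * (τ + 1) = ξ + k * (τ + 1) + τ + 1 by push_cast; ring, h2, h1,
        Finset.prod_range_succ, Nat.cast_succ, add_mul (k : ZMod N), one_mul,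
        AddChar.map_add_eq_mul]
      ring
  filter_upwards [key n] with ξ h
  rw [RHat_eq hτ, RHat_eq hτ, SMat, SMat, Finset.smul_sum, Finset.smul_sum, Finset.smul_sum]
  refine Finset.sum_congr rfl fun α _ => ?_
  rw [smul_smul, h, (ZMod.natCast_eq_zero_iff n N).mpr hn, zero_mul, AddChar.map_zero_eq_one,
    one_mul, smul_smul, smul_smul]
  congr 1
  ring

lemma wCoef_add_natCast (α : ZMod N × ZMod N) (n : ℕ) (x u : ℂ) :
    wCoef N τ α (x + n) u =
      (-1) ^ n * (ZMod.stdAddChar ((n : ZMod N) * α.1) * wCoef N τ α x u) := by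
  induction n with
  | zero => simp
  | succ n ih =>
    rw [Nat.cast_succ, ← add_assoc, wCoef_add_one, ih, Nat.cast_succ, add_mul, one_mul,
      AddChar.map_add_eq_mul]
    ring

lemma theta_add_natCast (n : ℕ) (x : ℂ) : theta τ (x + n) = (-1) ^ n * theta τ x := by
  induction n with
  | zero => simp
  | succ n ih =>
    rw [Nat.cast_succ, ← add_assoc, theta_add_one, ih]
    ring

lemma ePi_two_mul_natCast (n : ℕ) : ePi (2 * n) = 1 := (ePi_eq_one_iff (x := n)).mpr ⟨n, by simp⟩

/-- The `R`-matrix is a function of `z^{2/N}`. -/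
lemma RHat_add_natCast (hτ : 0 < τ.im) (ξ : ℂ) : RHat N (ξ + N) ζ τ = RHat N ξ ζ τ := by
  have hN := natCast_ne_zero N
  have e1 : ePi ξ ^ 2 = ePi (2 * ξ) := by rw [ePi_pow]; norm_num
  have e2 : ePi (ξ + N) ^ 2 = ePi (2 * ξ) := by
    rw [ePi_pow, mul_add]
    push_cast
    rw [ePi_add, ePi_two_mul_natCast, mul_one]
  have e3 : ePi (ζ / 2 - (ξ + N)) ^ 2 = ePi (ζ / 2 - ξ) ^ 2 := by
    rw [ePi_pow, ePi_pow]
    push_cast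
    rw [← sub_sub, mul_sub 2 _ (N : ℂ), ePi_sub, ePi_two_mul_natCast, div_one]
  have e4 : ePi ((ζ / 2 - (ξ + N)) * (2 / N - 2)) * ePi ((ξ + N) * (2 / N - 2)) =
      ePi ((ζ / 2 - ξ) * (2 / N - 2)) * ePi (ξ * (2 / N - 2)) := by
    rw [← ePi_add, ← ePi_add]; congr 1; ring
  have hr : rho N (ξ + N) ζ τ = (-1) ^ N * rho N ξ ζ τ := by
    have e5 : ((-1 : ℂ) ^ N)⁻¹ = (-1) ^ N := by rw [← inv_pow]; norm_num
    have ek : kappaInv N (ξ + N) ζ τ = kappaInv N ξ ζ τ := by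
      rw [kappaInv, kappaInv]; simp only [e1, e2]
    have et : theta τ ζ / theta τ (ξ + N + ζ) = (-1) ^ N * (theta τ ζ / theta τ (ξ + ζ)) := by
      rw [show ξ + N + ζ = ξ + ζ + N by ring, theta_add_natCast, div_eq_mul_inv, mul_inv, e5]
      ring
    rw [rho, rho, tauN, tauN, ek, et, e3]
    generalize Theta (ePi ζ ^ (2 * N)) (ePi ζ * ePi (ζ / 2 - ξ) ^ 2) /
      Theta (ePi ζ ^ (2 * N)) (ePi ζ * (ePi (ζ / 2 - ξ) ^ 2)⁻¹) = X
    linear_combination (X * kappaInv N ξ ζ τ *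
      ((-1) ^ N * (theta τ ζ / theta τ (ξ + ζ))) / N) * e4
  rw [RHat_eq hτ, RHat_eq hτ, hr, SMat, SMat, Finset.smul_sum, Finset.smul_sum]
  refine Finset.sum_congr rfl fun α _ => ?_
  rw [smul_smul, wCoef_add_natCast, smul_smul, ZMod.natCast_self, zero_mul,
    AddChar.map_zero_eq_one, one_mul]
  congr 1
  have : ((-1 : ℂ) ^ N) * (-1) ^ N = 1 := by rw [← mul_pow]; norm_num
  linear_combination (rho N ξ ζ τ * wCoef N τ α ξ (ζ / N)) * this

lemma RHat_add_intCast_mul (hτ : 0 < τ.im) (ξ : ℂ) (j : ℤ) :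
    RHat N (ξ + j * N) ζ τ = RHat N ξ ζ τ := by
  have : Function.Periodic (fun ξ => RHat N ξ ζ τ) (N : ℂ) := RHat_add_natCast N hτ
  exact this.int_mul j ξ

lemma theta_ne_zero_of_ePi_ne (hτ : 0 < τ.im) (h : ∀ n : ℤ, ePi (2 * ζ) ≠ ePi (2 * τ) ^ n) :
    theta τ ζ ≠ 0 := by
  intro h0
  obtain ⟨m, n, rfl⟩ := (theta_eq_zero_iff hτ).mp h0
  apply h m
  rw [ePi_zpow, mul_add, ePi_add, (ePi_eq_one_iff (x := n)).mpr ⟨n, rfl⟩, mul_one]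
  congr 1; ring

lemma natCast_mul_div (ζ : ℂ) : N * (ζ / N) = ζ := mul_div_cancel₀ _ (natCast_ne_zero N)

/-- Unitarity of the normalized `R`-matrix. -/
lemma eventually_RHat_inv (hζ : 0 < ζ.im) (hτ : 0 < τ.im) (h0 : theta τ ζ ≠ 0) :
    ∀ᶠ ξ in codiscrete ℂ, rho N ξ ζ τ ≠ 0 ∧ theta τ (ζ + ξ) ≠ 0 ∧ theta τ (ξ - ζ) ≠ 0 ∧
      IsUnit (RHat N ξ ζ τ).det ∧
      (RHat N ξ ζ τ)⁻¹ = (-(theta τ ζ ^ 2 /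
        (rho N ξ ζ τ * N ^ 2 * (theta τ (ζ + ξ) * theta τ (ξ - ζ))))) •
          SFlip N τ (-ξ) (ζ / N) := by
  filter_upwards [eventually_rho_ne_zero N hζ hτ h0,
    eventually_add (eventually_theta_ne_zero hτ) ζ,
    eventually_add (eventually_theta_ne_zero hτ) (-ζ)] with ξ h1 h2 h3
  rw [add_comm] at h2
  rw [← sub_eq_add_neg] at h3
  have hN := natCast_ne_zero N
  have key : RHat N ξ ζ τ * ((-(theta τ ζ ^ 2 /
        (rho N ξ ζ τ * N ^ 2 * (theta τ (ζ + ξ) * theta τ (ξ - ζ))))) •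
          SFlip N τ (-ξ) (ζ / N)) = 1 := by
    rw [RHat_eq hτ, Matrix.mul_smul, Matrix.smul_mul,
      SMat_mul_SFlip hτ (by rwa [natCast_mul_div]), smul_smul, smul_smul, natCast_mul_div,
      show ζ - ξ = -(ξ - ζ) by ring, theta_neg hτ]
    conv_rhs => rw [← one_smul ℂ (1 : Matrix (ZMod N × ZMod N) (ZMod N × ZMod N) ℂ)]
    congr 1
    field_simp
  refine ⟨h1, h2, h3, ?_, Matrix.inv_eq_right_inv key⟩
  have := congrArg Matrix.det key
  rw [Matrix.det_mul, Matrix.det_one] at this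
  exact IsUnit.of_mul_eq_one _ this

/-- Crossing unitarity of the normalized `R`-matrix. -/
lemma exists_eventually_ptr_RHat (hN : 2 ≤ N) (hζ : 0 < ζ.im) (hτ : 0 < τ.im)
    (h0 : theta τ ζ ≠ 0) : ∃ C : ℂ, ∀ᶠ ξ in codiscrete ℂ,
      ∀ (A : Type) [Ring A] [Algebra ℂ A] (T : Matrix (ZMod N) (ZMod N) A),
        ptr (scal (RHat N (ξ - N * ζ) ζ τ) * leg₁ T * scal (RHat N ξ ζ τ)⁻¹) =
          C • Matrix.scalar _ T.trace := by
  obtain ⟨C, hC⟩ := exists_ptr_crossing N hτ hN (u := ζ / N) (by rwa [natCast_mul_div])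
  have hN0 := natCast_ne_zero N
  refine ⟨-(C * theta τ ζ ^ 2 / N ^ 2), ?_⟩
  filter_upwards [eventually_RHat_inv N hζ hτ h0, eventually_rho_crossing N hζ hτ] with ξ
    ⟨h1, h2, h3, _, h5⟩ h6 A _ _ T
  have hsq : (N : ℂ) ^ 2 * (ζ / N) = N * ζ := by field_simp
  have hC' := hC A ξ T
  rw [hsq] at hC'
  rw [h5, RHat_eq hτ, scal_smul, scal_smul, Matrix.smul_mul, Matrix.smul_mul, Matrix.mul_smul,
    map_smul, map_smul, hC', smul_smul, smul_smul]
  congr 1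
  field_simp
  linear_combination (-C) * h6

end

/-! ### The exchange relation of the transfer matrix with `L` -/

section
open Filter Topology

/-- The algebraic core of the exchange of a monodromy with a Lax operator. -/
lemma mul_mul_inv_exchange {S : Type*} [Ring S] [Algebra ℂ S]
    {a b b' w g g' R R' Rs Rs' P : S} {s s' : ℂ} (hs : s ≠ 0)
    (hgg : g * g' = 1) (hgg' : g' * g = 1) (hbb : b * b' = 1) (hbb' : b' * b = 1)
    (hR : R' * R = 1) (hRs : Rs * Rs' = 1)
    (hwg' : w * g' = g' * w)
    (h1 : P * a * w = w * a * Rs)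
    (h2 : (s • (g' * R * g)) * b * w = w * b * (s' • (g' * Rs * g))) :
    w * (a * (g * b' * g')) = (s' / s) • (P * (a * (g * b' * g')) * R' * w) := by
  have e1 : w * a = P * a * w * Rs' := by rw [h1, mul_assoc, hRs, mul_one]
  -- The second exchange relation is solved for the combination involving the inverse of `Rs`, the
  -- one produced by `e1`; this eliminates `Rs` altogether.
  have e3 : s • (w * Rs' * g * b') = s' • (g * b' * g' * R' * g * w) := by
    have h3 : s • (g' * R * g * b * (w * g') * Rs' * g * b') = s' • w := by
      have := congrArg (· * (g' * Rs' * g * b')) h2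
      simp only [smul_mul_assoc, mul_smul_comm] at this
      rw [show g' * R * g * b * (w * g') * Rs' * g * b' =
        g' * R * g * b * w * (g' * Rs' * g * b') by simp only [mul_assoc], this]
      congr 1
      calc w * b * (g' * Rs * g) * (g' * Rs' * g * b')
          = w * b * g' * Rs * (g * g') * Rs' * g * b' := by simp only [mul_assoc]
        _ = w * b * g' * (Rs * Rs') * g * b' := by rw [hgg, mul_one]; simp only [mul_assoc]
        _ = w * b * (g' * g) * b' := by rw [hRs, mul_one]; simp only [mul_assoc]
        _ = w := by rw [hgg', mul_one, mul_assoc, hbb, mul_one]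
    rw [hwg'] at h3
    have := congrArg (fun z => g * b' * g' * R' * g * z) h3
    simp only [mul_smul_comm] at this
    rw [← this]
    congr 1
    calc w * Rs' * g * b' = (g * g') * (w * Rs' * g * b') := by rw [hgg, one_mul]
      _ = g * (b' * b) * g' * w * Rs' * g * b' := by rw [hbb', mul_one]; simp only [mul_assoc]
      _ = g * b' * (g' * g) * b * g' * w * Rs' * g * b' := by
        rw [hgg', mul_one]; simp only [mul_assoc]
      _ = g * b' * g' * (R' * R) * g * b * g' * w * Rs' * g * b' := by
        rw [hR, mul_one]; simp only [mul_assoc]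
      _ = g * b' * g' * R' * (g * g') * R * g * b * g' * w * Rs' * g * b' := by
        rw [hgg, mul_one]; simp only [mul_assoc]
      _ = _ := by simp only [mul_assoc]
  have e4 : w * Rs' * g * b' = (s' / s) • (g * b' * g' * R' * g * w) := by
    rw [div_eq_inv_mul, mul_smul, ← e3, smul_smul, inv_mul_cancel₀ hs, one_smul]
  calc w * (a * (g * b' * g')) = P * a * (w * Rs' * g * b') * g' := by
        rw [← mul_assoc, e1]; simp only [mul_assoc]
    _ = (s' / s) • (P * a * (g * b' * g') * R' * (g * (w * g'))) := by
        rw [e4]; simp only [smul_mul_assoc, mul_smul_comm, mul_assoc]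
    _ = (s' / s) • (P * (a * (g * b' * g')) * R' * w) := by
        rw [hwg', ← mul_assoc g, hgg, one_mul]; simp only [mul_assoc]

end

/-! ### The structure function -/

section
open Filter Topology

variable (N : ℕ) [NeZero N] {ζ τ c : ℂ} {M : ℤ}

omit [NeZero N] in
lemma unitFun_add_intCast (ζ ξ : ℂ) (n : ℤ) : unitFun N ζ (ξ + n) = unitFun N ζ ξ := by
  have : Function.Periodic (unitFun N ζ) 1 := unitFun_add_one N ζ
  simpa using this.int_mul n ξ

lemma unitFun_sub_mul (hζ : 0 < ζ.im) (ξ : ℂ) : unitFun N ζ (ξ - N * ζ) = unitFun N ζ ξ := by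
  rw [← unitFun_add_mul N hζ (ξ - N * ζ), sub_add_cancel]

/-- The exchange factor of the transfer matrix with `L`, up to a constant. -/
def exchFun (ζ τ : ℂ) (M : ℤ) (x : ℂ) : ℂ :=
  if 0 < M then ∏ i ∈ Finset.range (N * M.natAbs), unitFun N ζ (x - i * (τ + 1))
  else ∏ i ∈ Finset.range (N * M.natAbs), (unitFun N ζ (x + (i + 1) * (τ + 1)))⁻¹

/-- The square of X corresponds to -x, whence the appeal to the evenness of `unitFun`. The factor t
that separates `unitFactor` from a plain theta quotient cancels in the ratio. -/
lemma YFactor_eq (hζ : 0 < ζ.im) {x X : ℂ} (hX : X ^ 2 = ePi (2 * -x)) (k : ℕ) :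
    YFactor N ζ τ X k = unitFun N ζ (x - k * (τ + 1)) / unitFun N ζ (x + k * (τ + 1)) := by
  have hQ := norm_ePi_pow_lt_one N hζ
  have ht : ePi ζ ^ 2 ≠ 0 := pow_ne_zero 2 (ePi_ne_zero ζ)
  have e1 : ePi (2 * (-(x - k * (τ + 1)))) = X ^ 2 * ePi (2 * τ) ^ k := by
    rw [hX, ePi_pow, ← ePi_add,
      show 2 * (-(x - k * (τ + 1))) = 2 * -x + k * (2 * τ) + 2 * k by ring,
      ePi_add _ (2 * (k : ℂ)), ePi_two_mul_natCast, mul_one]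
  have e2 : ePi (2 * (-(x + k * (τ + 1)))) = X ^ 2 * (ePi (2 * τ) ^ k)⁻¹ := by
    rw [hX, ePi_pow, ← ePi_neg, ← ePi_add,
      show 2 * (-(x + k * (τ + 1))) = 2 * -x + -(k * (2 * τ)) - 2 * k by ring,
      ePi_sub _ (2 * (k : ℂ)), ePi_two_mul_natCast, div_one]
  have hX0 : X ^ 2 ≠ 0 := hX ▸ ePi_ne_zero _
  have hk : ePi (2 * τ) ^ k ≠ 0 := pow_ne_zero k (ePi_ne_zero _)
  rw [← unitFun_neg N ζ (x - _), ← unitFun_neg N ζ (x + _), unitFun, unitFun, e1, e2,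
    unitFactor_eq hQ ht (mul_ne_zero hX0 hk),
    unitFactor_eq hQ ht (mul_ne_zero hX0 (inv_ne_zero hk)), mul_div_mul_left _ _ ht,
    div_div_div_eq, YFactor]
  simp only [mul_right_comm (X ^ 2) (ePi (2 * τ) ^ k), mul_right_comm (X ^ 2) (ePi (2 * τ) ^ k)⁻¹]
  congr 1 <;> ring

/-- The logarithm of p^M = q^{-2(c+N)/N}, multiplied by N/2, has an ambiguity in Nℤ, which is
harmless because N is a period of R̂. -/
lemma OnSurface.exists_eq (h : OnSurface N M ζ τ c) :
    ∃ j : ℤ, c * ζ = -(N * ζ) - N * M * (τ + 1) + j * N := by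
  have hN := natCast_ne_zero N
  have h2 : ePi (2 * ((N * M * τ + c * ζ + N * ζ) / N)) = 1 := by
    have := h.2
    rw [ePi_zpow] at this
    rw [show 2 * ((N * M * τ + c * ζ + N * ζ) / N) = M * (2 * τ) - ζ * (2 / N * (-c - N)) by
      field_simp; ring, ePi_sub, this, div_self (ePi_ne_zero _)]
  obtain ⟨k, hk⟩ := (ePi_eq_one_iff _).mp h2
  -- The summand M compensates for writing τ + 1 in place of τ.
  refine ⟨k + M, ?_⟩
  rw [div_eq_iff hN] at hk
  push_cast
  linear_combination hk

omit [NeZero N] in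
lemma natAbs_mul_of_pos (h : 0 < M) : ((N * M.natAbs : ℕ) : ℂ) = N * M := by
  have : (M.natAbs : ℤ) = M := Int.natAbs_of_nonneg h.le
  push_cast
  rw [← this]
  simp

omit [NeZero N] in
lemma natAbs_mul_of_neg (h : M < 0) : ((N * M.natAbs : ℕ) : ℂ) = -(N * M) := by
  have : (M.natAbs : ℤ) = -M := by omega
  have h' : ((M.natAbs : ℤ) : ℂ) = -M := by rw [this]; simp
  push_cast
  rw [Int.cast_natCast] at h'
  rw [h']; ring

lemma OnSurface.unitFun_add (hζ : 0 < ζ.im) (h : OnSurface N M ζ τ c) (x : ℂ) :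
    unitFun N ζ (x + c * ζ) = unitFun N ζ (x - N * M * (τ + 1)) := by
  obtain ⟨j, hj⟩ := h.exists_eq
  rw [hj, show x + (-(N * ζ) - N * M * (τ + 1) + j * N) =
    x - N * M * (τ + 1) - N * ζ + ((j * N : ℤ) : ℂ) by push_cast; ring, unitFun_add_intCast,
    unitFun_sub_mul N hζ]

lemma OnSurface.unitFun_sub (hζ : 0 < ζ.im) (h : OnSurface N M ζ τ c) (x : ℂ) :
    unitFun N ζ (x - c * ζ) = unitFun N ζ (x + N * M * (τ + 1)) := by
  obtain ⟨j, hj⟩ := h.exists_eq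
  rw [hj, show x - (-(N * ζ) - N * M * (τ + 1) + j * N) =
    x + N * M * (τ + 1) + N * ζ + ((-(j * N) : ℤ) : ℂ) by push_cast; ring, unitFun_add_intCast,
    unitFun_add_mul N hζ]

lemma OnSurface.RHat_add (hτ : 0 < τ.im) (h : OnSurface N M ζ τ c) (x : ℂ) :
    RHat N (x + c * ζ) ζ τ = RHat N (x - N * ζ - N * M * (τ + 1)) ζ τ := by
  obtain ⟨j, hj⟩ := h.exists_eq
  rw [hj, show x + (-(N * ζ) - N * M * (τ + 1) + j * N) =
    x - N * ζ - N * M * (τ + 1) + j * N by ring, RHat_add_intCast_mul N hτ]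

lemma eventually_unitFun_add_natCast_mul_ne_zero (hζ : 0 < ζ.im) (l : ℂ) :
    ∀ᶠ x in codiscrete ℂ, ∀ i ∈ Finset.range (N * M.natAbs + 1),
      unitFun N ζ (x + i * l) ≠ 0 :=
  (eventually_all_finset _).mpr fun i _ => eventually_add (eventually_unitFun_ne_zero N hζ) (i * l)

/-- On the surface `Σ_{N,M}`, the `R`-matrix at `ξ + cζ` and at `ξ - Nζ` are proportional. -/
lemma OnSurface.exists_eventually_RHat (hM : M ≠ 0) (hζ : 0 < ζ.im) (hτ : 0 < τ.im)
    (h : OnSurface N M ζ τ c) : ∃ K : ℂ, ∀ᶠ x in codiscrete ℂ, ∃ P : ℂ,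
      RHat N (x + c * ζ) ζ τ = P • RHat N (x - N * ζ) ζ τ ∧
        shiftFun N ζ (x + c * ζ) / shiftFun N ζ x * P = K * exchFun N ζ τ M x := by
  have hk := ePi_ne_zero (2 * ζ - 2 * ζ / N)
  rcases lt_or_gt_of_ne hM with hM | hM
  · refine ⟨ePi (2 * ζ - 2 * ζ / N) ^ (N * M.natAbs), ?_⟩
    filter_upwards [eventually_unitFun_add_natCast_mul_ne_zero N (M := M) hζ (τ + 1),
      eventually_add (eventually_RHat_add_mul N hζ hτ (Dvd.intro M.natAbs rfl)) (-(N * ζ))]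
      with x h1 h2
    refine ⟨∏ j ∈ Finset.range (N * M.natAbs), shiftFun N ζ (x - N * ζ + j * (τ + 1)), ?_, ?_⟩
    · simp only [← sub_eq_add_neg] at h2
      rw [h.RHat_add N hτ, ← h2, natAbs_mul_of_neg N hM]
      congr 1; ring
    · have e : ∀ j : ℕ, shiftFun N ζ (x - N * ζ + j * (τ + 1)) =
          ePi (2 * ζ - 2 * ζ / N) * (unitFun N ζ (x + j * (τ + 1)))⁻¹ := fun j => by
        rw [shiftFun, sub_add_eq_add_sub, unitFun_sub_mul N hζ, div_eq_mul_inv]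
      have e' : unitFun N ζ (x + c * ζ) =
          unitFun N ζ (x + (N * M.natAbs : ℕ) * (τ + 1)) := by
        rw [h.unitFun_add N hζ, natAbs_mul_of_neg N hM]; congr 1; ring
      simp only [e]
      rw [Finset.prod_mul_distrib, Finset.prod_const, Finset.card_range, shiftFun, shiftFun, e',
        exchFun, if_neg hM.not_gt]
      -- Splitting off the last factor, and then the first, compares the products over 0 ≤ i < N|M|
      -- and 1 ≤ i ≤ N|M|. The ratio of the two values of `shiftFun` is exactly the discrepancy.
      have h3 := Finset.prod_range_succ (fun i : ℕ => (unitFun N ζ (x + i * (τ + 1)))⁻¹)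
        (N * M.natAbs)
      rw [Finset.prod_range_succ'] at h3
      have h4 := h1 0 (by simp)
      have h5 := h1 (N * M.natAbs) (by simp)
      simp only [Nat.cast_zero, zero_mul, add_zero, Nat.cast_add, Nat.cast_one] at h3 h4
      generalize ∏ i ∈ Finset.range (N * M.natAbs), (unitFun N ζ (x + (i + 1) * (τ + 1)))⁻¹ = a at *
      generalize ∏ i ∈ Finset.range (N * M.natAbs), (unitFun N ζ (x + i * (τ + 1)))⁻¹ = b at *
      generalize unitFun N ζ x = v at *
      generalize unitFun N ζ (x + (N * M.natAbs : ℕ) * (τ + 1)) = w at *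
      generalize ePi _ = k at *
      generalize k ^ _ = kn
      field_simp at h3 ⊢
      linear_combination (-kn) * h3
  · refine ⟨(ePi (2 * ζ - 2 * ζ / N) ^ (N * M.natAbs))⁻¹, ?_⟩
    filter_upwards [eventually_unitFun_add_natCast_mul_ne_zero N (M := M) hζ (-(τ + 1)),
      eventually_add (eventually_RHat_add_mul N hζ hτ (Dvd.intro M.natAbs rfl))
        (-(N * ζ) - N * M * (τ + 1))] with x h1 h2
    rw [natAbs_mul_of_pos N hM] at h2
    have e : ∏ j ∈ Finset.range (N * M.natAbs),
        shiftFun N ζ (x + (-(N * ζ) - N * M * (τ + 1)) + j * (τ + 1)) =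
        ePi (2 * ζ - 2 * ζ / N) ^ (N * M.natAbs) *
          (∏ i ∈ Finset.range (N * M.natAbs), unitFun N ζ (x + (i + 1 : ℕ) * -(τ + 1)))⁻¹ := by
      rw [← Finset.prod_range_reflect, ← Finset.prod_inv_distrib,
        ← Finset.card_range (N * M.natAbs), ← Finset.prod_const, Finset.card_range,
        ← Finset.prod_mul_distrib]
      refine Finset.prod_congr rfl fun i hi => ?_
      have hi' := Finset.mem_range.mp hi
      rw [shiftFun, div_eq_mul_inv, ← unitFun_sub_mul N hζ (x + _)]
      congr 3
      rw [Nat.cast_sub (by omega), Nat.cast_sub (by omega), natAbs_mul_of_pos N hM]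
      push_cast
      ring
    rw [e] at h2
    have hne : (∏ i ∈ Finset.range (N * M.natAbs), unitFun N ζ (x + (i + 1 : ℕ) * -(τ + 1))) ≠ 0 :=
      Finset.prod_ne_zero_iff.mpr fun i hi => h1 _ (by simpa using hi)
    -- For M > 0 the point x + cζ lies, modulo N, N·M steps below x - Nζ, so the multi-step
    -- quasi-periodicity is started there and its scalar inverted.
    refine ⟨(ePi (2 * ζ - 2 * ζ / N) ^ (N * M.natAbs) * (∏ i ∈ Finset.range (N * M.natAbs),
      unitFun N ζ (x + (i + 1 : ℕ) * -(τ + 1)))⁻¹)⁻¹, ?_, ?_⟩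
    · rw [h.RHat_add N hτ, show x - N * ζ = x + (-(N * ζ) - N * M * (τ + 1)) + N * M * (τ + 1) by
        ring, h2, smul_smul, inv_mul_cancel₀, one_smul]
      · congr 1; ring
      · exact mul_ne_zero (pow_ne_zero _ hk) (inv_ne_zero hne)
    · have e' : unitFun N ζ (x + c * ζ) =
          unitFun N ζ (x + (N * M.natAbs : ℕ) * -(τ + 1)) := by
        rw [h.unitFun_add N hζ, natAbs_mul_of_pos N hM]; congr 1; ring
      have e'' : exchFun N ζ τ M x =
          ∏ i ∈ Finset.range (N * M.natAbs), unitFun N ζ (x + i * -(τ + 1)) := by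
        rw [exchFun, if_pos hM]
        exact Finset.prod_congr rfl fun i _ => by rw [mul_neg, sub_eq_add_neg]
      rw [shiftFun, shiftFun, e', e'']
      have h3 := Finset.prod_range_succ (fun i : ℕ => unitFun N ζ (x + i * -(τ + 1)))
        (N * M.natAbs)
      rw [Finset.prod_range_succ'] at h3
      have h4 := h1 0 (by simp)
      have h5 := h1 (N * M.natAbs) (by simp)
      simp only [Nat.cast_zero, zero_mul, add_zero] at h3 h4
      have hkn := pow_ne_zero (N * M.natAbs) hk
      generalize ∏ i ∈ Finset.range (N * M.natAbs), unitFun N ζ (x + (i + 1 : ℕ) * -(τ + 1)) = a at *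
      generalize ∏ i ∈ Finset.range (N * M.natAbs), unitFun N ζ (x + i * -(τ + 1)) = b at *
      generalize unitFun N ζ x = v at *
      generalize unitFun N ζ (x + (N * M.natAbs : ℕ) * -(τ + 1)) = w at *
      generalize ePi _ = k at *
      generalize k ^ _ = kn at *
      field_simp
      linear_combination h3

/-- On the surface, subtracting cζ amounts for `unitFun` to adding NM(τ+1). After reversing the
order of the product on the right, both sides consist of values at x ± k(τ+1). For M < 0 both
contain k = 0, which cancels and leaves N|M| - 1 factors. -/
lemma OnSurface.eventually_exchFun (hM : M ≠ 0) (hζ : 0 < ζ.im)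
    (h : OnSurface N M ζ τ c) : ∀ᶠ x in codiscrete ℂ, ∀ X : ℂ, X ^ 2 = ePi (2 * -x) →
      exchFun N ζ τ M (x - (τ + 1)) = Y N ζ τ M X * exchFun N ζ τ M (x - c * ζ) := by
  filter_upwards [eventually_unitFun_add_natCast_mul_ne_zero N (M := M) hζ (τ + 1),
    eventually_unitFun_add_natCast_mul_ne_zero N (M := M) hζ (-(τ + 1))] with x h1 h2 X hX
  have hsub : ∀ a : ℂ, unitFun N ζ (x - c * ζ + a) = unitFun N ζ (x + N * M * (τ + 1) + a) :=
    fun a => by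
      rw [show x - c * ζ + a = x + a - c * ζ by ring, h.unitFun_sub N hζ]; congr 1; ring
  rcases lt_or_gt_of_ne hM with hM | hM
  · obtain ⟨m, hm⟩ : ∃ m, N * M.natAbs = m + 1 := Nat.exists_eq_succ_of_ne_zero
      (mul_ne_zero (NeZero.ne N) (by omega))
    have hn := natAbs_mul_of_neg N hM
    rw [exchFun, exchFun, Y, if_neg hM.not_gt, if_neg hM.not_gt, if_neg hM.not_gt]
    have e1 : ∏ i ∈ Finset.range (N * M.natAbs), (unitFun N ζ (x - c * ζ + (i + 1) * (τ + 1)))⁻¹ =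
        ∏ i ∈ Finset.range (N * M.natAbs), (unitFun N ζ (x - i * (τ + 1)))⁻¹ := by
      rw [← Finset.prod_range_reflect]
      refine Finset.prod_congr rfl fun i hi => ?_
      have hi' := Finset.mem_range.mp hi
      rw [hsub]
      congr 2
      rw [Nat.cast_sub (by omega), Nat.cast_sub (by omega), hn]
      push_cast
      ring
    rw [e1, hm, Nat.add_sub_cancel, ← Finset.Ico_add_one_right_eq_Icc,
      Finset.prod_Ico_eq_prod_range, Nat.add_sub_cancel, Finset.prod_range_succ',
      Finset.prod_range_succ', ← mul_assoc, ← Finset.prod_mul_distrib]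
    congr 1
    · refine Finset.prod_congr rfl fun i hi => ?_
      have hi' := Finset.mem_range.mp hi
      have h3 := h2 (i + 1) (by rw [Finset.mem_range]; omega)
      rw [mul_neg, ← sub_eq_add_neg] at h3
      rw [YFactor_eq N hζ hX, add_comm 1 i, div_mul_eq_mul_div, mul_inv_cancel₀ h3, one_div]
      congr 2
      push_cast
      ring
    · congr 2
      push_cast
      ring
  · have hn := natAbs_mul_of_pos N hM
    rw [exchFun, exchFun, Y, if_pos hM, if_pos hM, if_pos hM]
    have e1 : ∏ i ∈ Finset.range (N * M.natAbs), unitFun N ζ (x - c * ζ - i * (τ + 1)) =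
        ∏ i ∈ Finset.range (N * M.natAbs), unitFun N ζ (x + (1 + i : ℕ) * (τ + 1)) := by
      rw [← Finset.prod_range_reflect]
      refine Finset.prod_congr rfl fun i hi => ?_
      have hi' := Finset.mem_range.mp hi
      rw [sub_eq_add_neg _ (_ * (τ + 1)), hsub]
      congr 1
      rw [Nat.cast_sub (by omega), Nat.cast_sub (by omega), hn]
      push_cast
      ring
    rw [e1, ← Finset.Ico_add_one_right_eq_Icc,
      Finset.prod_Ico_eq_prod_range, Nat.add_sub_cancel, ← Finset.prod_mul_distrib]
    refine Finset.prod_congr rfl fun i hi => ?_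
    have hi' := Finset.mem_range.mp hi
    rw [YFactor_eq N hζ hX, div_mul_cancel₀ _ (h1 (1 + i) (by rw [Finset.mem_range]; omega))]
    congr 1
    push_cast
    ring

end

/-! ### Exchange relations in an algebra -/

section
open Filter Topology

variable {N : ℕ} [NeZero N] {A : Type} [Ring A] [Algebra ℂ A] {ζ τ c : ℂ} {E : Set ℂ}
  {L Linv : ℂ → Matrix (ZMod N) (ZMod N) A}

/-- The product of `L⁺` and the inverse of `L⁻`, whose trace is the transfer matrix. -/
def monodromy (ζ τ c : ℂ) (L Linv : ℂ → Matrix (ZMod N) (ZMod N) A) (ξ : ℂ) :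
    Matrix (ZMod N) (ZMod N) A :=
  L (ξ + c * ζ) * (scal (GMat N) * Linv (ξ + τ + 1) * scal (GMat N)⁻¹)

lemma scal_kronecker_one (X : Matrix (ZMod N) (ZMod N) ℂ) :
    (scal (X ⊗ₖ (1 : Matrix (ZMod N) (ZMod N) ℂ)) : Matrix _ _ A) = leg₁ (scal X) := by
  rw [scal_kronecker, scal_one, leg₂, Matrix.one_kronecker_one, mul_one]

lemma scal_mul_scal_eq_one {n : Type} [Fintype n] [DecidableEq n] {X Y : Matrix n n ℂ}
    (h : X * Y = 1) : (scal X : Matrix n n A) * scal Y = 1 := by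
  rw [← scal_mul, h, scal_one]

lemma eventually_monodromy_exchange (hζ : 0 < ζ.im) (hτ : 0 < τ.im) (hτs : 0 < (τ - c * ζ).im)
    (h0 : theta τ ζ ≠ 0) (h0s : theta (τ - c * ζ) ζ ≠ 0) (hE : Eᶜ ∈ codiscrete ℂ)
    (hL : ∀ ξ, L ξ * Linv ξ = 1) (hL' : ∀ ξ, Linv ξ * L ξ = 1)
    (hex : ∀ ξ η, ξ - η ∉ E → exchangeLHS ζ τ L ξ η = exchangeRHS ζ τ c L ξ η) :
    ∀ᶠ x in codiscrete ℂ, ∀ ξ η, ξ - η = x →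
      leg₂ (L η) * leg₁ (monodromy ζ τ c L Linv ξ) =
        (shiftFun N ζ (x + c * ζ) / shiftFun N ζ x) • (scal (RHat N (x + c * ζ) ζ τ) *
          leg₁ (monodromy ζ τ c L Linv ξ) * scal (RHat N x ζ τ)⁻¹ * leg₂ (L η)) := by
  have hE' : ∀ᶠ x in codiscrete ℂ, x ∉ E := hE
  filter_upwards [eventually_add hE' (c * ζ), eventually_add hE' (τ + 1),
    eventually_RHat_inv N hζ hτ h0, eventually_add (eventually_RHat_inv N hζ hτs h0s) (c * ζ),
    eventually_RHat_shift N hζ hτ, eventually_add (eventually_RHat_shift N hζ hτs) (c * ζ),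
    eventually_unitFun_ne_zero N hζ] with x a1 a2 a3 a4 a5 a6 a7 ξ η hx
  have h1 := hex (ξ + c * ζ) η (by rwa [add_sub_right_comm, hx])
  have h2 := hex (ξ + (τ + 1)) η (by rwa [add_sub_right_comm, hx])
  rw [exchangeLHS, exchangeRHS, RHatStar, add_sub_right_comm, hx] at h1 h2
  -- The argument of the second R̂* is that of the first plus one quasi-period of its own modulus τ*
  -- = τ - cζ.
  rw [show x + c * ζ + (τ - c * ζ) + 1 = x + (τ + 1) by ring] at a6
  rw [a6, ← add_assoc x, a5, scal_smul, scal_smul, scal_mul, scal_mul, scal_mul, scal_mul,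
    scal_kronecker_one, scal_kronecker_one, ← add_assoc] at h2
  have hG := isUnit_det_GMat N
  have key := mul_mul_inv_exchange (S := Matrix (ZMod N × ZMod N) (ZMod N × ZMod N) A)
    (b' := leg₁ (Linv (ξ + τ + 1)))
    (R' := scal (RHat N x ζ τ)⁻¹) (Rs' := scal (RHat N (x + c * ζ) ζ (τ - c * ζ))⁻¹)
    (div_ne_zero (ePi_ne_zero _) a7)
    (by rw [← leg₁_mul, scal_mul_scal_eq_one (Matrix.mul_nonsing_inv _ hG), leg₁_one])
    (by rw [← leg₁_mul, scal_mul_scal_eq_one (Matrix.nonsing_inv_mul _ hG), leg₁_one])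
    (by rw [← leg₁_mul, hL, leg₁_one]) (by rw [← leg₁_mul, hL', leg₁_one])
    (scal_mul_scal_eq_one (Matrix.nonsing_inv_mul _ a3.2.2.2.1))
    (scal_mul_scal_eq_one (Matrix.mul_nonsing_inv _ a4.2.2.2.1))
    (leg₁_scal_mul_leg₂ _ _).symm h1 h2
  rw [monodromy, leg₁_mul, leg₁_mul, leg₁_mul, key]
  rfl

/-- The partial trace of the monodromy exchange: the surface condition replaces R̂(x+cζ) by a
multiple of R̂(x-Nζ), which is the argument required by crossing unitarity. -/
lemma eventually_L_mul_trace {M : ℤ} (hN : 2 ≤ N) (hM : M ≠ 0) (hζ : 0 < ζ.im) (hτ : 0 < τ.im)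
    (hτs : 0 < (τ - c * ζ).im) (hsurf : OnSurface N M ζ τ c)
    (h0 : theta τ ζ ≠ 0) (h0s : theta (τ - c * ζ) ζ ≠ 0) (hE : Eᶜ ∈ codiscrete ℂ)
    (hL : ∀ ξ, L ξ * Linv ξ = 1) (hL' : ∀ ξ, Linv ξ * L ξ = 1)
    (hex : ∀ ξ η, ξ - η ∉ E → exchangeLHS ζ τ L ξ η = exchangeRHS ζ τ c L ξ η) :
    ∃ K : ℂ, ∀ᶠ x in codiscrete ℂ, ∀ ξ η, ξ - η = x →
      L η * Matrix.scalar _ (monodromy ζ τ c L Linv ξ).trace = (K * exchFun N ζ τ M x) •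
        (Matrix.scalar _ (monodromy ζ τ c L Linv ξ).trace * L η) := by
  obtain ⟨C, hC⟩ := exists_eventually_ptr_RHat N hN hζ hτ h0
  obtain ⟨K, hK⟩ := hsurf.exists_eventually_RHat N hM hζ hτ
  refine ⟨K * C, ?_⟩
  filter_upwards [hC, hK, eventually_monodromy_exchange hζ hτ hτs h0 h0s hE hL hL' hex] with
    x h1 ⟨P, h2, h3⟩ h4 ξ η hx
  have h5 := congrArg ptr (h4 ξ η hx)
  rw [ptr_leg₂_mul, ptr_leg₁, map_smul, ptr_mul_leg₂, h2, scal_smul, Matrix.smul_mul,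
    Matrix.smul_mul, map_smul, h1, smul_smul, Matrix.smul_mul, smul_smul] at h5
  rw [h5]
  congr 1
  linear_combination C * h3

/-- The exchange relation of the transfer matrices for an arbitrary representation. -/
lemma eventually_trace_exchange {M : ℤ} (hN : 2 ≤ N) (hM : M ≠ 0) (hζ : 0 < ζ.im) (hτ : 0 < τ.im)
    (hτs : 0 < (τ - c * ζ).im) (hsurf : OnSurface N M ζ τ c)
    (h0 : theta τ ζ ≠ 0) (h0s : theta (τ - c * ζ) ζ ≠ 0) (hE : Eᶜ ∈ codiscrete ℂ)
    (hL : ∀ ξ, L ξ * Linv ξ = 1) (hL' : ∀ ξ, Linv ξ * L ξ = 1)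
    (hex : ∀ ξ η, ξ - η ∉ E → exchangeLHS ζ τ L ξ η = exchangeRHS ζ τ c L ξ η) :
    ∀ᶠ δ in codiscrete ℂ, ∀ ξ η, η - ξ = δ →
      (monodromy ζ τ c L Linv ξ).trace * (monodromy ζ τ c L Linv η).trace =
        Y N ζ τ M (ePi η / ePi ξ) • ((monodromy ζ τ c L Linv η).trace *
          (monodromy ζ τ c L Linv ξ).trace) := by
  obtain ⟨K, hK⟩ := eventually_L_mul_trace hN hM hζ hτ hτs hsurf h0 h0s hE hL hL' hex
  filter_upwards [eventually_neg (eventually_add hK (-(c * ζ))),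
    eventually_neg (eventually_add hK (-(τ + 1))),
    eventually_neg (hsurf.eventually_exchFun N hM hζ)] with δ h1 h2 h3 ξ η hδ
  have hX : (ePi η / ePi ξ) ^ 2 = ePi (2 * -(-δ)) := by
    rw [← ePi_sub, hδ, ePi_pow, neg_neg]; norm_num
  specialize h1 ξ (η + c * ζ) (by rw [← hδ]; ring)
  specialize h2 ξ (η + τ + 1) (by rw [← hδ]; ring)
  specialize h3 _ hX
  rw [← sub_eq_add_neg] at h1 h2
  rw [h3] at h2
  generalize Y N ζ τ M (ePi η / ePi ξ) = y at *
  have htr : ∀ T : Matrix (ZMod N) (ZMod N) A, ∀ t : A,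
      (Matrix.scalar _ t * T).trace = t * T.trace ∧ (T * Matrix.scalar _ t).trace = T.trace * t :=
    fun T t => by
      simp [Matrix.trace, Matrix.scalar_apply, Matrix.diagonal_mul, Matrix.mul_diagonal,
        Finset.mul_sum, Finset.sum_mul]
  have hcomm : ∀ (X : Matrix (ZMod N) (ZMod N) ℂ) (t : A),
      Matrix.scalar _ t * scal X = scal X * Matrix.scalar _ t := fun X t => by
    ext i j
    simp [Matrix.scalar_apply, Matrix.diagonal_mul, Matrix.mul_diagonal, scal, Algebra.commutes]
  generalize (monodromy ζ τ c L Linv ξ).trace = t at *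
  generalize exchFun N ζ τ M (-δ - c * ζ) = F at *
  -- Inverting L exchanges the two sides, so the factors for L(η+cζ) and L(η+τ+1)⁻¹ enter as a
  -- quotient.
  have h4 : Matrix.scalar _ t * Linv (η + τ + 1) =
      (K * (y * F)) • (Linv (η + τ + 1) * Matrix.scalar _ t) := by
    have := congrArg (fun Z => Linv (η + τ + 1) * Z * Linv (η + τ + 1)) h2
    simp only [mul_smul_comm, smul_mul_assoc] at this
    rw [← mul_assoc, hL', one_mul, ← mul_assoc (Linv _), mul_assoc _ (L _), hL, mul_one] at this
    exact this
  have h5 : (K * F) • (Matrix.scalar _ t * monodromy ζ τ c L Linv η) =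
      (K * (y * F)) • (monodromy ζ τ c L Linv η * Matrix.scalar _ t) := by
    rw [monodromy]
    set D := Matrix.scalar (ZMod N) t
    set B := Linv (η + τ + 1)
    have hD : ∀ X, D * scal X = scal X * D := fun X => hcomm X t
    calc (K * F) • (D * (L (η + c * ζ) * (scal (GMat N) * B * scal (GMat N)⁻¹)))
        = L (η + c * ζ) * (D * scal (GMat N)) * B * scal (GMat N)⁻¹ := by
          rw [← mul_assoc D, ← smul_mul_assoc, ← h1]; simp only [mul_assoc]
      _ = L (η + c * ζ) * scal (GMat N) * (D * B) * scal (GMat N)⁻¹ := by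
          rw [hD]; simp only [mul_assoc]
      _ = (K * (y * F)) • (L (η + c * ζ) * scal (GMat N) * B * (D * scal (GMat N)⁻¹)) := by
          rw [h4]; simp only [mul_assoc, mul_smul_comm, smul_mul_assoc]
      _ = _ := by rw [hD]; simp only [mul_assoc]
  -- If the exchange factor vanishes, the invertibility of L forces t(ξ) = 0 and both sides are
  -- zero.
  by_cases hF : K * F = 0
  · have ht : t = 0 := by
      rw [hF, zero_smul] at h1
      have h6 := congrArg (Linv (η + c * ζ) * ·) h1
      simp only [← mul_assoc, hL', one_mul, mul_zero] at h6
      simpa using congrFun (congrFun h6 0) 0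
    rw [ht, zero_mul, mul_zero, smul_zero]
  · have h6 := congrArg (fun Z => (K * F)⁻¹ • Z.trace) h5
    simp only [Matrix.trace_smul, smul_smul, (htr _ _).1, (htr _ _).2] at h6
    rwa [inv_mul_cancel₀ hF, one_smul, mul_left_comm K, mul_left_comm _ y, inv_mul_cancel₀ hF,
      mul_one] at h6

lemma trace_monodromy_eq_transfer (hL : ∀ ξ, L ξ * Linv ξ = 1)
    (hL' : ∀ ξ, Linv ξ * L ξ = 1) (ξ : ℂ) :
    transfer ζ τ c L ξ = (monodromy ζ τ c L Linv ξ).trace := by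
  have hG := isUnit_det_GMat N
  have g1 : (scal (GMat N) : Matrix _ _ A) * scal (GMat N)⁻¹ = 1 :=
    scal_mul_scal_eq_one (Matrix.mul_nonsing_inv _ hG)
  have g2 : (scal (GMat N)⁻¹ : Matrix _ _ A) * scal (GMat N) = 1 :=
    scal_mul_scal_eq_one (Matrix.nonsing_inv_mul _ hG)
  have h1 : LMinus τ L ξ * (scal (GMat N) * Linv (ξ + τ + 1) * scal (GMat N)⁻¹) = 1 := by
    calc _ = scal (GMat N) * L (ξ + τ + 1) * (scal (GMat N)⁻¹ * scal (GMat N)) *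
          Linv (ξ + τ + 1) * scal (GMat N)⁻¹ := by rw [LMinus]; simp only [mul_assoc]
      _ = scal (GMat N) * (L (ξ + τ + 1) * Linv (ξ + τ + 1)) * scal (GMat N)⁻¹ := by
        rw [g2, mul_one]; simp only [mul_assoc]
      _ = 1 := by rw [hL, mul_one, g1]
  have h2 : scal (GMat N) * Linv (ξ + τ + 1) * scal (GMat N)⁻¹ * LMinus τ L ξ = 1 := by
    calc _ = scal (GMat N) * Linv (ξ + τ + 1) * (scal (GMat N)⁻¹ * scal (GMat N)) *
          L (ξ + τ + 1) * scal (GMat N)⁻¹ := by rw [LMinus]; simp only [mul_assoc]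
      _ = scal (GMat N) * (Linv (ξ + τ + 1) * L (ξ + τ + 1)) * scal (GMat N)⁻¹ := by
        rw [g2, mul_one]; simp only [mul_assoc]
      _ = 1 := by rw [hL', mul_one, g1]
  rw [transfer, monodromy, LPlus, show ξ + c / 2 * ζ + c / 2 * ζ = ξ + c * ζ by ring]
  congr 2
  exact Ring.inverse_unit (⟨_, _, h1, h2⟩ : (Matrix (ZMod N) (ZMod N) A)ˣ)

end

/-! ### The elliptic algebras -/

section

variable {N : ℕ} [NeZero N] {A B : Type} [Ring A] [Algebra ℂ A] [Ring B] [Algebra ℂ B]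

lemma map_scal {n : Type} (f : A →ₐ[ℂ] B) (X : Matrix n n ℂ) : (scal X).map f = scal X := by
  ext i j
  simp [scal]

omit [NeZero N] in
lemma map_leg₁ (f : A →ₐ[ℂ] B) (X : Matrix (ZMod N) (ZMod N) A) :
    (leg₁ X).map f = leg₁ (X.map f) := by
  ext i j
  simp [leg₁, Matrix.kroneckerMap_apply, Matrix.one_apply, apply_ite f]

omit [NeZero N] in
lemma map_leg₂ (f : A →ₐ[ℂ] B) (X : Matrix (ZMod N) (ZMod N) A) :
    (leg₂ X).map f = leg₂ (X.map f) := by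
  ext i j
  simp [leg₂, Matrix.kroneckerMap_apply, Matrix.one_apply, apply_ite f]

lemma map_exchangeLHS (f : A →ₐ[ℂ] B) (ζ τ : ℂ) (L : ℂ → Matrix (ZMod N) (ZMod N) A) (ξ η : ℂ) :
    (exchangeLHS ζ τ L ξ η).map f = exchangeLHS ζ τ (fun ξ => (L ξ).map f) ξ η := by
  rw [exchangeLHS, exchangeLHS, Matrix.map_mul, Matrix.map_mul, map_scal, map_leg₁, map_leg₂]

lemma map_exchangeRHS (f : A →ₐ[ℂ] B) (ζ τ c : ℂ) (L : ℂ → Matrix (ZMod N) (ZMod N) A)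
    (ξ η : ℂ) :
    (exchangeRHS ζ τ c L ξ η).map f = exchangeRHS ζ τ c (fun ξ => (L ξ).map f) ξ η := by
  rw [exchangeRHS, exchangeRHS, Matrix.map_mul, Matrix.map_mul, map_scal, map_leg₁, map_leg₂]

variable (N) (ζ τ c : ℂ) (E : Set ℂ)

/-- The matrix `L(z)⁻¹` of `𝒜_{q,p}(ĝl(N)_c)`. -/
def glLinv (ξ : ℂ) : Matrix (ZMod N) (ZMod N) (EllGL N ζ τ c E) :=
  (freeLinv N ξ).map (RingQuot.mkAlgHom ℂ (GLRel N ζ τ c E))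

/-- The matrix `L(z)⁻¹` of `𝒜_{q,p}(ŝl(N)_c)`. -/
def slLinv (ξ : ℂ) : Matrix (ZMod N) (ZMod N) (EllSL N ζ τ c E) :=
  (glLinv N ζ τ c E ξ).map (RingQuot.mkAlgHom ℂ (SLRel N ζ τ c E))

lemma glL_mul_glLinv (ξ : ℂ) : glL N ζ τ c E ξ * glLinv N ζ τ c E ξ = 1 := by
  rw [glL, glLinv, ← Matrix.map_mul, ← Matrix.map_one (RingQuot.mkAlgHom ℂ (GLRel N ζ τ c E))
    (map_zero _) (map_one _)]
  ext i j
  exact RingQuot.mkAlgHom_rel ℂ (GLRel.mul_inv ξ i j)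

lemma glLinv_mul_glL (ξ : ℂ) : glLinv N ζ τ c E ξ * glL N ζ τ c E ξ = 1 := by
  rw [glL, glLinv, ← Matrix.map_mul, ← Matrix.map_one (RingQuot.mkAlgHom ℂ (GLRel N ζ τ c E))
    (map_zero _) (map_one _)]
  ext i j
  exact RingQuot.mkAlgHom_rel ℂ (GLRel.inv_mul ξ i j)

lemma glL_exchange (ξ η : ℂ) (h : ξ - η ∉ E) :
    exchangeLHS ζ τ (glL N ζ τ c E) ξ η = exchangeRHS ζ τ c (glL N ζ τ c E) ξ η := by
  have h1 := map_exchangeLHS (RingQuot.mkAlgHom ℂ (GLRel N ζ τ c E)) ζ τ (freeL N) ξ η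
  have h2 := map_exchangeRHS (RingQuot.mkAlgHom ℂ (GLRel N ζ τ c E)) ζ τ c (freeL N) ξ η
  rw [show glL N ζ τ c E = fun ξ => (freeL N ξ).map (RingQuot.mkAlgHom ℂ (GLRel N ζ τ c E)) from
    rfl, ← h1, ← h2]
  ext a b
  exact RingQuot.mkAlgHom_rel ℂ (GLRel.exchange ξ η h a b)

lemma slL_mul_slLinv (ξ : ℂ) : slL N ζ τ c E ξ * slLinv N ζ τ c E ξ = 1 := by
  rw [slL, slLinv, ← Matrix.map_mul, glL_mul_glLinv, Matrix.map_one _ (map_zero _) (map_one _)]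

lemma slLinv_mul_slL (ξ : ℂ) : slLinv N ζ τ c E ξ * slL N ζ τ c E ξ = 1 := by
  rw [slL, slLinv, ← Matrix.map_mul, glLinv_mul_glL, Matrix.map_one _ (map_zero _) (map_one _)]

lemma slL_exchange (ξ η : ℂ) (h : ξ - η ∉ E) :
    exchangeLHS ζ τ (slL N ζ τ c E) ξ η = exchangeRHS ζ τ c (slL N ζ τ c E) ξ η := by
  rw [show slL N ζ τ c E =
    fun ξ => (glL N ζ τ c E ξ).map (RingQuot.mkAlgHom ℂ (SLRel N ζ τ c E)) from rfl,
    ← map_exchangeLHS, ← map_exchangeRHS, glL_exchange N ζ τ c E ξ η h]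

end

end EllipticAlgebra

end

theorem theorem5 (N : ℕ) [NeZero N] (hN : 2 ≤ N) (M : ℤ) (hM : M ≠ 0) (ζ τ c : ℂ)
    (hζ : 0 < ζ.im) (hτ : 0 < τ.im) (hτstar : 0 < (τ - c * ζ).im)
    (hqp : ∀ n : ℤ, ePi (2 * ζ) ≠ ePi (2 * τ) ^ n)
    (hqpstar : ∀ n : ℤ,
      ePi (2 * ζ) ≠ ePi (2 * (τ - c * ζ)) ^ n)
    (hsurf : OnSurface N M ζ τ c)
    (E : Set ℂ) (hE : IsExceptionalSet N ζ τ c E) :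
    (∀ᶠ δ in Filter.codiscrete ℂ, ∀ ξ η : ℂ, η - ξ = δ →
      transfer ζ τ c (glL N ζ τ c E) ξ *
          transfer ζ τ c (glL N ζ τ c E) η =
        Y N ζ τ M (ePi η / ePi ξ) •
          (transfer ζ τ c (glL N ζ τ c E) η *
            transfer ζ τ c (glL N ζ τ c E) ξ)) ∧
    (∀ᶠ δ in Filter.codiscrete ℂ, ∀ ξ η : ℂ, η - ξ = δ →
      transfer ζ τ c (slL N ζ τ c E) ξ *
          transfer ζ τ c (slL N ζ τ c E) η =
        Y N ζ τ M (ePi η / ePi ξ) •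
          (transfer ζ τ c (slL N ζ τ c E) η *
            transfer ζ τ c (slL N ζ τ c E) ξ)) := by
  -- The conditions on q² say that ζ avoids the zeros of the theta functions of moduli τ and τ*;
  -- this makes R̂ and R̂* invertible away from a discrete set.
  have h0 : theta τ ζ ≠ 0 := theta_ne_zero_of_ePi_ne hτ hqp
  have h0s : theta (τ - c * ζ) ζ ≠ 0 := theta_ne_zero_of_ePi_ne hτstar hqpstar
  have hgl := eventually_trace_exchange hN hM hζ hτ hτstar hsurf h0 h0s hE.closed_discrete
    (glL_mul_glLinv N ζ τ c E) (glLinv_mul_glL N ζ τ c E) (glL_exchange N ζ τ c E)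
  have hsl := eventually_trace_exchange hN hM hζ hτ hτstar hsurf h0 h0s hE.closed_discrete
    (slL_mul_slLinv N ζ τ c E) (slLinv_mul_slL N ζ τ c E) (slL_exchange N ζ τ c E)
  simp only [← trace_monodromy_eq_transfer (A := EllGL N ζ τ c E) (glL_mul_glLinv N ζ τ c E)
    (glLinv_mul_glL N ζ τ c E)] at hgl
  simp only [← trace_monodromy_eq_transfer (A := EllSL N ζ τ c E) (slL_mul_slLinv N ζ τ c E)
    (slLinv_mul_slL N ζ τ c E)] at hsl
  exact ⟨hgl, hsl⟩
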